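/- **Setting.** $L_0$ is the pure second-order language (object variables and relation variables of all finite arities, no non-logical vocabulary), with Henkin semantics: a structure is $\mathcal M=(M,S_1[M],S_2[M],\dots)$ with $M\neq\emptyset$ and $S_n[M]\subseteq P(M^n)$ the range of the $n$-ary relation variables; the members of $S_1[M]$ are called concepts. Cardinal comparisons $|X|\le|Y|$, $|X|=|Y|$ in $\mathcal M$ are always witnessed by functions whose graphs belong to $\mathcal M$, and $X$ is infinite in $\mathcal M$ if some injection in $\mathcal M$ maps it into a proper subconcept of itself. The background logic consists of full comprehension, with parameters, for all formulas in the signature of the structure (including any abstraction operators), together with: any two concepts are comparable in cardinality; $|X\sqcup Y|=\max(|X|,|Y|)$ and $|X\times Y|=\max(|X|,|Y|)$ for infinite $X,Y$; and, for every $L_0$-formula $\Phi(X)$ with no other free variables, if some concept satisfies $\Phi$ then some concept satisfying $\Phi$ has least cardinality among those that do. The axiom of choice is not assumed. Let $E(X,Y)$ be an $L_0$-formula whose only free variables are the concept variables $X,Y$. For $\partial:S_1[M]\to M$, the theory $A_E[\partial]$ consists of the background logic in the signature with $\partial$ and the axiom $(\forall X,Y)(\partial X=\partial Y\leftrightarrow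 E(X,Y))$. The theory $A_E^2[\partial_1,\partial_2]$ consists of the background logic in the signature with both operators and this axiom for each of $\partial_1$ and $\partial_2$. (These axioms force $E$ to be an equivalence relation.) The model induced by $\partial_i$ is $$\mathcal M_i=(\operatorname{rng}\partial_i,\;S_1[M]\cap P(\operatorname{rng}\partial_i),\;S_2[M]\cap P((\operatorname{rng}\partial_i)^2),\dots,\;\partial_i),$$ and $\cong$ is isomorphism of such structures, with $\partial_1$ corresponding to $\partial_2$. Write $X\boxminus Y$ ($X,Y$ are bicardinally equivalent) if, in $\mathcal M$, $|X|=|Y|$ and $|M-X|=|M-Y|$. The principle $A_E$ is *bicardinality coarsening on abstracts* if every $(\mathcal M,\partial)\models A_E[\partial]$ with $\operatorname{rng}\partial=M$ satisfies $(\forall X,Y)(X\boxminus Y\to E(X,Y))$. **Theorem.** 1. Let $\mathcal M$ be a structure for which there are $\partial_1,\partial_2$ with $\mathcal M\models A_E^2[\partial_1,\partial_2]$ and $\operatorname{rng}\partial_1=\operatorname{rng}\partial_2=M$. Then $\mathcal M_1\cong\mathcal M_2$ for all such $\partial_1,\partial_2$ on $\mathcal M$ if and only if $\mathcal M\models(\forall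 X,Y)(X\boxminus Y\to E(X,Y))$. 2. The isomorphism $\mathcal M_1\cong\mathcal M_2$ holds for all $\mathcal M,\partial_1,\partial_2$ with $\mathcal M\models A_E^2[\partial_1,\partial_2]$ and $\operatorname{rng}\partial_1=\operatorname{rng}\partial_2=M$ if and only if $A_E$ is bicardinality coarsening on abstracts. -/

import Mathlib

universe u v

/-- Terms of the second-order language with abstraction operators `∂_d`, `d : ι`:
object variables `x_i`, and `∂_d X_j` with `X_j` a concept (unary relation) variable. -/
inductive SOTerm (ι : Type) : Type
  | var (i : ℕ) : SOTerm ι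
  | abs (d : ι) (j : ℕ) : SOTerm ι

/-- Formulas of the second-order language with abstraction operators `∂_d`, `d : ι`.
The `j`-th relation variable of arity `n` is the pair `(n, j)`. -/
inductive SOFormula (ι : Type) : Type
  | eq (s t : SOTerm ι) : SOFormula ι
  | rel (n j : ℕ) (t : Fin n → SOTerm ι) : SOFormula ι
  | neg (φ : SOFormula ι) : SOFormula ι
  | and (φ ψ : SOFormula ι) : SOFormula ι
  | allObj (i : ℕ) (φ : SOFormula ι) : SOFormula ι
  | allRel (n j : ℕ) (φ : SOFormula ι) : SOFormula ι

/-- `L₀`-formulas: no non-logical vocabulary at all. -/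
abbrev L0Formula : Type := SOFormula Empty

def SOTerm.freeObj {ι : Type} : SOTerm ι → Set ℕ
  | .var i => {i}
  | .abs _ _ => ∅

def SOTerm.freeRel {ι : Type} : SOTerm ι → Set (ℕ × ℕ)
  | .var _ => ∅
  | .abs _ j => {(1, j)}

/-- Free object variables. -/
def SOFormula.freeObj {ι : Type} : SOFormula ι → Set ℕ
  | .eq s t => s.freeObj ∪ t.freeObj
  | .rel _ _ t => ⋃ k, (t k).freeObj
  | .neg φ => φ.freeObj
  | .and φ ψ => φ.freeObj ∪ ψ.freeObj
  | .allObj i φ => φ.freeObj \ {i}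
  | .allRel _ _ φ => φ.freeObj

/-- Free relation variables, as pairs (arity, index). -/
def SOFormula.freeRel {ι : Type} : SOFormula ι → Set (ℕ × ℕ)
  | .eq s t => s.freeRel ∪ t.freeRel
  | .rel n j t => {(n, j)} ∪ ⋃ k, (t k).freeRel
  | .neg φ => φ.freeRel
  | .and φ ψ => φ.freeRel ∪ ψ.freeRel
  | .allObj _ φ => φ.freeRel
  | .allRel n j φ => φ.freeRel \ {(n, j)}

/-- A (Henkin) structure `(M, S₁[M], S₂[M], …)` with first-order domain `M`: `rel n` is the
collection `Sₙ[M]` of those subsets of `Mⁿ` over which the `n`-ary relation variables range; it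
need not be the full power set. (Arity `0` is allowed for uniformity; comprehension makes
`rel 0` the set of the two truth values.) -/
structure SOStructure (M : Type u) where
  rel : (n : ℕ) → Set (Set (Fin n → M))

namespace SOStructure

variable {M : Type u} {N : Type v} {ι : Type}

abbrev Rel (𝓜 : SOStructure M) (n : ℕ) : Type u := {R : Set (Fin n → M) // R ∈ 𝓜.rel n}

abbrev Concept (𝓜 : SOStructure M) : Type u := 𝓜.Rel 1

/-- The objects falling under a concept. -/
def ext {𝓜 : SOStructure M} (X : 𝓜.Concept) : Set M := {x | ![x] ∈ X.1}

/-- Assignments of values to the relation variables. -/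
abbrev RelAssign (𝓜 : SOStructure M) : Type u := (n : ℕ) → ℕ → 𝓜.Rel n

/-- The assignment which differs from `V` only in giving `(n, j)` the value `R`. -/
def RelAssign.set {𝓜 : SOStructure M} (V : 𝓜.RelAssign) (n j : ℕ) (R : 𝓜.Rel n) :
    𝓜.RelAssign :=
  Function.update V n (Function.update (V n) j R)

/-- Value of a term; the operator symbol `d` is interpreted by `D d`, a map from the concepts
of the structure to its objects. -/
def termVal (𝓜 : SOStructure M) (D : ι → 𝓜.Concept → M) (v : ℕ → M) (V : 𝓜.RelAssign) :
    SOTerm ι → M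
  | .var i => v i
  | .abs d j => D d (V 1 j)

/-- Satisfaction, in the non-standard (Henkin) semantics. -/
def Sat (𝓜 : SOStructure M) (D : ι → 𝓜.Concept → M) :
    SOFormula ι → (ℕ → M) → 𝓜.RelAssign → Prop
  | .eq s t, v, V => 𝓜.termVal D v V s = 𝓜.termVal D v V t
  | .rel n j t, v, V => (fun k => 𝓜.termVal D v V (t k)) ∈ (V n j).1
  | .neg φ, v, V => ¬ 𝓜.Sat D φ v V
  | .and φ ψ, v, V => 𝓜.Sat D φ v V ∧ 𝓜.Sat D ψ v V
  | .allObj i φ, v, V => ∀ a : M, 𝓜.Sat D φ (Function.update v i a) V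
  | .allRel n j φ, v, V => ∀ R : 𝓜.Rel n, 𝓜.Sat D φ v (V.set n j R)

/-- Truth of an `L₀`-formula under an assignment. -/
def Sat0 (𝓜 : SOStructure M) (φ : L0Formula) (v : ℕ → M) (V : 𝓜.RelAssign) : Prop :=
  𝓜.Sat (fun d : Empty => d.elim) φ v V

/-- `Φ(X)` in `𝓜`, for an `L₀`-formula `Φ` whose only free variable is the concept variable
`X₀` (so that the rest of the assignment is irrelevant). -/
def Holds1 (𝓜 : SOStructure M) (Φ : L0Formula) (X : 𝓜.Concept) : Prop :=
  ∀ (v : ℕ → M) (V : 𝓜.RelAssign), 𝓜.Sat0 Φ v (V.set 1 0 X)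

/-- `E(X, Y)` in `𝓜`, for an `L₀`-formula `E` whose only free variables are the concept
variables `X₀` and `X₁` (so that the rest of the assignment is irrelevant). -/
def Holds2 (𝓜 : SOStructure M) (E : L0Formula) (X Y : 𝓜.Concept) : Prop :=
  ∀ (v : ℕ → M) (V : 𝓜.RelAssign), 𝓜.Sat0 E v ((V.set 1 0 X).set 1 1 Y)

/-! Cardinality inside a structure: all functions are required to be relations of `𝓜`. -/

/-- `F` is (the graph of) an injection of `A` into `B`. -/
def IsInj (𝓜 : SOStructure M) (F : 𝓜.Rel 2) (A B : Set M) : Prop :=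
  (∀ x ∈ A, ∃! y, y ∈ B ∧ ![x, y] ∈ F.1) ∧
    ∀ x ∈ A, ∀ x' ∈ A, ∀ y ∈ B, ![x, y] ∈ F.1 → ![x', y] ∈ F.1 → x = x'

/-- `|A| ≤ |B|` in `𝓜`. -/
def CardLE (𝓜 : SOStructure M) (A B : Set M) : Prop :=
  ∃ F : 𝓜.Rel 2, 𝓜.IsInj F A B

/-- `|A| = |B|` in `𝓜`. -/
def CardEq (𝓜 : SOStructure M) (A B : Set M) : Prop :=
  ∃ F : 𝓜.Rel 2, 𝓜.IsInj F A B ∧ ∀ y ∈ B, ∃ x ∈ A, ![x, y] ∈ F.1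

/-- `|A ⊔ B| = |C|` in `𝓜`: there are injections of `A` and of `B` into `C` whose ranges
partition `C`. -/
def CardSumEq (𝓜 : SOStructure M) (A B C : Set M) : Prop :=
  ∃ F G : 𝓜.Rel 2, 𝓜.IsInj F A C ∧ 𝓜.IsInj G B C ∧
    (∀ z ∈ C, (∃ x ∈ A, ![x, z] ∈ F.1) ∨ (∃ y ∈ B, ![y, z] ∈ G.1)) ∧
    ∀ z ∈ C, ¬ ((∃ x ∈ A, ![x, z] ∈ F.1) ∧ (∃ y ∈ B, ![y, z] ∈ G.1))

/-- `|A × B| = |C|` in `𝓜`: some ternary relation of `𝓜` is the graph of a bijection. -/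
def CardProdEq (𝓜 : SOStructure M) (A B C : Set M) : Prop :=
  ∃ P : 𝓜.Rel 3, (∀ x ∈ A, ∀ y ∈ B, ∃! z, z ∈ C ∧ ![x, y, z] ∈ P.1) ∧
    ∀ z ∈ C, ∃! p : M × M, p.1 ∈ A ∧ p.2 ∈ B ∧ ![p.1, p.2, z] ∈ P.1

/-- `|X| ≥ ω` in `𝓜`: Dedekind infinite. -/
def DedekindInfinite (𝓜 : SOStructure M) (X : 𝓜.Concept) : Prop :=
  ∃ Z : 𝓜.Concept, ext Z ⊂ ext X ∧ 𝓜.CardLE (ext X) (ext Z)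

/-- `X` and `Y` are bicardinally equivalent in `𝓜`. -/
def BicardEquiv (𝓜 : SOStructure M) (X Y : 𝓜.Concept) : Prop :=
  𝓜.CardEq (ext X) (ext Y) ∧ 𝓜.CardEq (ext X)ᶜ (ext Y)ᶜ

/-- Full comprehension, with object and relation parameters, for all formulas in the signature
with the operators `D`: for every formula `φ` and all values of the parameters, the relation
`{(x₀, …, xₙ₋₁) | φ}` belongs to the structure. -/
def Comprehension (𝓜 : SOStructure M) (D : ι → 𝓜.Concept → M) : Prop :=
  ∀ (n : ℕ) (φ : SOFormula ι) (v : ℕ → M) (V : 𝓜.RelAssign),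
    {a : Fin n → M | 𝓜.Sat D φ (fun i => if h : i < n then a ⟨i, h⟩ else v i) V} ∈ 𝓜.rel n

/-- Every two concepts are comparable in cardinality. -/
def CardinalComparability (𝓜 : SOStructure M) : Prop :=
  ∀ X Y : 𝓜.Concept, 𝓜.CardLE (ext X) (ext Y) ∨ 𝓜.CardLE (ext Y) (ext X)

/-- `|X ⊔ Y| = max (|X|, |Y|)` for infinite `X` and `Y`. -/
def InfiniteSumsAreMaxima (𝓜 : SOStructure M) : Prop :=
  ∀ X Y : 𝓜.Concept, 𝓜.DedekindInfinite X → 𝓜.DedekindInfinite Y →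
    (𝓜.CardLE (ext X) (ext Y) → 𝓜.CardSumEq (ext X) (ext Y) (ext Y)) ∧
    (𝓜.CardLE (ext Y) (ext X) → 𝓜.CardSumEq (ext X) (ext Y) (ext X))

/-- `|X × Y| = max (|X|, |Y|)` for infinite `X` and `Y`. -/
def InfiniteProductsAreMaxima (𝓜 : SOStructure M) : Prop :=
  ∀ X Y : 𝓜.Concept, 𝓜.DedekindInfinite X → 𝓜.DedekindInfinite Y →
    (𝓜.CardLE (ext X) (ext Y) → 𝓜.CardProdEq (ext X) (ext Y) (ext Y)) ∧
    (𝓜.CardLE (ext Y) (ext X) → 𝓜.CardProdEq (ext X) (ext Y) (ext X))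

/-- Every satisfied `L₀`-formula `Φ(X)` is satisfied by some `X` of least cardinality. -/
def CardinalsWellFounded (𝓜 : SOStructure M) : Prop :=
  ∀ Φ : L0Formula, Φ.freeObj = ∅ → Φ.freeRel ⊆ {(1, 0)} → (∃ X, 𝓜.Holds1 Φ X) →
    ∃ X, 𝓜.Holds1 Φ X ∧ ∀ Y, 𝓜.Holds1 Φ Y → 𝓜.CardLE (ext X) (ext Y)

/-- `(𝓜, D)` is a model of the background logic: all sorts are non-empty, full comprehension
holds in the signature with the operators `D`, and cardinalities are well behaved. There is no
axiom of choice. -/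
structure IsModel (𝓜 : SOStructure M) (D : ι → 𝓜.Concept → M) : Prop where
  nonempty_obj : Nonempty M
  nonempty_rel : ∀ n, (𝓜.rel n).Nonempty
  comprehension : 𝓜.Comprehension D
  comparability : 𝓜.CardinalComparability
  sums : 𝓜.InfiniteSumsAreMaxima
  products : 𝓜.InfiniteProductsAreMaxima
  wellFounded : 𝓜.CardinalsWellFounded

/-- The abstraction principle `(∀ X, Y) (∂ X = ∂ Y ↔ E(X, Y))`. -/
def AbstractionPrinciple (𝓜 : SOStructure M) (E : L0Formula) (δ : 𝓜.Concept → M) : Prop :=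
  ∀ X Y : 𝓜.Concept, δ X = δ Y ↔ 𝓜.Holds2 E X Y

/-- `(𝓜, ∂) ⊨ A_E[∂]`. -/
def ModelsA (𝓜 : SOStructure M) (E : L0Formula) (δ : 𝓜.Concept → M) : Prop :=
  𝓜.IsModel (fun _ : Unit => δ) ∧ 𝓜.AbstractionPrinciple E δ

/-- `(𝓜, ∂₁, ∂₂) ⊨ A²_E[∂₁, ∂₂]`. Comprehension is for formulas in which both operators
may occur. -/
def ModelsA2 (𝓜 : SOStructure M) (E : L0Formula) (δ₁ δ₂ : 𝓜.Concept → M) : Prop :=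
  𝓜.IsModel ![δ₁, δ₂] ∧ 𝓜.AbstractionPrinciple E δ₁ ∧ 𝓜.AbstractionPrinciple E δ₂

/-- The image of an `n`-ary relation under a map of objects. -/
def relImage {n : ℕ} (f : M → N) (R : Set (Fin n → M)) : Set (Fin n → N) :=
  (fun a => f ∘ a) '' R

/-- The structure `(rng ∂, S₁[M] ∩ P(rng ∂), S₂[M] ∩ P(rng ∂ × rng ∂), …)`. -/
def induced (𝓜 : SOStructure M) (δ : 𝓜.Concept → M) : SOStructure (Set.range δ) where
  rel n := {R | relImage Subtype.val R ∈ 𝓜.rel n}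

/-- The operator `∂` on the structure that it induces. -/
def inducedOp (𝓜 : SOStructure M) (δ : 𝓜.Concept → M) :
    (𝓜.induced δ).Concept → Set.range δ :=
  fun X => ⟨δ ⟨relImage Subtype.val X.1, X.2⟩, Set.mem_range_self _⟩

/-- `(𝓜, δ) ≅ (𝓝, ε)`: some bijection of the domains carries the relations of `𝓜` exactly
to those of `𝓝` and commutes with the operators. -/
def Isomorphic (𝓜 : SOStructure M) (δ : 𝓜.Concept → M)
    (𝓝 : SOStructure N) (ε : 𝓝.Concept → N) : Prop :=
  ∃ f : M ≃ N, (∀ (n : ℕ) (R : Set (Fin n → M)), R ∈ 𝓜.rel n ↔ relImage f R ∈ 𝓝.rel n) ∧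
    ∀ (X : 𝓜.Concept) (Y : 𝓝.Concept), Y.1 = relImage f X.1 → f (δ X) = ε Y

/-- The models `𝓜₁`, `𝓜₂` induced by `∂₁`, `∂₂` are isomorphic. -/
def InducedIsomorphic (𝓜 : SOStructure M) (δ₁ δ₂ : 𝓜.Concept → M) : Prop :=
  Isomorphic (𝓜.induced δ₁) (𝓜.inducedOp δ₁) (𝓜.induced δ₂) (𝓜.inducedOp δ₂)

/-- `𝓜 ⊨ (∀ X, Y) (X ⊟ Y → E(X, Y))`. -/
def BicardCoarse (𝓜 : SOStructure M) (E : L0Formula) : Prop :=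
  ∀ X Y : 𝓜.Concept, 𝓜.BicardEquiv X Y → 𝓜.Holds2 E X Y

end SOStructure

/-- `A_E` is bicardinality coarsening on abstracts: that bicardinally equivalent concepts are
`E`-equivalent is a consequence of `A_E[∂]` and `rng ∂ = M`. -/
def BicardCoarseningOnAbstracts (E : L0Formula) : Prop :=
  ∀ (M : Type u) (𝓜 : SOStructure M) (δ : 𝓜.Concept → M),
    𝓜.ModelsA E δ → Function.Surjective δ → 𝓜.BicardCoarse E

/-!
Call two concepts *equivalent* if `E` holds of them, that is, if they have the same abstract.

If bicardinal equivalence implies `E`, then `∂₁ X ↦ ∂₂ X` is a well defined permutation `f` of the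
domain. By comprehension its graph is a relation of the structure, so that `f` is an automorphism
and `X` is bicardinally equivalent to its image `f X`; hence `f (∂₁ X) = ∂₂ X = ∂₂ (f X)`, and `f`
is an isomorphism (`inducedIsomorphic_of_bicardCoarse`).

If it does not, some concept `X₀` is bicardinally equivalent to an inequivalent one, and two
permutations `π₁`, `π₂` in the structure are constructed for which `(𝓜, π₁ ∘ ∂)` and `(𝓜, π₂ ∘ ∂)`
are not isomorphic (`exists_iPerm_of_not_bicardCoarse`). They satisfy comprehension for both
operators together because formulas about them translate into formulas about `∂` with parameters
(`IsModel.of_definable`). Replacing `E (X, Y)` and `∂ X` by `E (Xᶜ, Yᶜ)` and `∂ Xᶜ` if necessary,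
one may assume that `|X₀| ≤ |X₀ᶜ|` and, by the last axiom of the background logic, that `X₀` is of
least cardinality. When the domain is infinite, the class `O` of the concepts bicardinally
equivalent to `X₀` is then invariant under all automorphisms of the structure.

*Infinite domain.* All permutations in the structure preserve equivalence. Hence concepts in `O` can
be equivalent only if they differ by fewer objects than they have: any equivalent pair that
violates this can be moved around so as to make all of `O` equivalent (`eq_of_large_diff`,
`eq_of_finite`). To exclude that `X₀` is as large as the domain, one codes all concepts by
concepts in `O` that differ much, and so names them all by objects, which Russell's argument forbids
(`not_big_of_bad`). The invariant that distinguishes the two models is the existence of a concept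
`S` such that, for all `Z` in `O`, the abstract of `Z` belongs to `S` if and only if
`|Z| > |Z ∩ S|`. Whether `|Z| > |Z ∩ S|` depends on the abstract of `Z` only. So for any `S` which
is, with its complement, as large as the domain, the abstracts can be permuted to make this true
(`exists_iPerm_liar`). On the other hand there is a family of inequivalent `Z_a ⊆ A`, `a ∈ A`,
which is paradoxical: no `S` satisfies
`a ∈ S ↔ |Z_a| > |Z_a ∩ S|` for all `a ∈ A`. Permuting the abstracts so that the abstract of `Z_a`
becomes `a` makes the invariant false (`exists_iPerm_no_liar`).

*Finite domain.* Here equivalence in `O` is equality up to complements (`eq_or_eq_compl`), and no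
concept in `O` has the abstract of `∅`. Counting shows that `X₀` has two elements, as has its
complement, and then `∂ {∂ ∅, t} = t` for `t ≠ ∂ ∅` is an invariant that can be made true and false
(`exists_iPerm_pairs`).

All of this takes place inside the structure. The recurring task of checking that a relation belongs
to it is reduced to the closure properties of `SOStructure.Internal`, and functions of the structure
are represented by total functions on the domain with internal graphs.
-/

/-! ### Formulas and satisfaction -/

namespace SOFormula

variable {ι : Type}

/-- Disjunction. -/
def or (φ ψ : SOFormula ι) : SOFormula ι := .neg (.and (.neg φ) (.neg ψ))
/-- Implication. -/
def imp (φ ψ : SOFormula ι) : SOFormula ι := .neg (.and φ (.neg ψ))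
/-- Equivalence. -/
def iff (φ ψ : SOFormula ι) : SOFormula ι := .and (.imp φ ψ) (.imp ψ φ)
/-- `∃ x_i, φ`. -/
def exObj (i : ℕ) (φ : SOFormula ι) : SOFormula ι := .neg (.allObj i (.neg φ))
/-- `∃ R, φ`, for the `j`-th relation variable `R` of arity `n`. -/
def exRel (n j : ℕ) (φ : SOFormula ι) : SOFormula ι := .neg (.allRel n j (.neg φ))
/-- `x_i` falls under the concept variable `X_j`. -/
def mem (i j : ℕ) : SOFormula ι := .rel 1 j ![.var i]
/-- The `j`-th binary relation variable holds of `x_i, x_k`. -/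
def app (i k j : ℕ) : SOFormula ι := .rel 2 j ![.var i, .var k]
/-- `x_i = x_k`. -/
def eqv (i k : ℕ) : SOFormula ι := .eq (.var i) (.var k)
/-- `x_i = ∂_d X_j`. -/
def isAbs (i : ℕ) (d : ι) (j : ℕ) : SOFormula ι := .eq (.var i) (.abs d j)

end SOFormula

namespace SOStructure

variable {M : Type u} {ι κ : Type} {𝓜 : SOStructure M}

namespace RelAssign

@[simp] theorem set_same (V : 𝓜.RelAssign) (n j : ℕ) (R : 𝓜.Rel n) : V.set n j R n j = R := by
  simp [RelAssign.set]

@[simp] theorem set_index_ne (V : 𝓜.RelAssign) {n j j' : ℕ} (R : 𝓜.Rel n) (h : j' ≠ j) :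
    V.set n j R n j' = V n j' := by
  simp [RelAssign.set, h]

@[simp] theorem set_arity_ne (V : 𝓜.RelAssign) {n n' : ℕ} (j : ℕ) (R : 𝓜.Rel n) (h : n' ≠ n) :
    V.set n j R n' = V n' := by
  simp [RelAssign.set, h]

end RelAssign

section Sat

variable (D : ι → 𝓜.Concept → M) (v : ℕ → M) (V : 𝓜.RelAssign)

@[simp] theorem sat_neg (φ : SOFormula ι) : 𝓜.Sat D (.neg φ) v V ↔ ¬ 𝓜.Sat D φ v V := Iff.rfl

@[simp] theorem sat_and (φ ψ : SOFormula ι) :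
    𝓜.Sat D (.and φ ψ) v V ↔ 𝓜.Sat D φ v V ∧ 𝓜.Sat D ψ v V := Iff.rfl

@[simp] theorem sat_allObj (i : ℕ) (φ : SOFormula ι) :
    𝓜.Sat D (.allObj i φ) v V ↔ ∀ a, 𝓜.Sat D φ (Function.update v i a) V := Iff.rfl

@[simp] theorem sat_allRel (n j : ℕ) (φ : SOFormula ι) :
    𝓜.Sat D (.allRel n j φ) v V ↔ ∀ R, 𝓜.Sat D φ v (V.set n j R) := Iff.rfl

@[simp] theorem sat_or (φ ψ : SOFormula ι) :
    𝓜.Sat D (.or φ ψ) v V ↔ 𝓜.Sat D φ v V ∨ 𝓜.Sat D ψ v V := by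
  simp [SOFormula.or]; tauto

@[simp] theorem sat_imp (φ ψ : SOFormula ι) :
    𝓜.Sat D (.imp φ ψ) v V ↔ (𝓜.Sat D φ v V → 𝓜.Sat D ψ v V) := by
  simp [SOFormula.imp]

@[simp] theorem sat_iff (φ ψ : SOFormula ι) :
    𝓜.Sat D (.iff φ ψ) v V ↔ (𝓜.Sat D φ v V ↔ 𝓜.Sat D ψ v V) := by
  simp [SOFormula.iff]; tauto

@[simp] theorem sat_exObj (i : ℕ) (φ : SOFormula ι) :
    𝓜.Sat D (.exObj i φ) v V ↔ ∃ a, 𝓜.Sat D φ (Function.update v i a) V := by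
  simp [SOFormula.exObj]

@[simp] theorem sat_exRel (n j : ℕ) (φ : SOFormula ι) :
    𝓜.Sat D (.exRel n j φ) v V ↔ ∃ R, 𝓜.Sat D φ v (V.set n j R) := by
  simp [SOFormula.exRel]

@[simp] theorem sat_mem (i j : ℕ) : 𝓜.Sat D (.mem i j) v V ↔ v i ∈ ext (V 1 j) := by
  have : (fun k => 𝓜.termVal D v V ((![.var i] : Fin 1 → SOTerm ι) k)) = ![v i] := by
    ext k; fin_cases k; rfl
  simp only [SOFormula.mem, Sat, this, ext, Set.mem_ofPred_eq]

@[simp] theorem sat_app (i k j : ℕ) :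
    𝓜.Sat D (.app i k j) v V ↔ ![v i, v k] ∈ (V 2 j).1 := by
  have : (fun l => 𝓜.termVal D v V ((![.var i, .var k] : Fin 2 → SOTerm ι) l)) = ![v i, v k] := by
    ext l; fin_cases l <;> rfl
  simp only [SOFormula.app, Sat, this]

@[simp] theorem sat_eqv (i k : ℕ) : 𝓜.Sat D (.eqv i k) v V ↔ v i = v k := Iff.rfl

@[simp] theorem sat_isAbs (i j : ℕ) (d : ι) :
    𝓜.Sat D (.isAbs i d j) v V ↔ v i = D d (V 1 j) := Iff.rfl

end Sat

/-! ### Truth depends only on the free variables, and is invariant under automorphisms -/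

theorem sat_congr (D : ι → 𝓜.Concept → M) (φ : SOFormula ι) :
    ∀ {v v' : ℕ → M} {V V' : 𝓜.RelAssign}, (∀ i ∈ φ.freeObj, v i = v' i) →
      (∀ p ∈ φ.freeRel, V p.1 p.2 = V' p.1 p.2) → (𝓜.Sat D φ v V ↔ 𝓜.Sat D φ v' V') := by
  have hterm : ∀ (s : SOTerm ι) {v v' : ℕ → M} {V V' : 𝓜.RelAssign},
      (∀ i ∈ s.freeObj, v i = v' i) → (∀ p ∈ s.freeRel, V p.1 p.2 = V' p.1 p.2) →
      𝓜.termVal D v V s = 𝓜.termVal D v' V' s := by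
    rintro (i | ⟨d, j⟩) v v' V V' h1 h2
    · exact h1 i rfl
    · exact congrArg (D d) (h2 (1, j) rfl)
  induction φ with
  | eq s t =>
    intro v v' V V' h1 h2
    simp only [Sat]
    rw [hterm s (fun i hi => h1 i (Or.inl hi)) (fun p hp => h2 p (Or.inl hp)),
      hterm t (fun i hi => h1 i (Or.inr hi)) (fun p hp => h2 p (Or.inr hp))]
  | rel n j t =>
    intro v v' V V' h1 h2
    simp only [Sat]
    have h3 : V n j = V' n j := h2 (n, j) (Or.inl rfl)
    have h4 : (fun k => 𝓜.termVal D v V (t k)) = fun k => 𝓜.termVal D v' V' (t k) := by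
      funext k
      exact hterm (t k) (fun i hi => h1 i (Set.mem_iUnion.2 ⟨k, hi⟩))
        (fun p hp => h2 p (Or.inr (Set.mem_iUnion.2 ⟨k, hp⟩)))
    rw [h3, h4]
  | neg φ ih => intro v v' V V' h1 h2; exact not_congr (ih h1 h2)
  | and φ ψ ih1 ih2 =>
    intro v v' V V' h1 h2
    exact and_congr (ih1 (fun i hi => h1 i (Or.inl hi)) (fun p hp => h2 p (Or.inl hp)))
      (ih2 (fun i hi => h1 i (Or.inr hi)) (fun p hp => h2 p (Or.inr hp)))
  | allObj i φ ih =>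
    intro v v' V V' h1 h2
    refine forall_congr' fun a => ih (fun k hk => ?_) h2
    by_cases hki : k = i
    · subst hki; simp
    · simp only [Function.update_of_ne hki]; exact h1 k ⟨hk, hki⟩
  | allRel n j φ ih =>
    intro v v' V V' h1 h2
    refine forall_congr' fun R => ih h1 fun p hp => ?_
    obtain ⟨m, k⟩ := p
    by_cases hm : m = n
    · subst hm
      by_cases hk : k = j
      · subst hk; simp
      · simp only [RelAssign.set_index_ne _ _ hk]
        exact h2 (m, k) ⟨hp, by simpa using hk⟩
    · simp only [RelAssign.set_arity_ne _ _ _ hm]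
      exact h2 (m, k) ⟨hp, by simp [hm]⟩

/-- A permutation of the objects which carries the relations of `𝓜` exactly to relations
of `𝓜`. It need not itself belong to `𝓜`. -/
def IsAut (𝓜 : SOStructure M) (f : M ≃ M) : Prop :=
  ∀ (n : ℕ) (R : Set (Fin n → M)), R ∈ 𝓜.rel n ↔ relImage f R ∈ 𝓜.rel n

theorem mem_relImage {n : ℕ} (f : M ≃ M) (R : Set (Fin n → M)) (a : Fin n → M) :
    a ∈ relImage f R ↔ f.symm ∘ a ∈ R := by
  constructor
  · rintro ⟨b, hb, rfl⟩
    simpa [Function.comp_def] using hb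
  · intro h
    exact ⟨_, h, by ext; simp⟩

theorem comp_mem_relImage {n : ℕ} (f : M ≃ M) (R : Set (Fin n → M)) (a : Fin n → M) :
    f ∘ a ∈ relImage f R ↔ a ∈ R := by
  rw [mem_relImage]
  simp [Function.comp_def]

theorem relImage_symm_relImage {n : ℕ} (f : M ≃ M) (R : Set (Fin n → M)) :
    relImage f.symm (relImage f R) = R := by
  ext a
  rw [mem_relImage, mem_relImage]
  simp [Function.comp_def]

/-- The action of an automorphism on the relations of the structure. -/
def IsAut.map {f : M ≃ M} (hf : 𝓜.IsAut f) {n : ℕ} : 𝓜.Rel n ≃ 𝓜.Rel n where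
  toFun R := ⟨relImage f R.1, (hf n R.1).1 R.2⟩
  invFun R := ⟨relImage f.symm R.1, by
    have : relImage f (relImage f.symm R.1) = R.1 := relImage_symm_relImage f.symm R.1
    rw [hf, this]; exact R.2⟩
  left_inv R := Subtype.ext (relImage_symm_relImage f R.1)
  right_inv R := Subtype.ext (relImage_symm_relImage f.symm R.1)

theorem IsAut.symm {f : M ≃ M} (hf : 𝓜.IsAut f) : 𝓜.IsAut f.symm := fun n R => by
  have : relImage f (relImage f.symm R) = R := relImage_symm_relImage f.symm R
  rw [hf n (relImage f.symm R), this]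

theorem IsAut.map_set {f : M ≃ M} (hf : 𝓜.IsAut f) (V : 𝓜.RelAssign) (n j : ℕ) (R : 𝓜.Rel n) :
    (fun m k => hf.map (V.set n j R m k)) =
      RelAssign.set (𝓜 := 𝓜) (fun m k => hf.map (V m k)) n j (hf.map R) := by
  funext m k
  by_cases hm : m = n
  · subst hm
    by_cases hk : k = j
    · subst hk; simp
    · simp [hk]
  · rw [RelAssign.set_arity_ne _ _ _ hm, RelAssign.set_arity_ne _ _ _ hm]

theorem IsAut.sat_iff {f : M ≃ M} (hf : 𝓜.IsAut f) {D D' : ι → 𝓜.Concept → M}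
    (hD : ∀ d X, f (D d X) = D' d (hf.map X)) (φ : SOFormula ι) :
    ∀ (v : ℕ → M) (V : 𝓜.RelAssign),
      𝓜.Sat D φ v V ↔ 𝓜.Sat D' φ (f ∘ v) (fun n j => hf.map (V n j)) := by
  have hterm : ∀ (s : SOTerm ι) (v : ℕ → M) (V : 𝓜.RelAssign),
      𝓜.termVal D' (f ∘ v) (fun n j => hf.map (V n j)) s = f (𝓜.termVal D v V s) := by
    rintro (i | ⟨d, j⟩) v V
    · rfl
    · exact (hD d _).symm
  induction φ with
  | eq s t => intro v V; simp only [Sat, hterm, f.apply_eq_iff_eq]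
  | rel n j t =>
    intro v V
    simp only [Sat, hterm]
    exact (comp_mem_relImage f _ _).symm
  | neg φ ih => intro v V; exact not_congr (ih v V)
  | and φ ψ ih1 ih2 => intro v V; exact and_congr (ih1 v V) (ih2 v V)
  | allObj i φ ih =>
    intro v V
    refine Iff.trans (forall_congr' fun a => ?_) (f.forall_congr_left (p := fun a => 𝓜.Sat D' φ
      (Function.update (f ∘ v) i (f a)) fun n j => hf.map (V n j)) |>.trans ?_)
    · rw [ih, Function.comp_update]
    · simp [Sat]
  | allRel n j φ ih =>
    intro v V
    simp only [sat_allRel, ih, hf.map_set]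
    exact hf.map.forall_congr_right (q := fun R => 𝓜.Sat D' φ (f ∘ v)
      (RelAssign.set (𝓜 := 𝓜) (fun m k => hf.map (V m k)) n j R))

end SOStructure

/-! ### Closure properties of the relations of a structure -/

namespace SOFormula

variable {ι κ : Type}

/-- Renaming of the operator symbols. -/
def relabel (r : ι → κ) : SOFormula ι → SOFormula κ
  | .eq s t => .eq (term s) (term t)
  | .rel n j t => .rel n j fun k => term (t k)
  | .neg φ => .neg (relabel r φ)
  | .and φ ψ => .and (relabel r φ) (relabel r ψ)
  | .allObj i φ => .allObj i (relabel r φ)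
  | .allRel n j φ => .allRel n j (relabel r φ)
where
  /-- Renaming of the operator symbols of a term. -/
  term : SOTerm ι → SOTerm κ
  | .var i => .var i
  | .abs d j => .abs (r d) j

end SOFormula

namespace SOStructure

variable {M : Type u} {ι κ : Type} {𝓜 : SOStructure M}

theorem sat_relabel (r : ι → κ) (D : κ → 𝓜.Concept → M) (φ : SOFormula ι) :
    ∀ (v : ℕ → M) (V : 𝓜.RelAssign),
      𝓜.Sat D (φ.relabel r) v V ↔ 𝓜.Sat (fun d => D (r d)) φ v V := by
  have hterm : ∀ (s : SOTerm ι) (v : ℕ → M) (V : 𝓜.RelAssign),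
      𝓜.termVal D v V (SOFormula.relabel.term r s) = 𝓜.termVal (fun d => D (r d)) v V s := by
    rintro (i | ⟨d, j⟩) v V <;> rfl
  induction φ with
  | eq s t => intro v V; simp only [SOFormula.relabel, Sat, hterm]
  | rel n j t => intro v V; simp only [SOFormula.relabel, Sat, hterm]
  | neg φ ih => intro v V; exact not_congr (ih v V)
  | and φ ψ ih1 ih2 => intro v V; exact and_congr (ih1 v V) (ih2 v V)
  | allObj i φ ih => intro v V; exact forall_congr' fun a => ih _ _
  | allRel n j φ ih => intro v V; exact forall_congr' fun R => ih _ _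

/-- A model of the background logic in a signature is one in every smaller signature. -/
theorem IsModel.reduct {D : κ → 𝓜.Concept → M} (h : 𝓜.IsModel D) (r : ι → κ)
    {D' : ι → 𝓜.Concept → M} (hD : D' = fun d => D (r d)) : 𝓜.IsModel D' := by
  subst hD
  refine ⟨h.1, h.2, fun n φ v V => ?_, h.4, h.5, h.6, h.7⟩
  have := h.comprehension n (φ.relabel r) v V
  simpa only [sat_relabel] using this

/-- `𝓜` is a model of the background logic in the language without operators. -/
def Background (𝓜 : SOStructure M) : Prop := 𝓜.IsModel (fun d : Empty => d.elim)

theorem IsModel.background {D : ι → 𝓜.Concept → M} (h : 𝓜.IsModel D) : 𝓜.Background :=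
  h.reduct Empty.elim (funext fun d => d.elim)

/-- The predicate `P` on `n`-tuples defines a relation of the structure. -/
def Internal (𝓜 : SOStructure M) {n : ℕ} (P : (Fin n → M) → Prop) : Prop := {v | P v} ∈ 𝓜.rel n

/-- The set `A` is the extension of a concept. -/
def ISet (𝓜 : SOStructure M) (A : Set M) : Prop := 𝓜.Internal fun v : Fin 1 → M => v 0 ∈ A

/-- The binary relation `R` belongs to the structure. -/
def IRel (𝓜 : SOStructure M) (R : M → M → Prop) : Prop :=
  𝓜.Internal fun v : Fin 2 → M => R (v 0) (v 1)

/-- The ternary relation `R` belongs to the structure. -/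
def IRel₃ (𝓜 : SOStructure M) (R : M → M → M → Prop) : Prop :=
  𝓜.Internal fun v : Fin 3 → M => R (v 0) (v 1) (v 2)

/-- The graph of `f` belongs to the structure. -/
def IFun (𝓜 : SOStructure M) (f : M → M) : Prop := 𝓜.IRel fun x y => f x = y

/-- The graph of the binary function `f` belongs to the structure. -/
def IFun₂ (𝓜 : SOStructure M) (f : M → M → M) : Prop := 𝓜.IRel₃ fun x y z => f x y = z

/-- The graph of the `n`-ary function `t` belongs to the structure; the value is the first
component of the tuples in the graph. -/
structure ITerm (𝓜 : SOStructure M) {n : ℕ} (t : (Fin n → M) → M) : Prop where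
  graph : 𝓜.Internal fun w : Fin (n + 1) → M => t (fun i => w i.succ) = w 0

/-- The concept whose extension is the internal set `A`. -/
def ISet.concept {A : Set M} (hA : 𝓜.ISet A) : 𝓜.Concept := ⟨{v | v 0 ∈ A}, hA⟩

@[simp] theorem ISet.ext_concept {A : Set M} (hA : 𝓜.ISet A) : ext hA.concept = A := by
  ext x; simp [ISet.concept, ext]

theorem mem_iff_mem_ext (X : 𝓜.Concept) (v : Fin 1 → M) : v ∈ X.1 ↔ v 0 ∈ ext X := by
  have : v = ![v 0] := by ext i; fin_cases i; rfl
  rw [ext, Set.mem_ofPred_eq, ← this]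

theorem iSet_ext (X : 𝓜.Concept) : 𝓜.ISet (ext X) := by
  have : {v : Fin 1 → M | v 0 ∈ ext X} = X.1 := by
    ext v; exact (mem_iff_mem_ext X v).symm
  unfold ISet Internal
  rw [this]; exact X.2

theorem ext_injective : Function.Injective (ext : 𝓜.Concept → Set M) := fun X Y h => by
  apply Subtype.ext
  ext v
  rw [mem_iff_mem_ext, mem_iff_mem_ext, h]

@[simp] theorem concept_iSet_ext (X : 𝓜.Concept) : (iSet_ext X).concept = X :=
  ext_injective (by simp)

theorem iRel_rel (F : 𝓜.Rel 2) : 𝓜.IRel fun x y => ![x, y] ∈ F.1 := by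
  have : {v : Fin 2 → M | ![v 0, v 1] ∈ F.1} = F.1 := by
    ext v
    have : v = ![v 0, v 1] := by ext i; fin_cases i <;> rfl
    rw [Set.mem_ofPred_eq, ← this]
  unfold IRel Internal
  rw [this]; exact F.2

theorem iRel₃_rel (F : 𝓜.Rel 3) : 𝓜.IRel₃ fun x y z => ![x, y, z] ∈ F.1 := by
  have : {v : Fin 3 → M | ![v 0, v 1, v 2] ∈ F.1} = F.1 := by
    ext v
    have : v = ![v 0, v 1, v 2] := by ext i; fin_cases i <;> rfl
    rw [Set.mem_ofPred_eq, ← this]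
  unfold IRel₃ Internal
  rw [this]; exact F.2

/-- The relation of the structure given by an internal binary relation. -/
def IRel.toRel {R : M → M → Prop} (hR : 𝓜.IRel R) : 𝓜.Rel 2 := ⟨{v | R (v 0) (v 1)}, hR⟩

@[simp] theorem IRel.mem_toRel {R : M → M → Prop} (hR : 𝓜.IRel R) (x y : M) :
    ![x, y] ∈ hR.toRel.1 ↔ R x y := by
  simp [IRel.toRel]

/-- The graph of an internal function, as a relation of the structure. -/
def IFun.toRel {f : M → M} (hf : 𝓜.IFun f) : 𝓜.Rel 2 := IRel.toRel hf

@[simp] theorem IFun.mem_toRel {f : M → M} (hf : 𝓜.IFun f) (x y : M) :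
    ![x, y] ∈ hf.toRel.1 ↔ f x = y :=
  IRel.mem_toRel hf x y

/-- An arbitrary assignment of relations. -/
noncomputable def IsModel.someRel {D : ι → 𝓜.Concept → M} (h : 𝓜.IsModel D) : 𝓜.RelAssign :=
  fun n _ => ⟨(h.nonempty_rel n).choose, (h.nonempty_rel n).choose_spec⟩

/-- An arbitrary object. -/
noncomputable def IsModel.someObj {D : ι → 𝓜.Concept → M} (h : 𝓜.IsModel D) : M :=
  h.nonempty_obj.some

namespace Background

variable {n m : ℕ} {P Q : (Fin n → M) → Prop}

/-- Comprehension for a formula, with the values of the first variables abstracted. -/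
theorem internal_of_sat {D : ι → 𝓜.Concept → M} (h : 𝓜.IsModel D) (φ : SOFormula ι) (v : ℕ → M)
    (V : 𝓜.RelAssign) (hP : ∀ a : Fin n → M,
      P a ↔ 𝓜.Sat D φ (fun i => if h : i < n then a ⟨i, h⟩ else v i) V) : 𝓜.Internal P := by
  have := h.comprehension n φ v V
  unfold Internal
  simpa only [hP] using this

theorem not (h : 𝓜.Background) (hP : 𝓜.Internal P) : 𝓜.Internal fun v => ¬ P v := by
  refine internal_of_sat h (.neg (.rel n 0 fun k => .var k)) (fun _ => h.someObj)
    (h.someRel.set n 0 ⟨_, hP⟩) fun a => ?_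
  simp [Sat, termVal]

theorem and (h : 𝓜.Background) (hP : 𝓜.Internal P) (hQ : 𝓜.Internal Q) :
    𝓜.Internal fun v => P v ∧ Q v := by
  refine internal_of_sat h (.and (.rel n 0 fun k => .var k) (.rel n 1 fun k => .var k))
    (fun _ => h.someObj) ((h.someRel.set n 0 ⟨_, hP⟩).set n 1 ⟨_, hQ⟩) fun a => ?_
  simp [Sat, termVal]

theorem or (h : 𝓜.Background) (hP : 𝓜.Internal P) (hQ : 𝓜.Internal Q) :
    𝓜.Internal fun v => P v ∨ Q v := by
  have := h.not (h.and (h.not hP) (h.not hQ))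
  simpa only [not_and_or, not_not] using this

theorem subst (h : 𝓜.Background) {P : (Fin m → M) → Prop} (hP : 𝓜.Internal P) (ρ : Fin m → Fin n) :
    𝓜.Internal fun v : Fin n → M => P fun i => v (ρ i) := by
  refine internal_of_sat h (.rel m 0 fun k => .var (ρ k)) (fun _ => h.someObj)
    (h.someRel.set m 0 ⟨_, hP⟩) fun a => ?_
  simp [Sat, termVal]

theorem ex (h : 𝓜.Background) {P : (Fin n → M) → M → Prop}
    (hP : 𝓜.Internal fun w : Fin (n + 1) → M => P (fun i => w i.succ) (w 0)) :
    𝓜.Internal fun v => ∃ y, P v y := by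
  refine internal_of_sat h (.exObj n (.rel (n + 1) 0 fun k => .var (Fin.cases n (fun i => i.val) k)))
    (fun _ => h.someObj) (h.someRel.set (n + 1) 0 ⟨_, hP⟩) fun a => ?_
  rw [sat_exObj]
  refine exists_congr fun y => ?_
  simp only [Sat, RelAssign.set_same, Set.mem_ofPred_eq, termVal, Fin.cases_zero, Fin.cases_succ,
    Function.update_self]
  have : a = fun i : Fin n => Function.update (fun j => if hj : j < n then a ⟨j, hj⟩ else h.someObj)
      n y i := by
    funext i
    simp [Function.update_of_ne (ne_of_lt i.2)]
  rw [← this]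

theorem proj (h : 𝓜.Background) (i : Fin n) : 𝓜.ITerm fun v => v i := by
  refine ⟨internal_of_sat h (.eqv (i + 1) 0) (fun _ => h.someObj) h.someRel fun a => ?_⟩
  simp; rfl

theorem const (h : 𝓜.Background) (c : M) : 𝓜.ITerm fun _ : Fin n → M => c := by
  refine ⟨internal_of_sat h (.eqv (n + 1) 0) (fun _ => c) h.someRel fun a => ?_⟩
  simp

/-- Substitution of an internal function for the first variable. -/
theorem subst_term (h : 𝓜.Background) {P : (Fin n → M) → M → Prop} {t : (Fin n → M) → M}
    (hP : 𝓜.Internal fun w : Fin (n + 1) → M => P (fun i => w i.succ) (w 0)) (ht : 𝓜.ITerm t) :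
    𝓜.Internal fun v => P v (t v) := by
  have := h.ex (P := fun v y => t v = y ∧ P v y) (h.and ht.graph hP)
  simpa using this

theorem mem (h : 𝓜.Background) {A : Set M} (hA : 𝓜.ISet A) {t : (Fin n → M) → M} (ht : 𝓜.ITerm t) :
    𝓜.Internal fun v => t v ∈ A :=
  h.subst_term (P := fun _ y => y ∈ A) (h.subst hA (fun _ => 0)) ht

theorem weaken (h : 𝓜.Background) {t : (Fin n → M) → M} (ht : 𝓜.ITerm t) :
    𝓜.ITerm fun w : Fin (n + 1) → M => t fun i => w i.succ :=
  ⟨h.subst (n := n + 1 + 1) ht.graph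
    (Fin.cases (motive := fun _ => Fin (n + 1 + 1)) 0 fun i => i.succ.succ)⟩

theorem rel (h : 𝓜.Background) {R : M → M → Prop} (hR : 𝓜.IRel R) {s t : (Fin n → M) → M}
    (hs : 𝓜.ITerm s) (ht : 𝓜.ITerm t) : 𝓜.Internal fun v => R (s v) (t v) := by
  refine h.subst_term (P := fun v y => R (s v) y) ?_ ht
  refine h.subst_term (P := fun (w : Fin (n + 1) → M) y => R y (w 0)) ?_ (h.weaken hs)
  exact h.subst hR ![0, 1]

theorem rel₃ (h : 𝓜.Background) {R : M → M → M → Prop} (hR : 𝓜.IRel₃ R) {s t r : (Fin n → M) → M}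
    (hs : 𝓜.ITerm s) (ht : 𝓜.ITerm t) (hr : 𝓜.ITerm r) :
    𝓜.Internal fun v => R (s v) (t v) (r v) := by
  refine h.subst_term (P := fun v y => R (s v) (t v) y) ?_ hr
  refine h.subst_term (P := fun (w : Fin (n + 1) → M) y => R (s fun i => w i.succ) y (w 0)) ?_
    (h.weaken ht)
  refine h.subst_term (P := fun (w : Fin (n + 1 + 1) → M) y => R y (w 0) (w 1)) ?_
    (h.weaken (h.weaken hs))
  exact h.subst hR ![0, 1, 2]

theorem eq (h : 𝓜.Background) {s t : (Fin n → M) → M} (hs : 𝓜.ITerm s) (ht : 𝓜.ITerm t) :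
    𝓜.Internal fun v => s v = t v := by
  have hE : 𝓜.IRel fun x y : M => x = y :=
    internal_of_sat h (.eqv 0 1) (fun _ => h.someObj) h.someRel fun a => by simp
  exact h.rel hE hs ht

theorem app (h : 𝓜.Background) {f : M → M} (hf : 𝓜.IFun f) {t : (Fin n → M) → M} (ht : 𝓜.ITerm t) :
    𝓜.ITerm fun v => f (t v) :=
  ⟨h.rel hf (h.weaken ht) (h.proj 0)⟩

theorem app₂ (h : 𝓜.Background) {f : M → M → M} (hf : 𝓜.IFun₂ f) {s t : (Fin n → M) → M}
    (hs : 𝓜.ITerm s) (ht : 𝓜.ITerm t) : 𝓜.ITerm fun v => f (s v) (t v) :=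
  ⟨h.rel₃ hf (h.weaken hs) (h.weaken ht) (h.proj 0)⟩

theorem true (h : 𝓜.Background) : 𝓜.Internal fun _ : Fin n → M => True := by
  have := h.ex (n := n) (P := fun _ _ => True)
    (by simpa only [eq_self] using h.eq (n := n + 1) (h.proj 0) (h.proj 0))
  have hn := h.nonempty_obj
  simpa only [exists_const] using this

theorem ite (h : 𝓜.Background) [DecidablePred P] (hP : 𝓜.Internal P) {s t : (Fin n → M) → M}
    (hs : 𝓜.ITerm s) (ht : 𝓜.ITerm t) : 𝓜.ITerm fun v => if P v then s v else t v := by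
  have hP' : 𝓜.Internal fun w : Fin (n + 1) → M => P fun i => w i.succ := h.subst hP Fin.succ
  have := h.or (h.and hP' hs.graph) (h.and (h.not hP') ht.graph)
  refine ⟨?_⟩
  convert this using 2 with w
  split_ifs with hw <;> simp [hw]

theorem ifun (h : 𝓜.Background) {f : M → M} (hf : 𝓜.ITerm fun v : Fin 1 → M => f (v 0)) :
    𝓜.IFun f :=
  h.subst hf.graph ![1, 0]

end Background

end SOStructure

/-! ### Functions and permutations inside a structure -/

namespace SOStructure

variable {M : Type u} {ι κ : Type} {𝓜 : SOStructure M}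

/-- In `𝓜` there is an injection of `A` into `B`; it is extended to a function on all objects. -/
def Embeds (𝓜 : SOStructure M) (A B : Set M) : Prop :=
  ∃ f : M → M, 𝓜.IFun f ∧ Set.MapsTo f A B ∧ Set.InjOn f A

/-- In `𝓜` there is a bijection of `A` with `B`; it is extended to a function on all objects. -/
def Equi (𝓜 : SOStructure M) (A B : Set M) : Prop :=
  ∃ f : M → M, 𝓜.IFun f ∧ Set.BijOn f A B

/-- `A` is Dedekind infinite in `𝓜`. -/
def Infin (𝓜 : SOStructure M) (A : Set M) : Prop :=
  ∃ f : M → M, 𝓜.IFun f ∧ Set.MapsTo f A A ∧ Set.InjOn f A ∧ ∃ a ∈ A, a ∉ f '' A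

/-- `𝓜` contains the permutation `π`. -/
def IPerm (𝓜 : SOStructure M) (π : Equiv.Perm M) : Prop := 𝓜.IFun π

theorem Equi.embeds {A B : Set M} (hAB : 𝓜.Equi A B) : 𝓜.Embeds A B :=
  let ⟨f, hf, hb⟩ := hAB; ⟨f, hf, hb.mapsTo, hb.injOn⟩

namespace Background

variable {A B C A' B' : Set M} {f g : M → M}

theorem inter (h : 𝓜.Background) (hA : 𝓜.ISet A) (hB : 𝓜.ISet B) : 𝓜.ISet (A ∩ B) := h.and hA hB

theorem union (h : 𝓜.Background) (hA : 𝓜.ISet A) (hB : 𝓜.ISet B) : 𝓜.ISet (A ∪ B) := h.or hA hB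

theorem compl (h : 𝓜.Background) (hA : 𝓜.ISet A) : 𝓜.ISet Aᶜ := h.not hA

theorem diff (h : 𝓜.Background) (hA : 𝓜.ISet A) (hB : 𝓜.ISet B) : 𝓜.ISet (A \ B) :=
  h.and hA (h.not hB)

theorem univ (h : 𝓜.Background) : 𝓜.ISet Set.univ := h.true

theorem empty (h : 𝓜.Background) : 𝓜.ISet ∅ := by
  simpa using h.compl h.univ

theorem singleton (h : 𝓜.Background) (c : M) : 𝓜.ISet {c} := h.eq (h.proj 0) (h.const c)

theorem insert (h : 𝓜.Background) (c : M) (hA : 𝓜.ISet A) : 𝓜.ISet (insert c A) :=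
  h.union (h.singleton c) hA

theorem image (h : 𝓜.Background) (hf : 𝓜.IFun f) (hA : 𝓜.ISet A) : 𝓜.ISet (f '' A) :=
  h.ex (h.and (h.mem hA (h.proj 0)) (h.eq (h.app hf (h.proj 0)) (h.proj 1)))

theorem preimage (h : 𝓜.Background) (hf : 𝓜.IFun f) (hA : 𝓜.ISet A) : 𝓜.ISet (f ⁻¹' A) :=
  h.mem hA (h.app hf (h.proj 0))

theorem id (h : 𝓜.Background) : 𝓜.IFun (id : M → M) := h.eq (h.proj 0) (h.proj 1)

theorem comp (h : 𝓜.Background) (hg : 𝓜.IFun g) (hf : 𝓜.IFun f) : 𝓜.IFun (g ∘ f) :=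
  h.ifun (h.app hg (h.app hf (h.proj 0)))

theorem piecewise (h : 𝓜.Background) (hA : 𝓜.ISet A) [DecidablePred (· ∈ A)] (hf : 𝓜.IFun f)
    (hg : 𝓜.IFun g) : 𝓜.IFun (A.piecewise f g) :=
  h.ifun (h.ite (h.mem hA (h.proj 0)) (h.app hf (h.proj 0)) (h.app hg (h.proj 0)))

/-- A function is internal if its values on an internal set `A` are described by an internal
relation and it is the identity elsewhere. -/
theorem ifun_of_graph (h : 𝓜.Background) (hA : 𝓜.ISet A) {R : M → M → Prop} (hR : 𝓜.IRel R)
    (hf : ∀ x y, f x = y ↔ (x ∈ A ∧ R x y) ∨ (x ∉ A ∧ x = y)) : 𝓜.IFun f := by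
  unfold IFun
  simp only [hf]
  exact h.or (h.and (h.mem hA (h.proj 0)) (h.rel hR (h.proj 0) (h.proj 1)))
    (h.and (h.not (h.mem hA (h.proj 0))) (h.eq (h.proj 0) (h.proj 1)))

/-- An internal relation which is functional on `A` is there the graph of an internal function. -/
theorem exists_ifun (h : 𝓜.Background) (hA : 𝓜.ISet A) {R : M → M → Prop} (hR : 𝓜.IRel R)
    (hu : ∀ x ∈ A, ∃! y, R x y) : ∃ f, 𝓜.IFun f ∧ ∀ x ∈ A, ∀ y, f x = y ↔ R x y := by
  classical
  choose! F hF hF' using hu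
  refine ⟨fun x => if x ∈ A then F x else x, h.ifun_of_graph hA hR fun x y => ?_, fun x hx y => ?_⟩
  · by_cases hx : x ∈ A
    · simp only [hx, if_true, true_and, not_true_eq_false, false_and, or_false]
      exact ⟨fun e => e ▸ hF x hx, fun e => (hF' x hx y e).symm⟩
    · simp [hx]
  · simp only [hx, if_true]
    exact ⟨fun e => e ▸ hF x hx, fun e => (hF' x hx y e).symm⟩

/-- Internal bijections have internal inverses. -/
theorem exists_inverse (h : 𝓜.Background) (hA : 𝓜.ISet A) (hf : 𝓜.IFun f) (hb : Set.BijOn f A B)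
    (hB : 𝓜.ISet B) : ∃ g, 𝓜.IFun g ∧ Set.BijOn g B A ∧ Set.InvOn g f A B := by
  obtain ⟨g, hg, hg'⟩ := h.exists_ifun hB (R := fun y x => x ∈ A ∧ f x = y)
    (h.and (h.mem hA (h.proj 1)) (h.eq (h.app hf (h.proj 1)) (h.proj 0))) (by
      intro y hy
      obtain ⟨x, hx, rfl⟩ := hb.surjOn hy
      exact ⟨x, ⟨hx, rfl⟩, fun z hz => hb.injOn hz.1 hx hz.2⟩)
  have h1 : Set.LeftInvOn g f A := fun x hx => (hg' _ (hb.mapsTo hx) _).2 ⟨hx, rfl⟩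
  have h2 : Set.RightInvOn g f B := fun y hy => ((hg' y hy _).1 rfl).2
  have h3 : Set.MapsTo g B A := fun y hy => ((hg' y hy _).1 rfl).1
  exact ⟨g, hg, Set.InvOn.bijOn ⟨h2, h1⟩ h3 hb.mapsTo, h1, h2⟩

theorem iPerm_symm (h : 𝓜.Background) {π : Equiv.Perm M} (hπ : 𝓜.IPerm π) : 𝓜.IPerm π.symm := by
  have : 𝓜.IFun π.symm := by
    unfold IFun
    simp only [Equiv.symm_apply_eq]
    exact h.eq (h.proj 0) (h.app hπ (h.proj 1))
  exact this

theorem iPerm_trans (h : 𝓜.Background) {π σ : Equiv.Perm M} (hπ : 𝓜.IPerm π) (hσ : 𝓜.IPerm σ) :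
    𝓜.IPerm (π.trans σ) :=
  show 𝓜.IFun (σ ∘ π) from h.comp hσ hπ

theorem iPerm_swap [DecidableEq M] (h : 𝓜.Background) (a b : M) : 𝓜.IPerm (Equiv.swap a b) := by
  refine h.ifun ?_
  simp only [Equiv.swap_apply_def]
  exact h.ite (h.eq (h.proj 0) (h.const a)) (h.const b)
    (h.ite (h.eq (h.proj 0) (h.const b)) (h.const a) (h.proj 0))

/-! ### Comparison of cardinalities -/

theorem embeds_of_subset (h : 𝓜.Background) (hAB : A ⊆ B) : 𝓜.Embeds A B :=
  ⟨_, h.id, hAB, Set.injOn_id A⟩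

theorem embeds_trans (h : 𝓜.Background) (hAB : 𝓜.Embeds A B) (hBC : 𝓜.Embeds B C) :
    𝓜.Embeds A C := by
  obtain ⟨f, hf, hm, hi⟩ := hAB
  obtain ⟨g, hg, hm', hi'⟩ := hBC
  exact ⟨_, h.comp hg hf, hm'.comp hm, hi'.comp hi hm⟩

theorem equi_refl (h : 𝓜.Background) (A : Set M) : 𝓜.Equi A A := ⟨_, h.id, Set.bijOn_id A⟩

theorem equi_trans (h : 𝓜.Background) (hAB : 𝓜.Equi A B) (hBC : 𝓜.Equi B C) : 𝓜.Equi A C := by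
  obtain ⟨f, hf, hm⟩ := hAB
  obtain ⟨g, hg, hm'⟩ := hBC
  exact ⟨_, h.comp hg hf, hm'.comp hm⟩

theorem equi_symm (h : 𝓜.Background) (hA : 𝓜.ISet A) (hB : 𝓜.ISet B) (hAB : 𝓜.Equi A B) :
    𝓜.Equi B A := by
  obtain ⟨f, hf, hb⟩ := hAB
  obtain ⟨g, hg, hb', -⟩ := h.exists_inverse hA hf hb hB
  exact ⟨g, hg, hb'⟩

theorem equi_image (_ : 𝓜.Background) (hf : 𝓜.IFun f) (hi : Set.InjOn f A) : 𝓜.Equi A (f '' A) :=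
  ⟨f, hf, hi.bijOn_image⟩

/-- Internal bijections between the two parts of partitions can be glued. -/
theorem exists_glue (h : 𝓜.Background) (hA : 𝓜.ISet A) (hf : 𝓜.IFun f) (hg : 𝓜.IFun g)
    (hb : Set.BijOn f A B) (hb' : Set.BijOn g A' B') (hd : Disjoint A A') (hd' : Disjoint B B') :
    ∃ k, 𝓜.IFun k ∧ Set.BijOn k (A ∪ A') (B ∪ B') ∧ Set.EqOn k f A ∧ Set.EqOn k g A' := by
  classical
  have e1 : Set.EqOn (A.piecewise f g) f A := A.piecewise_eqOn f g
  have e2 : Set.EqOn (A.piecewise f g) g A' := fun x hx =>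
    Set.piecewise_eq_of_notMem _ _ _ fun hx' => Set.disjoint_left.1 hd hx' hx
  refine ⟨A.piecewise f g, h.piecewise hA hf hg, ?_, e1, e2⟩
  have c1 := hb.congr e1.symm
  have c2 := hb'.congr e2.symm
  refine c1.union c2 ?_
  rw [Set.injOn_union hd]
  refine ⟨c1.injOn, c2.injOn, fun x hx y hy e => ?_⟩
  exact Set.disjoint_left.1 hd' (c1.mapsTo hx) (e ▸ c2.mapsTo hy)

theorem embeds_union (h : 𝓜.Background) (hA : 𝓜.ISet A) (h1 : 𝓜.Embeds A B)
    (h2 : 𝓜.Embeds A' B') (hd : Disjoint A A') (hd' : Disjoint B B') :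
    𝓜.Embeds (A ∪ A') (B ∪ B') := by
  obtain ⟨f, hf, hm, hi⟩ := h1
  obtain ⟨g, hg, hm', hi'⟩ := h2
  obtain ⟨k, hk, hkb, -⟩ := h.exists_glue hA hf hg hi.bijOn_image hi'.bijOn_image hd
    (hd'.mono hm.image_subset hm'.image_subset)
  exact ⟨k, hk, fun x hx => Set.union_subset_union hm.image_subset hm'.image_subset
    (hkb.mapsTo hx), hkb.injOn⟩

/-- An internal bijection of three disjoint sets with three disjoint sets extends to a permutation
if the complements of the unions are equinumerous. -/
theorem exists_iPerm₃ (h : 𝓜.Background) {A₁ A₂ A₃ B₁ B₂ B₃ : Set M}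
    (hA₁ : 𝓜.ISet A₁) (hA₂ : 𝓜.ISet A₂) (hA₃ : 𝓜.ISet A₃)
    (h₁ : 𝓜.Equi A₁ B₁) (h₂ : 𝓜.Equi A₂ B₂) (h₃ : 𝓜.Equi A₃ B₃)
    (hc : 𝓜.Equi (A₁ ∪ A₂ ∪ A₃)ᶜ (B₁ ∪ B₂ ∪ B₃)ᶜ)
    (a₁₂ : Disjoint A₁ A₂) (a₃ : Disjoint (A₁ ∪ A₂) A₃)
    (b₁₂ : Disjoint B₁ B₂) (b₃ : Disjoint (B₁ ∪ B₂) B₃) :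
    ∃ π : Equiv.Perm M, 𝓜.IPerm π ∧ π '' A₁ = B₁ ∧ π '' A₂ = B₂ ∧ π '' A₃ = B₃ := by
  obtain ⟨f₁, i₁, b₁⟩ := h₁
  obtain ⟨f₂, i₂, b₂⟩ := h₂
  obtain ⟨f₃, i₃, b₃'⟩ := h₃
  obtain ⟨f₄, i₄, b₄⟩ := hc
  obtain ⟨k, hk, kb, k1, k2⟩ := h.exists_glue hA₁ i₁ i₂ b₁ b₂ a₁₂ b₁₂
  obtain ⟨l, hl, lb, l1, l2⟩ := h.exists_glue (h.union hA₁ hA₂) hk i₃ kb b₃' a₃ b₃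
  obtain ⟨m, hm, mb, m1, m2⟩ := h.exists_glue (h.union (h.union hA₁ hA₂) hA₃) hl i₄ lb b₄
    disjoint_compl_right disjoint_compl_right
  rw [Set.union_compl_self, Set.union_compl_self, Set.bijOn_univ] at mb
  refine ⟨Equiv.ofBijective m mb, hm, ?_, ?_, ?_⟩
  · rw [← b₁.image_eq]
    refine Set.image_congr fun x hx => ?_
    have : m x = f₁ x := by rw [m1 (Or.inl (Or.inl hx)), l1 (Or.inl hx), k1 hx]
    exact this
  · rw [← b₂.image_eq]
    refine Set.image_congr fun x hx => ?_
    have : m x = f₂ x := by rw [m1 (Or.inl (Or.inr hx)), l1 (Or.inr hx), k2 hx]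
    exact this
  · rw [← b₃'.image_eq]
    refine Set.image_congr fun x hx => ?_
    have : m x = f₃ x := by rw [m1 (Or.inr hx), l2 hx]
    exact this

theorem exists_iPerm₂ (h : 𝓜.Background) {A₁ A₂ B₁ B₂ : Set M}
    (hA₁ : 𝓜.ISet A₁) (hA₂ : 𝓜.ISet A₂) (h₁ : 𝓜.Equi A₁ B₁) (h₂ : 𝓜.Equi A₂ B₂)
    (hc : 𝓜.Equi (A₁ ∪ A₂)ᶜ (B₁ ∪ B₂)ᶜ) (a₁₂ : Disjoint A₁ A₂) (b₁₂ : Disjoint B₁ B₂) :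
    ∃ π : Equiv.Perm M, 𝓜.IPerm π ∧ π '' A₁ = B₁ ∧ π '' A₂ = B₂ := by
  obtain ⟨π, hπ, h1, h2, -⟩ := h.exists_iPerm₃ hA₁ hA₂ h.empty h₁ h₂ (h.equi_refl ∅)
    (by simpa using hc) a₁₂ (by simp) b₁₂ (by simp)
  exact ⟨π, hπ, h1, h2⟩

theorem exists_iPerm (h : 𝓜.Background) (hA : 𝓜.ISet A) (h₁ : 𝓜.Equi A B)
    (hc : 𝓜.Equi Aᶜ Bᶜ) : ∃ π : Equiv.Perm M, 𝓜.IPerm π ∧ π '' A = B := by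
  obtain ⟨π, hπ, h1, -⟩ := h.exists_iPerm₂ hA h.empty h₁ (h.equi_refl ∅)
    (by simpa using hc) (by simp) (by simp)
  exact ⟨π, hπ, h1⟩

/-- The intersection of all concepts which contain `A` and are closed under `f`. -/
theorem iSet_closure (h : 𝓜.Background) (hA : 𝓜.ISet A) (hf : 𝓜.IFun f) :
    𝓜.ISet {x | ∀ Z, 𝓜.ISet Z → A ⊆ Z → (∀ y ∈ Z, f y ∈ Z) → x ∈ Z} := by
  refine internal_of_sat h (φ := .allRel 1 0 (.imp (.and
    (.allObj 1 (.imp (.mem 1 1) (.mem 1 0)))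
    (.allObj 1 (.imp (.mem 1 0) (.allObj 2 (.imp (.app 1 2 0) (.mem 2 0)))))) (.mem 0 0)))
    (fun _ => h.someObj) ((h.someRel.set 1 1 hA.concept).set 2 0 hf.toRel) fun a => ?_
  simp only [sat_allRel, sat_imp, sat_and, sat_allObj, sat_mem, sat_app]
  constructor
  · intro H Z hZ
    simp at hZ ⊢
    exact H (ext Z) (iSet_ext Z) hZ.1 hZ.2
  · intro H Z hZ h1 h2
    have := H hZ.concept
    simp at this
    exact this h1 h2

/-- The Cantor–Bernstein theorem inside `𝓜`. -/
theorem equi_of_embeds (h : 𝓜.Background) (hA : 𝓜.ISet A) (hB : 𝓜.ISet B) (h₁ : 𝓜.Embeds A B)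
    (h₂ : 𝓜.Embeds B A) : 𝓜.Equi A B := by
  obtain ⟨f, hf, hfm, hfi⟩ := h₁
  obtain ⟨g, hg, hgm, hgi⟩ := h₂
  have hk : 𝓜.IFun (g ∘ f) := h.comp hg hf
  have hS : 𝓜.ISet (A \ g '' B) := h.diff hA (h.image hg hB)
  set C := {x | ∀ Z, 𝓜.ISet Z → A \ g '' B ⊆ Z → (∀ y ∈ Z, (g ∘ f) y ∈ Z) → x ∈ Z} with hCdef
  have hC : 𝓜.ISet C := h.iSet_closure hS hk
  have hCA : C ⊆ A := fun x hx => hx A hA Set.sdiff_subset fun y hy => hgm (hfm hy)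
  have hSC : A \ g '' B ⊆ C := fun x hx Z _ h1 _ => h1 hx
  have hCk : ∀ x ∈ C, g (f x) ∈ C := fun x hx Z hZ h1 h2 => h2 x (hx Z hZ h1 h2)
  have hCmin : C ⊆ A \ g '' B ∪ (g ∘ f) '' C := fun x hx =>
    hx _ (h.union hS (h.image hk hC)) Set.subset_union_left fun y hy => Or.inr ⟨y, by
      rcases hy with hy | ⟨z, hz, rfl⟩
      · exact hSC hy
      · exact hCk z hz, rfl⟩
  -- On `C` the bijection is `f`, on the rest of `A` the inverse of `g`.
  have hgB : ∀ x ∈ A, x ∉ C → ∃ y ∈ B, g y = x := fun x hx hxC => by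
    by_contra hn
    exact hxC (hSC ⟨hx, fun ⟨y, hy, e⟩ => hn ⟨y, hy, e⟩⟩)
  obtain ⟨k, hki, hk'⟩ := h.exists_ifun hA
    (R := fun x y => (x ∈ C ∧ f x = y) ∨ (x ∉ C ∧ y ∈ B ∧ g y = x))
    (h.or (h.and (h.mem hC (h.proj 0)) (h.eq (h.app hf (h.proj 0)) (h.proj 1)))
      (h.and (h.not (h.mem hC (h.proj 0)))
        (h.and (h.mem hB (h.proj 1)) (h.eq (h.app hg (h.proj 1)) (h.proj 0))))) (by
      intro x hx
      by_cases hxC : x ∈ C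
      · exact ⟨f x, Or.inl ⟨hxC, rfl⟩, fun y hy => by
          rcases hy with hy | hy
          · exact hy.2.symm
          · exact absurd hxC hy.1⟩
      · obtain ⟨y, hy, e⟩ := hgB x hx hxC
        refine ⟨y, Or.inr ⟨hxC, hy, e⟩, fun z hz => ?_⟩
        rcases hz with hz | hz
        · exact absurd hz.1 hxC
        · exact hgi hz.2.1 hy (hz.2.2.trans e.symm))
  refine ⟨k, hki, fun x hx => ?_, fun x hx x' hx' e => ?_, fun y hy => ?_⟩
  · rcases (hk' x hx _).1 rfl with hy | hy
    · exact hy.2 ▸ hfm hx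
    · exact hy.2.1
  · rcases (hk' x hx _).1 rfl with hy | hy <;> rcases (hk' x' hx' _).1 rfl with hy' | hy'
    · exact hfi hx hx' (by rw [hy.2, hy'.2, e])
    · refine absurd (hCk x hy.1) ?_
      rw [hy.2, e, hy'.2.2]; exact hy'.1
    · refine absurd (hCk x' hy'.1) ?_
      rw [hy'.2, ← e, hy.2.2]; exact hy.1
    · rw [← hy.2.2, ← hy'.2.2, e]
  · by_cases hyC : g y ∈ C
    · rcases hCmin hyC with hn | ⟨x, hx, e⟩
      · exact absurd ⟨y, hy, rfl⟩ hn.2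
      · exact ⟨x, hCA hx, (hk' x (hCA hx) y).2 (Or.inl ⟨hx, hgi (hfm (hCA hx)) hy e⟩)⟩
    · exact ⟨g y, hgm hy, (hk' _ (hgm hy) y).2 (Or.inr ⟨hyC, hy, rfl⟩)⟩

/-! ### The cardinality axioms in terms of internal functions -/

theorem cardLE_iff (h : 𝓜.Background) (hA : 𝓜.ISet A) (hB : 𝓜.ISet B) :
    𝓜.CardLE A B ↔ 𝓜.Embeds A B := by
  constructor
  · rintro ⟨F, hF, hF'⟩
    obtain ⟨f, hf, hf'⟩ := h.exists_ifun hA (R := fun x y => y ∈ B ∧ ![x, y] ∈ F.1)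
      (h.and (h.mem hB (h.proj 1)) (h.rel (iRel_rel F) (h.proj 0) (h.proj 1))) hF
    have hfB : ∀ x ∈ A, f x ∈ B ∧ ![x, f x] ∈ F.1 := fun x hx => (hf' x hx _).1 rfl
    refine ⟨f, hf, fun x hx => (hfB x hx).1, fun x hx x' hx' e => ?_⟩
    exact hF' x hx x' hx' (f x) (hfB x hx).1 (hfB x hx).2 (e ▸ (hfB x' hx').2)
  · rintro ⟨f, hf, hm, hi⟩
    refine ⟨hf.toRel, fun x hx => ⟨f x, ⟨hm hx, by simp⟩, fun y hy => by simpa using hy.2.symm⟩, ?_⟩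
    intro x hx x' hx' y _ e e'
    simp only [IFun.mem_toRel] at e e'
    exact hi hx hx' (e.trans e'.symm)

theorem cardEq_iff (h : 𝓜.Background) (hA : 𝓜.ISet A) (hB : 𝓜.ISet B) :
    𝓜.CardEq A B ↔ 𝓜.Equi A B := by
  constructor
  · rintro ⟨F, ⟨hF, hF'⟩, hs⟩
    obtain ⟨f, hf, hf'⟩ := h.exists_ifun hA (R := fun x y => y ∈ B ∧ ![x, y] ∈ F.1)
      (h.and (h.mem hB (h.proj 1)) (h.rel (iRel_rel F) (h.proj 0) (h.proj 1))) hF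
    have hfB : ∀ x ∈ A, f x ∈ B ∧ ![x, f x] ∈ F.1 := fun x hx => (hf' x hx _).1 rfl
    refine ⟨f, hf, fun x hx => (hfB x hx).1, fun x hx x' hx' e => ?_, fun y hy => ?_⟩
    · exact hF' x hx x' hx' (f x) (hfB x hx).1 (hfB x hx).2 (e ▸ (hfB x' hx').2)
    · obtain ⟨x, hx, hxy⟩ := hs y hy
      exact ⟨x, hx, (hf' x hx y).2 ⟨hy, hxy⟩⟩
  · rintro ⟨f, hf, hm, hi, hs⟩
    refine ⟨hf.toRel, ⟨fun x hx => ⟨f x, ⟨hm hx, by simp⟩, fun y hy => by simpa using hy.2.symm⟩,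
      ?_⟩, fun y hy => ?_⟩
    · intro x hx x' hx' y _ e e'
      simp only [IFun.mem_toRel] at e e'
      exact hi hx hx' (e.trans e'.symm)
    · obtain ⟨x, hx, e⟩ := hs hy
      exact ⟨x, hx, by simpa using e⟩

theorem embeds_total (h : 𝓜.Background) (hA : 𝓜.ISet A) (hB : 𝓜.ISet B) :
    𝓜.Embeds A B ∨ 𝓜.Embeds B A := by
  have := h.comparability hA.concept hB.concept
  simpa [h.cardLE_iff hA hB, h.cardLE_iff hB hA] using this

theorem dedekindInfinite_iff (h : 𝓜.Background) (hA : 𝓜.ISet A) :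
    𝓜.DedekindInfinite hA.concept ↔ 𝓜.Infin A := by
  constructor
  · rintro ⟨Z, hZ, hle⟩
    rw [ISet.ext_concept] at hZ hle
    obtain ⟨f, hf, hm, hi⟩ := (h.cardLE_iff hA (iSet_ext Z)).1 hle
    obtain ⟨a, haA, haZ⟩ := Set.exists_of_ssubset hZ
    refine ⟨f, hf, fun x hx => hZ.1 (hm hx), hi, a, haA, ?_⟩
    rintro ⟨x, hx, rfl⟩
    exact haZ (hm hx)
  · rintro ⟨f, hf, hm, hi, a, ha, ha'⟩
    have hZ := h.image hf hA
    refine ⟨hZ.concept, ?_, ?_⟩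
    · rw [ISet.ext_concept, ISet.ext_concept]
      exact ⟨hm.image_subset, fun hn => ha' (hn ha)⟩
    · rw [ISet.ext_concept, ISet.ext_concept, h.cardLE_iff hA hZ]
      exact ⟨f, hf, Set.mapsTo_image f A, hi⟩

/-- An infinite set is the union of two disjoint sets equinumerous with it. -/
theorem exists_halves (h : 𝓜.Background) (hA : 𝓜.ISet A) (hi : 𝓜.Infin A) :
    ∃ P Q, 𝓜.ISet P ∧ 𝓜.ISet Q ∧ P ∪ Q = A ∧ Disjoint P Q ∧ 𝓜.Equi A P ∧ 𝓜.Equi A Q := by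
  have hi' := (h.dedekindInfinite_iff hA).2 hi
  obtain ⟨F, G, hF, hG, hc, hd⟩ := (h.sums hA.concept hA.concept hi' hi').1
    ((h.cardLE_iff (by simpa using hA) (by simpa using hA)).2 (by
      simpa using (h.equi_refl A).embeds))
  rw [ISet.ext_concept] at hF hG hc hd
  have key : ∀ F : 𝓜.Rel 2, 𝓜.IsInj F A A → ∃ f, 𝓜.IFun f ∧ Set.MapsTo f A A ∧ Set.InjOn f A ∧
      ∀ x ∈ A, ∀ z ∈ A, ![x, z] ∈ F.1 ↔ f x = z := by
    rintro F ⟨h1, h2⟩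
    obtain ⟨f, hf, hf'⟩ := h.exists_ifun hA (R := fun x y => y ∈ A ∧ ![x, y] ∈ F.1)
      (h.and (h.mem hA (h.proj 1)) (h.rel (iRel_rel F) (h.proj 0) (h.proj 1))) h1
    have hfB : ∀ x ∈ A, f x ∈ A ∧ ![x, f x] ∈ F.1 := fun x hx => (hf' x hx _).1 rfl
    refine ⟨f, hf, fun x hx => (hfB x hx).1, fun x hx x' hx' e => ?_, fun x hx z hz => ?_⟩
    · exact h2 x hx x' hx' (f x) (hfB x hx).1 (hfB x hx).2 (e ▸ (hfB x' hx').2)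
    · rw [hf' x hx z]; tauto
  obtain ⟨f, hf, hfm, hfi, hfF⟩ := key F hF
  obtain ⟨g, hg, hgm, hgi, hgG⟩ := key G hG
  refine ⟨f '' A, g '' A, h.image hf hA, h.image hg hA, ?_, ?_, h.equi_image hf hfi,
    h.equi_image hg hgi⟩
  · refine Set.Subset.antisymm (Set.union_subset hfm.image_subset hgm.image_subset) fun z hz => ?_
    rcases hc z hz with ⟨x, hx, e⟩ | ⟨x, hx, e⟩
    · exact Or.inl ⟨x, hx, (hfF x hx z hz).1 e⟩
    · exact Or.inr ⟨x, hx, (hgG x hx z hz).1 e⟩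
  · rw [Set.disjoint_left]
    rintro _ ⟨x, hx, rfl⟩ ⟨y, hy, e⟩
    exact hd (f x) (hfm hx) ⟨⟨x, hx, (hfF x hx _ (hfm hx)).2 rfl⟩,
      ⟨y, hy, (hgG y hy _ (hfm hx)).2 e⟩⟩

/-- On an infinite set there is an internal pairing function. -/
theorem exists_pairing (h : 𝓜.Background) (hA : 𝓜.ISet A) (hi : 𝓜.Infin A) :
    ∃ p : M → M → M, 𝓜.IFun₂ p ∧ (∀ x ∈ A, ∀ y ∈ A, p x y ∈ A) ∧
      ∀ x ∈ A, ∀ y ∈ A, ∀ x' ∈ A, ∀ y' ∈ A, p x y = p x' y' → x = x' ∧ y = y' := by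
  classical
  have hi' := (h.dedekindInfinite_iff hA).2 hi
  obtain ⟨P, hP, hP'⟩ := (h.products hA.concept hA.concept hi' hi').1
    ((h.cardLE_iff (by simpa using hA) (by simpa using hA)).2 (by
      simpa using (h.equi_refl A).embeds))
  rw [ISet.ext_concept] at hP hP'
  choose! p hp hpu using hP
  have hR : 𝓜.IRel₃ fun x y z => (x ∈ A ∧ y ∈ A) ∧ (z ∈ A ∧ ![x, y, z] ∈ P.1) ∨
      ¬ (x ∈ A ∧ y ∈ A) ∧ x = z :=
    h.or (h.and (h.and (h.mem hA (h.proj 0)) (h.mem hA (h.proj 1)))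
      (h.and (h.mem hA (h.proj 2)) (h.rel₃ (iRel₃_rel P) (h.proj 0) (h.proj 1) (h.proj 2))))
      (h.and (h.not (h.and (h.mem hA (h.proj 0)) (h.mem hA (h.proj 1))))
        (h.eq (h.proj 0) (h.proj 2)))
  refine ⟨fun x y => if x ∈ A ∧ y ∈ A then p x y else x, ?_, fun x hx y hy => ?_, ?_⟩
  · unfold IFun₂
    convert hR using 5 with x y z
    by_cases hxy : x ∈ A ∧ y ∈ A
    · simp only [hxy, and_self, if_true, true_and, not_true_eq_false, false_and, or_false]
      exact ⟨fun e => e ▸ hp x hxy.1 y hxy.2,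
        fun e => (hpu x hxy.1 y hxy.2 z e).symm⟩
    · simp [hxy]
  · simp only [hx, hy, and_self, if_true]
    exact (hp x hx y hy).1
  · intro x hx y hy x' hx' y' hy' e
    simp only [hx, hy, hx', hy', and_self, if_true] at e
    obtain ⟨h1, h2⟩ := hp x hx y hy
    obtain ⟨-, h4⟩ := hp x' hx' y' hy'
    have := (hP' _ h1).unique (y₁ := (x, y)) (y₂ := (x', y')) ⟨hx, hy, h2⟩
      ⟨hx', hy', by rw [e]; exact h4⟩
    exact ⟨congrArg Prod.fst this, congrArg Prod.snd this⟩

theorem bicardEquiv_iff (h : 𝓜.Background) (X Y : 𝓜.Concept) :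
    𝓜.BicardEquiv X Y ↔ 𝓜.Equi (ext X) (ext Y) ∧ 𝓜.Equi (ext X)ᶜ (ext Y)ᶜ := by
  rw [BicardEquiv, h.cardEq_iff (iSet_ext X) (iSet_ext Y),
    h.cardEq_iff (h.compl (iSet_ext X)) (h.compl (iSet_ext Y))]

end Background

end SOStructure

/-! ### Bicardinal equivalence and sets of the size of the domain -/

namespace SOStructure

variable {M : Type u} {ι κ : Type} {𝓜 : SOStructure M}

/-- `A` is as large as the whole domain. -/
def Big (𝓜 : SOStructure M) (A : Set M) : Prop := 𝓜.Embeds Set.univ A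

/-- `X` and `Y` are bicardinally equivalent in `𝓜`. -/
def Bic (𝓜 : SOStructure M) (X Y : Set M) : Prop := 𝓜.Equi X Y ∧ 𝓜.Equi Xᶜ Yᶜ

namespace Background

variable {A B C U V X Y : Set M} {f g : M → M}

theorem embeds_mono (h : 𝓜.Background) (hAB : 𝓜.Embeds A B) (hBC : B ⊆ C) : 𝓜.Embeds A C :=
  h.embeds_trans hAB (h.embeds_of_subset hBC)

theorem Big.mono (h : 𝓜.Background) (hA : 𝓜.Big A) (hAB : A ⊆ B) : 𝓜.Big B := h.embeds_mono hA hAB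

theorem big_of_embeds (h : 𝓜.Background) (hA : 𝓜.Big A) (hAB : 𝓜.Embeds A B) : 𝓜.Big B :=
  h.embeds_trans hA hAB

theorem embeds_of_big (h : 𝓜.Background) (hB : 𝓜.Big B) (A : Set M) : 𝓜.Embeds A B :=
  h.embeds_trans (h.embeds_of_subset (Set.subset_univ A)) hB

theorem equi_of_big (h : 𝓜.Background) (hA : 𝓜.ISet A) (hB : 𝓜.ISet B) (hA' : 𝓜.Big A)
    (hB' : 𝓜.Big B) : 𝓜.Equi A B :=
  h.equi_of_embeds hA hB (h.embeds_of_big hB' A) (h.embeds_of_big hA' B)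

theorem bic_refl (h : 𝓜.Background) (X : Set M) : 𝓜.Bic X X := ⟨h.equi_refl _, h.equi_refl _⟩

theorem bic_symm (h : 𝓜.Background) (hX : 𝓜.ISet X) (hY : 𝓜.ISet Y) (hXY : 𝓜.Bic X Y) :
    𝓜.Bic Y X :=
  ⟨h.equi_symm hX hY hXY.1, h.equi_symm (h.compl hX) (h.compl hY) hXY.2⟩

theorem bic_trans (h : 𝓜.Background) (h1 : 𝓜.Bic A B) (h2 : 𝓜.Bic B C) : 𝓜.Bic A C :=
  ⟨h.equi_trans h1.1 h2.1, h.equi_trans h1.2 h2.2⟩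

theorem bic_image (h : 𝓜.Background) {π : Equiv.Perm M} (hπ : 𝓜.IPerm π) (X : Set M) :
    𝓜.Bic X (π '' X) := by
  refine ⟨h.equi_image hπ π.injective.injOn, ?_⟩
  rw [← Set.image_compl_eq π.bijective]
  exact h.equi_image hπ π.injective.injOn

theorem bic_iff_exists_iPerm (h : 𝓜.Background) (hX : 𝓜.ISet X) :
    𝓜.Bic X Y ↔ ∃ π : Equiv.Perm M, 𝓜.IPerm π ∧ π '' X = Y := by
  refine ⟨fun hXY => h.exists_iPerm hX hXY.1 hXY.2, ?_⟩
  rintro ⟨π, hπ, rfl⟩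
  exact h.bic_image hπ X

/-- An internal bijection between sets with equinumerous complements extends to a permutation. -/
theorem exists_iPerm_extending (h : 𝓜.Background) (hA : 𝓜.ISet A) (hf : 𝓜.IFun f)
    (hb : Set.BijOn f A B) (hc : 𝓜.Equi Aᶜ Bᶜ) :
    ∃ π : Equiv.Perm M, 𝓜.IPerm π ∧ Set.EqOn π f A := by
  obtain ⟨g, hg, hb'⟩ := hc
  obtain ⟨k, hk, kb, k1, -⟩ := h.exists_glue hA hf hg hb hb' disjoint_compl_right
    disjoint_compl_right
  rw [Set.union_compl_self, Set.union_compl_self, Set.bijOn_univ] at kb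
  exact ⟨Equiv.ofBijective k kb, hk, k1⟩

/-! ### Infinite sets -/

theorem infin_of_embeds (h : 𝓜.Background) (hA : 𝓜.ISet A) (hB : 𝓜.ISet B) (hi : 𝓜.Infin A)
    (hAB : 𝓜.Embeds A B) : 𝓜.Infin B := by
  obtain ⟨f, hf, hm, hfi, a, ha, haf⟩ := hi
  obtain ⟨e, he, hem, hei⟩ := hAB
  -- `e ∘ f ∘ e⁻¹` on the image of `A`, the identity on the rest of `B`.
  obtain ⟨k, hk, hk'⟩ := h.exists_ifun hB
    (R := fun x y => (∃ u, u ∈ A ∧ e u = x ∧ y = e (f u)) ∨ (x ∉ e '' A ∧ y = x))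
    (h.or (h.ex (h.and (h.mem hA (h.proj 0)) (h.and (h.eq (h.app he (h.proj 0)) (h.proj 1))
        (h.eq (h.proj 2) (h.app he (h.app hf (h.proj 0)))))))
      (h.and (h.not (h.mem (h.image he hA) (h.proj 0))) (h.eq (h.proj 1) (h.proj 0)))) (by
    intro x hx
    by_cases hxe : x ∈ e '' A
    · obtain ⟨u, hu, rfl⟩ := hxe
      refine ⟨e (f u), Or.inl ⟨u, hu, rfl, rfl⟩, fun y hy => ?_⟩
      rcases hy with ⟨w, hw, e1, rfl⟩ | hy
      · rw [hei hw hu e1]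
      · exact absurd ⟨u, hu, rfl⟩ hy.1
    · refine ⟨x, Or.inr ⟨hxe, rfl⟩, fun y hy => ?_⟩
      rcases hy with ⟨w, hw, e1, -⟩ | hy
      · exact absurd ⟨w, hw, e1⟩ hxe
      · exact hy.2)
  have k1 : ∀ u ∈ A, k (e u) = e (f u) := fun u hu =>
    (hk' _ (hem hu) _).2 (Or.inl ⟨u, hu, rfl, rfl⟩)
  have k2 : ∀ x ∈ B, x ∉ e '' A → k x = x := fun x hx hxe => (hk' _ hx _).2 (Or.inr ⟨hxe, rfl⟩)
  refine ⟨k, hk, fun x hx => ?_, fun x hx y hy hxy => ?_, e a, hem ha, ?_⟩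
  · by_cases hxe : x ∈ e '' A
    · obtain ⟨u, hu, rfl⟩ := hxe
      rw [k1 u hu]; exact hem (hm hu)
    · rw [k2 x hx hxe]; exact hx
  · by_cases hxe : x ∈ e '' A <;> by_cases hye : y ∈ e '' A
    · obtain ⟨u, hu, rfl⟩ := hxe
      obtain ⟨w, hw, rfl⟩ := hye
      rw [k1 u hu, k1 w hw] at hxy
      rw [hfi hu hw (hei (hm hu) (hm hw) hxy)]
    · obtain ⟨u, hu, rfl⟩ := hxe
      rw [k1 u hu, k2 y hy hye] at hxy
      exact absurd ⟨_, hm hu, hxy⟩ hye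
    · obtain ⟨w, hw, rfl⟩ := hye
      rw [k1 w hw, k2 x hx hxe] at hxy
      exact absurd ⟨_, hm hw, hxy.symm⟩ hxe
    · rwa [k2 x hx hxe, k2 y hy hye] at hxy
  · rintro ⟨x, hx, hxa⟩
    by_cases hxe : x ∈ e '' A
    · obtain ⟨u, hu, rfl⟩ := hxe
      rw [k1 u hu] at hxa
      exact haf ⟨u, hu, hei (hm hu) ha hxa⟩
    · rw [k2 x hx hxe] at hxa
      exact hxe ⟨a, ha, hxa.symm⟩

/-- A finite set does not embed into a proper subset. -/
theorem eq_of_subset_of_embeds (_ : 𝓜.Background) (hi : ¬ 𝓜.Infin A) (hBA : B ⊆ A)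
    (hAB : 𝓜.Embeds A B) : B = A := by
  obtain ⟨f, hf, hm, hfi⟩ := hAB
  refine hBA.antisymm fun a ha => ?_
  by_contra haB
  exact hi ⟨f, hf, fun x hx => hBA (hm hx), hfi, a, ha, fun ⟨x, hx, e⟩ => haB (e ▸ hm hx)⟩

theorem exists_ne_of_infin (_ : 𝓜.Background) (hi : 𝓜.Infin A) :
    ∃ a ∈ A, ∃ b ∈ A, a ≠ b := by
  obtain ⟨f, hf, hm, hfi, a, ha, haf⟩ := hi
  exact ⟨a, ha, f a, hm ha, fun e => haf ⟨a, ha, e.symm⟩⟩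

/-- If an infinite set embeds into a union, it embeds into one of the two parts. -/
theorem embeds_or_of_union (h : 𝓜.Background) (hA : 𝓜.ISet A) (hU : 𝓜.ISet U)
    (hi : 𝓜.Infin A) (hAUV : 𝓜.Embeds A (U ∪ V)) : 𝓜.Embeds A U ∨ 𝓜.Embeds A V := by
  obtain ⟨P, Q, hP, hQ, hPQ, hd, eP, eQ⟩ := h.exists_halves hA hi
  obtain ⟨f, hf, hm, hfi⟩ := hAUV
  have hfU := h.preimage hf hU
  have hPA : P ⊆ A := hPQ ▸ Set.subset_union_left
  have hQA : Q ⊆ A := hPQ ▸ Set.subset_union_right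
  -- Compare the part of one half that is mapped to `U` with the part of the other that is not.
  rcases h.embeds_total (h.inter hP hfU) (h.diff hQ hfU) with h1 | h1
  · right
    have h2 := h.embeds_union (h.inter hP hfU) h1 (h.embeds_of_subset (subset_refl (P \ f ⁻¹' U)))
      (Set.disjoint_left.2 fun x hx hx' => hx'.2 hx.2)
      (hd.symm.mono Set.sdiff_subset Set.sdiff_subset)
    rw [Set.inter_union_sdiff] at h2
    refine h.embeds_trans eP.embeds (h.embeds_trans h2 ⟨f, hf, fun x hx => ?_, fun x hx y hy =>
      hfi ?_ ?_⟩)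
    · rcases hx with hx | hx
      · exact (hm (hQA hx.1)).resolve_left hx.2
      · exact (hm (hPA hx.1)).resolve_left hx.2
    · exact hx.elim (fun hx => hQA hx.1) (fun hx => hPA hx.1)
    · exact hy.elim (fun hx => hQA hx.1) (fun hx => hPA hx.1)
  · left
    have h2 := h.embeds_union (h.diff hQ hfU) h1 (h.embeds_of_subset (subset_refl (Q ∩ f ⁻¹' U)))
      (Set.disjoint_left.2 fun x hx hx' => hx.2 hx'.2)
      (hd.mono Set.inter_subset_left Set.inter_subset_left)
    rw [Set.sdiff_union_inter] at h2
    refine h.embeds_trans eQ.embeds (h.embeds_trans h2 ⟨f, hf, fun x hx => ?_, fun x hx y hy =>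
      hfi ?_ ?_⟩)
    · exact hx.elim (fun hx => hx.2) (fun hx => hx.2)
    · exact hx.elim (fun hx => hPA hx.1) (fun hx => hQA hx.1)
    · exact hy.elim (fun hx => hPA hx.1) (fun hx => hQA hx.1)

section InfiniteDomain

variable (h : 𝓜.Background) (hM : 𝓜.Infin (Set.univ : Set M))
include h hM

theorem infin_of_big (hA : 𝓜.ISet A) (hA' : 𝓜.Big A) : 𝓜.Infin A :=
  h.infin_of_embeds h.univ hA hM hA'

theorem big_or_of_union (hA : 𝓜.ISet A) (hAB : 𝓜.Big (A ∪ B)) :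
    𝓜.Big A ∨ 𝓜.Big B :=
  h.embeds_or_of_union h.univ hA hM hAB

theorem big_compl_or (hA : 𝓜.ISet A) : 𝓜.Big A ∨ 𝓜.Big Aᶜ :=
  h.big_or_of_union hM hA (by
    rw [Set.union_compl_self]; exact (h.equi_refl _).embeds)

theorem exists_big_halves (hA : 𝓜.ISet A) (hA' : 𝓜.Big A) :
    ∃ P Q, 𝓜.ISet P ∧ 𝓜.ISet Q ∧ P ∪ Q = A ∧ Disjoint P Q ∧ 𝓜.Big P ∧ 𝓜.Big Q := by
  obtain ⟨P, Q, hP, hQ, hPQ, hd, eP, eQ⟩ := h.exists_halves hA (h.infin_of_big hM hA hA')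
  exact ⟨P, Q, hP, hQ, hPQ, hd, h.big_of_embeds hA' eP.embeds, h.big_of_embeds hA' eQ.embeds⟩

/-- Inside a set of the size of the domain every set has a copy that leaves as much room. -/
theorem exists_copy (hA : 𝓜.ISet A) (hA' : 𝓜.Big A) (hX : 𝓜.ISet X) :
    ∃ Z, 𝓜.ISet Z ∧ Z ⊆ A ∧ 𝓜.Equi X Z ∧ 𝓜.Big (A \ Z) := by
  obtain ⟨P, Q, hP, hQ, hPQ, hd, bP, bQ⟩ := h.exists_big_halves hM hA hA'
  obtain ⟨f, hf, hm, hi⟩ := h.embeds_of_big bP X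
  refine ⟨f '' X, h.image hf hX, hm.image_subset.trans (hPQ ▸ Set.subset_union_left),
    h.equi_image hf hi, Big.mono h bQ fun x hx => ⟨hPQ ▸ Or.inr hx, fun hx' => ?_⟩⟩
  exact Set.disjoint_left.1 hd (hm.image_subset hx') hx

end InfiniteDomain

end Background

end SOStructure

/-! ### Abstraction operators as functions on sets -/

namespace SOStructure

variable {M : Type u} {𝓜 : SOStructure M}

/-- What the argument uses about an abstraction operator, written as a function `d` on sets of
objects of which only the values on the concepts of `𝓜` matter. Two concepts are `E`-equivalent when
they have the same value. The field `image_eq` says that internal permutations preserve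
equivalence. The fields `family`, `few` and `diagonal` are instances of comprehension: for
the abstracts of a family of concepts, for the abstracts of those concepts of the type of `X` that
are not as large as their parts in `S`, and for the set that is used in Russell's argument. The field
`swap` says that all concepts bicardinally equivalent to a finite concept `X` are equivalent to it if
exchanging one element of `X` for another object can lead to an equivalent concept. -/
structure Naming (𝓜 : SOStructure M) (d : Set M → M) : Prop where
  image_eq : ∀ {π : Equiv.Perm M} {A B : Set M}, 𝓜.IPerm π → 𝓜.ISet A → 𝓜.ISet B → d A = d B →
    d (π '' A) = d (π '' B)
  family : ∀ {R : M → M → Prop}, 𝓜.IRel R → 𝓜.IFun fun m => d {y | R m y}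
  few : ∀ {X S : Set M}, 𝓜.ISet X → 𝓜.ISet S →
    𝓜.ISet {x | ∃ Z, 𝓜.ISet Z ∧ d Z = x ∧ 𝓜.Bic X Z ∧ ¬ 𝓜.Embeds Z (Z ∩ S)}
  diagonal : ∀ {L₀ L₁ : M → M → Prop}, 𝓜.IRel L₀ → 𝓜.IRel L₁ →
    𝓜.ISet {x | ∃ Z, 𝓜.ISet Z ∧ d Z = x ∧
      (∀ y, y ∈ Z ↔ ∃ c, ((∀ z, L₀ c z → z ∈ Z) ∧ L₀ c y) ∨ (¬ (∀ z, L₀ c z → z ∈ Z) ∧ L₁ c y)) ∧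
      ¬ ∀ z, L₀ x z → z ∈ Z}
  swap : ∀ {X Y : Set M}, 𝓜.ISet X → 𝓜.ISet Y → 𝓜.Bic X Y → ¬ 𝓜.Infin X →
    (∃ x ∈ X, ∃ z ∉ X, d X = d (insert z (X \ {x}))) → d X = d Y

/-- Some concept bicardinally equivalent to `X` has a different abstract. -/
def Bad (𝓜 : SOStructure M) (d : Set M → M) (X : Set M) : Prop :=
  ∃ Y, 𝓜.ISet Y ∧ 𝓜.Bic X Y ∧ d X ≠ d Y

section

variable {d : Set M → M} {X X₀ Y U V W S : Set M}
variable (h : 𝓜.Background) (hd : 𝓜.Naming d)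
include h hd

omit h in
theorem Naming.transport {π : Equiv.Perm M} (hπ : 𝓜.IPerm π) (hX : 𝓜.ISet X) (hY : 𝓜.ISet Y)
    (e : d X = d Y) (hU : π '' X = U) (hV : π '' Y = V) : d U = d V :=
  hU ▸ hV ▸ hd.image_eq hπ hX hY e

variable (hM : 𝓜.Infin (Set.univ : Set M)) (hX₀ : 𝓜.ISet X₀) (hB₀ : 𝓜.Big X₀ᶜ)
include hM hX₀ hB₀

omit hd hM in
theorem bic_of_equi_of_big (hY : 𝓜.ISet Y) (e : 𝓜.Equi X₀ Y) (hb : 𝓜.Big Yᶜ) : 𝓜.Bic X₀ Y :=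
  ⟨e, h.equi_of_big (h.compl hX₀) (h.compl hY) hB₀ hb⟩

omit hd hM hX₀ in
theorem big_compl_of_bic (e : 𝓜.Bic X₀ Y) : 𝓜.Big Yᶜ := h.big_of_embeds hB₀ e.2.embeds

/-- If two disjoint concepts bicardinally equivalent to `X₀` and leaving much room have the same
abstract, then all concepts bicardinally equivalent to `X₀` do. -/
theorem eq_of_disjoint (hX : 𝓜.ISet X) (hY : 𝓜.ISet Y) (bX : 𝓜.Bic X₀ X) (bY : 𝓜.Bic X₀ Y)
    (hXY : Disjoint X Y) (hr : 𝓜.Big (X ∪ Y)ᶜ) (e : d X = d Y)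
    (hU : 𝓜.ISet U) (hV : 𝓜.ISet V) (bU : 𝓜.Bic X₀ U) (bV : 𝓜.Bic X₀ V) : d U = d V := by
  have step1 : ∀ {U V : Set M}, 𝓜.ISet U → 𝓜.ISet V → 𝓜.Bic X₀ U → 𝓜.Bic X₀ V → Disjoint U V →
      𝓜.Big (U ∪ V)ᶜ → d U = d V := by
    intro U V hU hV bU bV hUV hr'
    obtain ⟨π, hπ, e1, e2⟩ := h.exists_iPerm₂ hX hY
      (h.equi_trans (h.equi_symm hX₀ hX bX.1) bU.1) (h.equi_trans (h.equi_symm hX₀ hY bY.1) bV.1)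
      (h.equi_of_big (h.compl (h.union hX hY)) (h.compl (h.union hU hV)) hr hr') hXY hUV
    exact hd.transport hπ hX hY e e1 e2
  have step2 : ∀ {U V : Set M}, 𝓜.ISet U → 𝓜.ISet V → 𝓜.Bic X₀ U → 𝓜.Bic X₀ V →
      𝓜.Big (U ∪ V)ᶜ → d U = d V := by
    intro U V hU hV bU bV hr'
    obtain ⟨W, hW, hWs, eW, bW⟩ := h.exists_copy hM (h.compl (h.union hU hV)) hr' hX₀
    have bW' : 𝓜.Bic X₀ W := bic_of_equi_of_big h hX₀ hB₀ hW eW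
      (Background.Big.mono h bW fun x hx => hx.2)
    refine (step1 hU hW bU bW' ?_ ?_).trans (step1 hV hW bV bW' ?_ ?_).symm
    · exact Set.disjoint_left.2 fun x hx hx' => hWs hx' (Or.inl hx)
    · exact Background.Big.mono h bW fun x hx hx' =>
        hx'.elim (fun hx' => hx.1 (Or.inl hx')) hx.2
    · exact Set.disjoint_left.2 fun x hx hx' => hWs hx' (Or.inr hx)
    · exact Background.Big.mono h bW fun x hx hx' =>
        hx'.elim (fun hx' => hx.1 (Or.inr hx')) hx.2
  rcases h.big_compl_or hM (h.union hU hV) with hb | hb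
  swap
  · exact step2 hU hV bU bV hb
  -- Now `U` and `V` are as large as the domain; compare suitable halves of them.
  have hX₀b : 𝓜.Big X₀ := by
    rcases h.big_or_of_union hM hU hb with hb | hb
    · exact h.big_of_embeds hb (h.equi_symm hX₀ hU bU.1).embeds
    · exact h.big_of_embeds hb (h.equi_symm hX₀ hV bV.1).embeds
  have half : ∀ {U U' : Set M}, 𝓜.ISet U → 𝓜.ISet U' → 𝓜.Bic X₀ U → U' ⊆ U → 𝓜.Big U' →
      𝓜.Bic X₀ U' ∧ d U = d U' := by
    intro U U' hU hU' bU hs hb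
    have bU' : 𝓜.Bic X₀ U' := bic_of_equi_of_big h hX₀ hB₀ hU' (h.equi_of_big hX₀ hU' hX₀b hb)
      (Background.Big.mono h (big_compl_of_bic h hB₀ bU) (Set.compl_subset_compl.2 hs))
    refine ⟨bU', step2 hU hU' bU bU' ?_⟩
    rw [Set.union_eq_left.2 hs]
    exact big_compl_of_bic h hB₀ bU
  obtain ⟨U₁, U₂, hU₁, hU₂, eU, dU, hbU₁, hbU₂⟩ := h.exists_big_halves hM hU
    (h.big_of_embeds hX₀b bU.1.embeds)
  obtain ⟨V₁, V₂, hV₁, hV₂, eV, dV, hbV₁, hbV₂⟩ := h.exists_big_halves hM hV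
    (h.big_of_embeds hX₀b bV.1.embeds)
  obtain ⟨bU₁, e1⟩ := half hU hU₁ bU (eU ▸ Set.subset_union_left) hbU₁
  have fin : ∀ {V' : Set M}, 𝓜.ISet V' → V' ⊆ V → 𝓜.Big V' → 𝓜.Big (U₂ \ V') → d U = d V := by
    intro V' hV' hs hb hb'
    obtain ⟨bV', e2⟩ := half hV hV' bV hs hb
    rw [e1, e2]
    refine step2 hU₁ hV' bU₁ bV' (Background.Big.mono h hb' fun x hx hx' => ?_)
    exact hx'.elim (fun hx' => Set.disjoint_left.1 dU hx' hx.1) hx.2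
  rcases h.big_or_of_union hM (h.diff hU₂ hV₁) (B := U₂ \ V₂) (Background.Big.mono h hbU₂
    fun x hx => by
      by_cases hx1 : x ∈ V₁
      · exact Or.inr ⟨hx, Set.disjoint_left.1 dV hx1⟩
      · exact Or.inl ⟨hx, hx1⟩) with hb | hb
  · exact fin hV₁ (eV ▸ Set.subset_union_left) hbV₁ hb
  · exact fin hV₂ (eV ▸ Set.subset_union_right) hbV₂ hb

/-- If two concepts bicardinally equivalent to the infinite concept `X₀` leave much room, differ by
as many objects as they have, and have the same abstract, then all concepts bicardinally equivalent
to `X₀` do. -/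
theorem eq_of_large_diff (hi : 𝓜.Infin X₀) (hX : 𝓜.ISet X) (hY : 𝓜.ISet Y) (bX : 𝓜.Bic X₀ X)
    (hXY : 𝓜.Embeds X (X \ Y)) (hr : 𝓜.Big (X ∪ Y)ᶜ) (e : d X = d Y)
    (hU : 𝓜.ISet U) (hV : 𝓜.ISet V) (bU : 𝓜.Bic X₀ U) (bV : 𝓜.Bic X₀ V) : d U = d V := by
  set I := X ∩ Y with hI
  set P := X \ Y with hP
  have iI : 𝓜.ISet I := h.inter hX hY
  have iP : 𝓜.ISet P := h.diff hX hY
  have hIP : I ∪ P = X := Set.inter_union_sdiff X Y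
  have dIP : Disjoint I P := Set.disjoint_left.2 fun x hx hx' => hx'.2 hx.2
  have eP : 𝓜.Equi X₀ P := h.equi_of_embeds hX₀ iP (h.embeds_trans bX.1.embeds hXY)
    (h.embeds_trans (h.embeds_of_subset Set.sdiff_subset) (h.equi_symm hX₀ hX bX.1).embeds)
  -- Exchange the part `P` of `X` for a disjoint copy `Z`.
  obtain ⟨Z, iZ, hZs, eZ, bZ⟩ := h.exists_copy hM (h.compl (h.union hX hY)) hr iP
  have dXZ : Disjoint X Z := Set.disjoint_left.2 fun x hx hx' => hZs hx' (Or.inl hx)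
  have dYZ : Disjoint Y Z := Set.disjoint_left.2 fun x hx hx' => hZs hx' (Or.inr hx)
  have eIZ : d X = d (I ∪ Z) := by
    have iJ : 𝓜.ISet (Y \ X) := h.diff hY hX
    have hIJ : I ∪ Y \ X = Y := by rw [hI, Set.inter_comm]; exact Set.inter_union_sdiff Y X
    have dIJ : Disjoint I (Y \ X) := Set.disjoint_left.2 fun x hx hx' => hx'.2 hx.1
    obtain ⟨π, hπ, e1, e2, e3⟩ := h.exists_iPerm₃ iI iJ iP (h.equi_refl I) (h.equi_refl (Y \ X)) eZ
      (by
        rw [hIJ]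
        refine h.equi_of_big (h.compl (h.union hY iP)) (h.compl (h.union hY iZ))
          (Background.Big.mono h hr ?_) (Background.Big.mono h bZ ?_)
        · exact fun x hx hx' => hx (hx'.elim Or.inr fun hx' => Or.inl hx'.1)
        · exact fun x hx hx' => hx'.elim (fun hx' => hx.1 (Or.inr hx')) hx.2)
      dIJ (by rw [hIJ]; exact Set.disjoint_left.2 fun x hx hx' => hx'.2 hx)
      dIJ (by rw [hIJ]; exact dYZ)
    refine e.trans (hd.transport hπ hX hY e (U := I ∪ Z) (V := Y) ?_ ?_).symm
    · rw [← hIP, Set.image_union, e1, e3]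
    · conv_lhs => rw [← hIJ]
      rw [Set.image_union, e1, e2, hIJ]
  have dIZ : Disjoint I Z := dXZ.mono_left (hIP ▸ Set.subset_union_left)
  have dPZ : Disjoint P Z := dXZ.mono_left (hIP ▸ Set.subset_union_right)
  have key : ∀ {A T T' : Set M}, 𝓜.ISet A → 𝓜.ISet T → 𝓜.ISet T' → 𝓜.Equi I A → 𝓜.Equi P T →
      𝓜.Equi Z T' → Disjoint A T → Disjoint (A ∪ T) T' → 𝓜.Big (A ∪ T ∪ T')ᶜ →
      d (A ∪ T) = d (A ∪ T') := by
    intro A T T' iA iT iT' eA eT eT' dAT dT' hr'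
    obtain ⟨π, hπ, e1, e2, e3⟩ := h.exists_iPerm₃ iI iP iZ eA eT eT'
      (h.equi_of_big (h.compl (h.union (h.union iI iP) iZ)) (h.compl (h.union (h.union iA iT) iT'))
        (Background.Big.mono h bZ fun x hx hx' => hx'.elim
          (fun hx' => hx.1 (Or.inl (hIP ▸ hx'))) hx.2) hr') dIP (hIP ▸ dXZ) dAT dT'
    refine hd.transport hπ hX (h.union iI iZ) eIZ ?_ ?_
    · rw [← hIP, Set.image_union, e1, e2]
    · rw [Set.image_union, e1, e3]
  -- Exchange the rest of `X` as well, by moving `I` into `Z`.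
  have eZ₀ : 𝓜.Equi X₀ Z := h.equi_trans eP eZ
  obtain ⟨Z₁, Z₂, iZ₁, iZ₂, hZ, dZ, eZ₁, eZ₂⟩ := h.exists_halves iZ
    (h.infin_of_embeds hX₀ iZ hi eZ₀.embeds)
  obtain ⟨f, hf, hfm, hfi⟩ : 𝓜.Embeds I Z₂ := h.embeds_trans (h.embeds_of_subset
    (Set.inter_subset_left : I ⊆ X)) (h.embeds_trans hXY (h.embeds_trans eZ.embeds eZ₂.embeds))
  set A := f '' I with hA
  have iA : 𝓜.ISet A := h.image hf iI
  have hAZ₂ : A ⊆ Z₂ := hfm.image_subset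
  have hAZ : A ⊆ Z := hAZ₂.trans (hZ ▸ Set.subset_union_right)
  have iIZ : 𝓜.ISet (I ∪ Z) := h.union iI iZ
  set T := (I ∪ Z) \ A with hT
  have iT : 𝓜.ISet T := h.diff iIZ iA
  have hAT : A ∪ T = I ∪ Z := Set.union_sdiff_cancel (hAZ.trans Set.subset_union_right)
  have hIX : 𝓜.Embeds (I ∪ Z) P := by
    have : 𝓜.Embeds (I ∪ Z) (I ∪ P) := h.embeds_union iI (h.embeds_of_subset subset_rfl)
      (h.equi_symm iP iZ eZ).embeds dIZ dIP
    rw [hIP] at this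
    exact h.embeds_trans this hXY
  have eT : 𝓜.Equi P T := h.equi_of_embeds iP iT
    (h.embeds_mono (h.embeds_trans eZ.embeds eZ₁.embeds) fun x hx => ⟨Or.inr (hZ ▸ Or.inl hx),
      fun hx' => Set.disjoint_left.1 dZ hx (hAZ₂ hx')⟩)
    (h.embeds_trans (h.embeds_of_subset Set.sdiff_subset) hIX)
  have bXZ : 𝓜.Big (X ∪ Z)ᶜ := Background.Big.mono h bZ fun x hx hx' =>
    hx'.elim (fun hx' => hx.1 (Or.inl hx')) hx.2
  obtain ⟨T', iT', hT's, eT', bT'⟩ := h.exists_copy hM (h.compl (h.union hX iZ)) bXZ iZ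
  have e2 : d (I ∪ Z) = d (A ∪ T') := by
    have := key iA iT iT' (h.equi_image hf hfi) eT eT'
      (Set.disjoint_left.2 fun x hx hx' => hx'.2 hx)
      (by rw [hAT]
          exact Set.disjoint_left.2 fun x hx hx' => hT's hx' (hx.elim (fun q => Or.inl q.1) Or.inr))
      (Background.Big.mono h bT' fun x hx hx' => hx'.elim
        (fun hx' => hx.1 ((hAT ▸ hx' : x ∈ I ∪ Z).elim (fun q => Or.inl q.1) Or.inr)) hx.2)
    rwa [hAT] at this
  have dXA : Disjoint X (A ∪ T') := Set.disjoint_left.2 fun x hx hx' => hx'.elim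
    (fun q => Set.disjoint_left.1 dXZ hx (hAZ q)) (fun q => hT's q (Or.inl hx))
  have bXA : 𝓜.Big (X ∪ (A ∪ T'))ᶜ := Background.Big.mono h bT' fun x hx hx' => by
    rcases hx' with q | q | q
    · exact hx.1 (Or.inl q)
    · exact hx.1 (Or.inr (hAZ q))
    · exact hx.2 q
  refine eq_of_disjoint h hd hM hX₀ hB₀ hX (h.union iA iT') bX
    (bic_of_equi_of_big h hX₀ hB₀ (h.union iA iT') ?_ (Background.Big.mono h bXA ?_)) dXA bXA
    (eIZ.trans e2) hU hV bU bV
  · refine h.equi_of_embeds hX₀ (h.union iA iT')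
      (h.embeds_mono (h.embeds_trans eZ₀.embeds eT'.embeds) Set.subset_union_right) ?_
    have : 𝓜.Embeds (A ∪ T') (I ∪ P) := h.embeds_union iA
      (h.equi_symm iI iA (h.equi_image hf hfi)).embeds
      (h.embeds_trans (h.equi_symm iZ iT' eT').embeds (h.equi_symm iP iZ eZ).embeds)
      (Set.disjoint_left.2 fun x hx hx' => hT's hx' (Or.inr (hAZ hx))) dIP
    rw [hIP] at this
    exact h.embeds_trans this (h.equi_symm hX₀ hX bX.1).embeds
  · exact Set.compl_subset_compl.2 Set.subset_union_right

end

end SOStructure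

/-! ### How equivalent concepts can differ in an infinite domain -/

namespace SOStructure

variable {M : Type u} {𝓜 : SOStructure M} {d : Set M → M} {X X₀ Y U V W S : Set M}

theorem Bad.nonempty (hb : 𝓜.Bad d X) : X.Nonempty := by
  obtain ⟨Y, -, ⟨⟨f, -, hf⟩, -⟩, hne⟩ := hb
  by_contra hX
  rw [Set.not_nonempty_iff_eq_empty] at hX
  subst hX
  have : Y = ∅ := by rw [← hf.image_eq, Set.image_empty]
  exact hne (by rw [this])

section

variable (h : 𝓜.Background) (hd : 𝓜.Naming d) (hM : 𝓜.Infin (Set.univ : Set M))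
  (hX₀ : 𝓜.ISet X₀) (hB₀ : 𝓜.Big X₀ᶜ) (hbad : 𝓜.Bad d X₀)
include h hd hM hX₀ hB₀ hbad

/-- A Russell argument: if `X₀` and its complement were both as large as the domain, one could
assign distinct objects to all concepts. The concept `C` is coded by the union of the lines
`L₀ c`, `c ∈ C`, and `L₁ c`, `c ∉ C`, for two families of disjoint large sets. -/
theorem not_big_of_bad : ¬ 𝓜.Big X₀ := by
  intro hbig
  obtain ⟨H, H', iH, iH', eH, dH, bH, bH'⟩ := h.exists_big_halves hM h.univ
    (h.equi_refl Set.univ).embeds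
  obtain ⟨p, ip, -, hp⟩ := h.exists_pairing h.univ hM
  obtain ⟨k₀, -, k₁, -, hk⟩ := h.exists_ne_of_infin hM
  obtain ⟨e, ie, heH, he⟩ := bH
  have hp' : ∀ {x y x' y'}, p x y = p x' y' → x = x' ∧ y = y' := fun q =>
    hp _ trivial _ trivial _ trivial _ trivial q
  have he' : ∀ {x y}, e x = e y → x = y := fun q => he trivial trivial q
  let L : M → M → M → Prop := fun k c y => ∃ m, y = e (p (p c k) m)
  have iL : ∀ k, 𝓜.IRel (L k) := fun k =>
    h.ex (h.eq (h.proj 2) (h.app ie (h.app₂ ip (h.app₂ ip (h.proj 1) (h.const k)) (h.proj 0))))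
  have Ldisj : ∀ {k k' c c' y}, L k c y → L k' c' y → k = k' ∧ c = c' := by
    rintro k k' c c' y ⟨m, rfl⟩ ⟨m', q⟩
    have := hp' (hp' (he' q)).1
    exact ⟨this.2, this.1⟩
  have Lbig : ∀ k c, 𝓜.Big {y | L k c y} := fun k c => ⟨fun m => e (p (p c k) m),
    h.ifun (h.app ie (h.app₂ ip (h.const _) (h.proj 0))), fun m _ => ⟨m, rfl⟩,
    fun m _ m' _ q => (hp' (he' q)).2⟩
  have Lne : ∀ k c, ∃ y, L k c y := fun k c => ⟨_, c, rfl⟩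
  have LH : ∀ {k c y}, L k c y → y ∈ H := by
    rintro k c y ⟨m, rfl⟩
    exact heH trivial
  -- The sets `Z` that code a concept, namely the concept of those `c` whose line `L₀ c` is in `Z`.
  let good : Set M → Prop := fun Z => ∀ y, y ∈ Z ↔
    ∃ c, ((∀ z, L k₀ c z → z ∈ Z) ∧ L k₀ c y) ∨ (¬ (∀ z, L k₀ c z → z ∈ Z) ∧ L k₁ c y)
  have good₁ : ∀ {Z}, good Z → ∀ c, ¬ (∀ z, L k₀ c z → z ∈ Z) → ∀ z, L k₁ c z → z ∈ Z :=
    fun hZ c hc z hz => (hZ z).2 ⟨c, Or.inr ⟨hc, hz⟩⟩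
  have good_not₀ : ∀ {Z}, good Z → ∀ c, ¬ (∀ z, L k₀ c z → z ∈ Z) → ∀ z, L k₀ c z → z ∉ Z := by
    intro Z hZ c hc z hz hzZ
    obtain ⟨c', q | q⟩ := (hZ z).1 hzZ
    · obtain ⟨-, rfl⟩ := Ldisj hz q.2
      exact hc q.1
    · exact hk (Ldisj hz q.2).1
  have good_not₁ : ∀ {Z}, good Z → ∀ c, (∀ z, L k₀ c z → z ∈ Z) → ∀ z, L k₁ c z → z ∉ Z := by
    intro Z hZ c hc z hz hzZ
    obtain ⟨c', q | q⟩ := (hZ z).1 hzZ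
    · exact hk (Ldisj hz q.2).1.symm
    · obtain ⟨-, rfl⟩ := Ldisj hz q.2
      exact q.1 hc
  have goodH : ∀ {Z}, good Z → Z ⊆ H := by
    intro Z hZ y hy
    obtain ⟨c, q | q⟩ := (hZ y).1 hy
    · exact LH q.2
    · exact LH q.2
  have good_bic : ∀ {Z}, 𝓜.ISet Z → good Z → 𝓜.Bic X₀ Z := by
    intro Z iZ hZ
    refine bic_of_equi_of_big h hX₀ hB₀ iZ (h.equi_of_big hX₀ iZ hbig ?_)
      (Background.Big.mono h bH' fun x hx hx' => Set.disjoint_left.1 dH (goodH hZ hx') hx)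
    by_cases hc : ∀ z, L k₀ k₀ z → z ∈ Z
    · exact Background.Big.mono h (Lbig k₀ k₀) hc
    · exact Background.Big.mono h (Lbig k₁ k₀) (good₁ hZ k₀ hc)
  have good_sep : ∀ {Z Z'}, 𝓜.ISet Z → 𝓜.ISet Z' → good Z → good Z' → d Z = d Z' →
      ∀ c, (∀ z, L k₀ c z → z ∈ Z) ↔ (∀ z, L k₀ c z → z ∈ Z') := by
    intro Z Z' iZ iZ' hZ hZ' hdZ c
    obtain ⟨Y, iY, bY, hY⟩ := hbad
    by_contra hc
    refine hY (eq_of_large_diff h hd hM hX₀ hB₀ (h.infin_of_big hM hX₀ hbig) iZ iZ'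
      (good_bic iZ hZ) (h.embeds_of_big ?_ _) (Background.Big.mono h bH' ?_) hdZ hX₀ iY
      (h.bic_refl _) bY)
    · by_cases hc' : ∀ z, L k₀ c z → z ∈ Z
      · have hc'' : ¬ ∀ z, L k₀ c z → z ∈ Z' := fun q => hc ⟨fun _ => q, fun _ => hc'⟩
        exact Background.Big.mono h (Lbig k₀ c) fun z hz => ⟨hc' z hz, good_not₀ hZ' c hc'' z hz⟩
      · have hc'' : ∀ z, L k₀ c z → z ∈ Z' := by
          by_contra q
          exact hc ⟨fun q' => absurd q' hc', fun q' => absurd q' q⟩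
        exact Background.Big.mono h (Lbig k₁ c) fun z hz =>
          ⟨good₁ hZ c hc' z hz, good_not₁ hZ' c hc'' z hz⟩
    · exact fun x hx hx' => Set.disjoint_left.1 dH (hx'.elim (fun q => goodH hZ q)
        (fun q => goodH hZ' q)) hx
  -- The objects that name a coded concept to which they do not belong themselves.
  set R := {x | ∃ Z, 𝓜.ISet Z ∧ d Z = x ∧ good Z ∧ ¬ ∀ z, L k₀ x z → z ∈ Z} with hR
  have iR : 𝓜.ISet R := hd.diagonal (iL k₀) (iL k₁)
  set Z := {y | ∃ c, (c ∈ R ∧ L k₀ c y) ∨ (c ∉ R ∧ L k₁ c y)} with hZ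
  have iZ : 𝓜.ISet Z := h.ex (h.or
    (h.and (h.mem iR (h.proj 0)) (h.rel (iL k₀) (h.proj 0) (h.proj 1)))
    (h.and (h.not (h.mem iR (h.proj 0))) (h.rel (iL k₁) (h.proj 0) (h.proj 1))))
  have hZR : ∀ c, (∀ z, L k₀ c z → z ∈ Z) ↔ c ∈ R := by
    refine fun c => ⟨fun hc => ?_, fun hc z hz => ⟨c, Or.inl ⟨hc, hz⟩⟩⟩
    obtain ⟨y, hy⟩ := Lne k₀ c
    obtain ⟨c', q | q⟩ := hc y hy
    · obtain ⟨-, rfl⟩ := Ldisj hy q.2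
      exact q.1
    · exact absurd (Ldisj hy q.2).1 hk
  have gZ : good Z := by
    intro y
    simp only [hZR]
    rfl
  by_cases hr : d Z ∈ R
  · obtain ⟨Z', iZ', e', gZ', hn⟩ := hr
    refine hn ((good_sep iZ iZ' gZ gZ' e'.symm _).1 ((hZR _).2 ⟨Z', iZ', e', gZ', hn⟩))
  · exact hr ⟨Z, iZ, rfl, gZ, fun q => hr ((hZR _).1 q)⟩

theorem big_compl_union (hX : 𝓜.ISet X) (hY : 𝓜.ISet Y) (bX : 𝓜.Bic X₀ X) (bY : 𝓜.Bic X₀ Y) :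
    𝓜.Big (X ∪ Y)ᶜ := by
  have hn := not_big_of_bad h hd hM hX₀ hB₀ hbad
  refine (h.big_compl_or hM (h.union hX hY)).resolve_left fun hb => ?_
  rcases h.big_or_of_union hM hX hb with hb | hb
  · exact hn (h.big_of_embeds hb (h.equi_symm hX₀ hX bX.1).embeds)
  · exact hn (h.big_of_embeds hb (h.equi_symm hX₀ hY bY.1).embeds)

/-- For finite `X₀`, equivalent concepts bicardinally equivalent to `X₀` are equal: otherwise a
transposition moves one of them and fixes the other, and exchanging one element would preserve
equivalence. -/
theorem eq_of_finite (hf : ¬ 𝓜.Infin X₀) (hX : 𝓜.ISet X) (hY : 𝓜.ISet Y) (bX : 𝓜.Bic X₀ X)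
    (bY : 𝓜.Bic X₀ Y) (e : d X = d Y) : X = Y := by
  classical
  have fX : ¬ 𝓜.Infin X := fun q => hf (h.infin_of_embeds hX hX₀ q (h.equi_symm hX₀ hX bX.1).embeds)
  have fY : ¬ 𝓜.Infin Y := fun q => hf (h.infin_of_embeds hY hX₀ q (h.equi_symm hX₀ hY bY.1).embeds)
  have bXX := h.bic_symm hX₀ hX bX
  by_contra hne
  obtain ⟨x, hx, hxY⟩ : ∃ x ∈ X, x ∉ Y := by
    by_contra hn
    push Not at hn
    exact hne (h.eq_of_subset_of_embeds fY hn (h.equi_trans (h.equi_symm hX₀ hY bY.1) bX.1).embeds)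
  obtain ⟨w, -, hwm, -⟩ := big_compl_union h hd hM hX₀ hB₀ hbad hX hY bX bY
  set z := w x
  have hz : z ∉ X ∪ Y := hwm trivial
  have e1 : Equiv.swap x z '' Y = Y := by
    ext y
    have hy : y = x → y ∉ Y := fun q => q ▸ hxY
    have hy' : y = z → y ∉ Y := fun q hq => hz (Or.inr (q ▸ hq))
    simp only [Set.mem_image_equiv, Equiv.symm_swap]
    rw [Equiv.swap_apply_def]
    split_ifs with h1 h2
    · exact ⟨fun q => absurd (Or.inr q) hz, fun q => absurd q (hy h1)⟩
    · exact ⟨fun q => absurd q hxY, fun q => absurd q (hy' h2)⟩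
    · rfl
  have e2 : Equiv.swap x z '' X = insert z (X \ {x}) := by
    ext y
    have hzX : z ∉ X := fun q => hz (Or.inl q)
    simp only [Set.mem_image_equiv, Equiv.symm_swap, Set.mem_insert_iff, Set.mem_sdiff,
      Set.mem_singleton_iff]
    rw [Equiv.swap_apply_def]
    split_ifs with h1 h2
    · subst h1; simp [hzX]; rintro q; exact hzX (q ▸ hx)
    · simp [hx, h2]
    · simp [h1, h2]
  have e3 : d X = d (insert z (X \ {x})) :=
    e.trans (hd.transport (h.iPerm_swap x z) hX hY e e2 e1).symm
  obtain ⟨U, iU, bU, hU⟩ := hbad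
  have all : ∀ {U}, 𝓜.ISet U → 𝓜.Bic X₀ U → d X = d U := fun iU bU =>
    hd.swap hX iU (h.bic_trans bXX bU) fX ⟨x, hx, z, fun q => hz (Or.inl q), e3⟩
  exact hU ((all hX₀ (h.bic_refl _)).symm.trans (all iU bU))

/-- Concepts which are bicardinally equivalent to `X₀` and have the same abstract differ by fewer
objects than they have. -/
theorem not_embeds_diff (hX : 𝓜.ISet X) (hY : 𝓜.ISet Y) (bX : 𝓜.Bic X₀ X) (bY : 𝓜.Bic X₀ Y)
    (e : d X = d Y) : ¬ 𝓜.Embeds X (X \ Y) := by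
  intro hXY
  by_cases hi : 𝓜.Infin X₀
  · obtain ⟨U, iU, bU, hU⟩ := id hbad
    exact hU (eq_of_large_diff h hd hM hX₀ hB₀ hi hX hY bX hXY
      (big_compl_union h hd hM hX₀ hB₀ hbad hX hY bX bY) e hX₀ iU (h.bic_refl _) bU)
  · obtain rfl := eq_of_finite h hd hM hX₀ hB₀ hbad hi hX hY bX bY e
    obtain ⟨x, hx⟩ := hbad.nonempty
    obtain ⟨f, -, hf⟩ := bX.1
    obtain ⟨g, -, hg, -⟩ := hXY
    simpa using hg (hf.mapsTo hx)

/-- Whether `X` embeds into its part in `S` depends on the abstract of `X` only. -/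
theorem embeds_inter_of_eq (hX : 𝓜.ISet X) (hY : 𝓜.ISet Y) (bX : 𝓜.Bic X₀ X)
    (bY : 𝓜.Bic X₀ Y) (e : d X = d Y) (hXS : 𝓜.Embeds X (X ∩ S)) : 𝓜.Embeds Y (Y ∩ S) := by
  have eYX := h.equi_trans (h.equi_symm hX₀ hY bY.1) bX.1
  by_cases hi : 𝓜.Infin X₀
  · have hiX := h.infin_of_embeds hX₀ hX hi bX.1.embeds
    rcases h.embeds_or_of_union (V := Y ∩ S) hX (h.diff hX hY) hiX (h.embeds_mono hXS fun x hx => by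
      by_cases hxY : x ∈ Y
      · exact Or.inr ⟨hxY, hx.2⟩
      · exact Or.inl ⟨hx.1, hxY⟩) with q | q
    · exact absurd q (not_embeds_diff h hd hM hX₀ hB₀ hbad hX hY bX bY e)
    · exact h.embeds_trans eYX.embeds q
  · obtain rfl := eq_of_finite h hd hM hX₀ hB₀ hbad hi hX hY bX bY e
    exact hXS

end

end SOStructure

/-! ### A paradoxical property of abstraction operators -/

namespace SOStructure

variable {M : Type u} {𝓜 : SOStructure M} {d : Set M → M} {X X₀ Y U V W S H : Set M}

theorem IRel.iSet (h : 𝓜.Background) {R : M → M → Prop} (hR : 𝓜.IRel R) (m : M) :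
    𝓜.ISet {y | R m y} := h.rel hR (h.const m) (h.proj 0)

/-- Inside a set as large as the domain there are as many disjoint copies of `X₀` as there are
objects. -/
theorem exists_lines (h : 𝓜.Background) (hM : 𝓜.Infin (Set.univ : Set M)) (hX₀ : 𝓜.ISet X₀)
    (hH : 𝓜.Big H) : ∃ R : M → M → Prop, 𝓜.IRel R ∧ (∀ m y, R m y → y ∈ H) ∧
      (∀ m m' y, R m y → R m' y → m = m') ∧ ∀ m, 𝓜.Equi X₀ {y | R m y} := by
  obtain ⟨p, ip, -, hp⟩ := h.exists_pairing h.univ hM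
  obtain ⟨e, ie, heH, he⟩ := hH
  have hp' : ∀ {x y x' y'}, p x y = p x' y' → x = x' ∧ y = y' := fun q =>
    hp _ trivial _ trivial _ trivial _ trivial q
  have he' : ∀ {x y}, e x = e y → x = y := fun q => he trivial trivial q
  refine ⟨fun m y => ∃ x, x ∈ X₀ ∧ y = e (p m x), h.ex (h.and (h.mem hX₀ (h.proj 0))
    (h.eq (h.proj 2) (h.app ie (h.app₂ ip (h.proj 1) (h.proj 0))))), ?_, ?_, fun m => ?_⟩
  · rintro m y ⟨x, -, rfl⟩
    exact heH trivial
  · rintro m m' y ⟨x, -, rfl⟩ ⟨x', -, q⟩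
    exact (hp' (he' q)).1
  · refine ⟨fun x => e (p m x), h.ifun (h.app ie (h.app₂ ip (h.const m) (h.proj 0))),
      fun x hx => ⟨x, hx, rfl⟩, fun x _ x' _ q => (hp' (he' q)).2, ?_⟩
    rintro _ ⟨x, hx, rfl⟩
    exact ⟨x, hx, rfl⟩

section

variable (h : 𝓜.Background) (hd : 𝓜.Naming d) (hM : 𝓜.Infin (Set.univ : Set M))
  (hX₀ : 𝓜.ISet X₀) (hB₀ : 𝓜.Big X₀ᶜ) (hbad : 𝓜.Bad d X₀)
include h hd hM hX₀ hB₀ hbad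

theorem ne_of_disjoint (hX : 𝓜.ISet X) (hY : 𝓜.ISet Y) (bX : 𝓜.Bic X₀ X) (bY : 𝓜.Bic X₀ Y)
    (hXY : Disjoint X Y) : d X ≠ d Y := fun e =>
  not_embeds_diff h hd hM hX₀ hB₀ hbad hX hY bX bY e
    (by rw [hXY.sdiff_eq_left]; exact (h.equi_refl X).embeds)

/-- A set that contains the abstracts of the members of a large family of disjoint copies of `X₀` is
as large as the domain. -/
theorem big_of_lines {T : Set M} {R : M → M → Prop} (hR : 𝓜.IRel R)
    (hdis : ∀ m m' y, R m y → R m' y → m = m') (hb : ∀ m, 𝓜.Bic X₀ {y | R m y})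
    (hT : ∀ m, d {y | R m y} ∈ T) : 𝓜.Big T := by
  refine ⟨_, hd.family hR, fun m _ => hT m, fun m _ m' _ e => ?_⟩
  by_contra hne
  exact ne_of_disjoint h hd hM hX₀ hB₀ hbad (hR.iSet h m) (hR.iSet h m') (hb m) (hb m')
    (Set.disjoint_left.2 fun y hy hy' => hne (hdis m m' y hy hy')) e

/-- The abstracts can be permuted so that, for some concept `S`, a concept of the type of `X₀` has
its abstract in `S` exactly when it does not embed into its part in `S`. For any `S` such as `H`
below, the objects which are abstracts of a `Z` not embedding into `Z ∩ S` are moved to `S`, and all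
others to the complement of `S`. -/
theorem exists_iPerm_liar : ∃ π : Equiv.Perm M, 𝓜.IPerm π ∧ ∃ S, 𝓜.ISet S ∧
    ∀ Z, 𝓜.ISet Z → 𝓜.Bic X₀ Z → (π (d Z) ∈ S ↔ ¬ 𝓜.Embeds Z (Z ∩ S)) := by
  obtain ⟨H, H', iH, iH', eH, dH, bH, bH'⟩ := h.exists_big_halves hM h.univ
    (h.equi_refl Set.univ).embeds
  have hHc : Hᶜ = H' := by
    ext x
    have : x ∈ H ∪ H' := eH ▸ trivial
    exact ⟨fun q => this.resolve_left q, fun q q' => Set.disjoint_left.1 dH q' q⟩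
  set F := {x | ∃ Z, 𝓜.ISet Z ∧ d Z = x ∧ 𝓜.Bic X₀ Z ∧ ¬ 𝓜.Embeds Z (Z ∩ H)} with hF
  have iF : 𝓜.ISet F := hd.few hX₀ iH
  obtain ⟨R, iR, hRH, hRd, hRe⟩ := exists_lines h hM hX₀ bH
  obtain ⟨R', iR', hRH', hRd', hRe'⟩ := exists_lines h hM hX₀ bH'
  have bR : ∀ m, 𝓜.Bic X₀ {y | R m y} := fun m => bic_of_equi_of_big h hX₀ hB₀ (iR.iSet h m)
    (hRe m) (Background.Big.mono h bH' fun x hx hx' => Set.disjoint_left.1 dH (hRH m x hx') hx)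
  have bR' : ∀ m, 𝓜.Bic X₀ {y | R' m y} := fun m => bic_of_equi_of_big h hX₀ hB₀ (iR'.iSet h m)
    (hRe' m) (Background.Big.mono h bH fun x hx hx' => Set.disjoint_left.1 dH hx (hRH' m x hx'))
  have bF : 𝓜.Big F := by
    refine big_of_lines h hd hM hX₀ hB₀ hbad iR' hRd' bR' fun m =>
      ⟨_, iR'.iSet h m, rfl, bR' m, ?_⟩
    rintro ⟨f, -, hf, -⟩
    obtain ⟨x, hx⟩ := hbad.nonempty
    obtain ⟨g, -, hg⟩ := hRe' m
    have := hf (hg.mapsTo hx)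
    exact Set.disjoint_left.1 dH this.2 (hRH' m _ this.1)
  have bFc : 𝓜.Big Fᶜ := by
    refine big_of_lines h hd hM hX₀ hB₀ hbad iR hRd bR fun m => ?_
    rintro ⟨Z, iZ, e, bZ, hn⟩
    refine hn (embeds_inter_of_eq h hd hM hX₀ hB₀ hbad (iR.iSet h m) iZ (bR m) bZ e.symm ?_)
    exact h.embeds_of_subset fun y hy => ⟨hy, hRH m y hy⟩
  obtain ⟨π, iπ, hπ⟩ := h.exists_iPerm iF (h.equi_of_big iF iH bF bH)
    (h.equi_of_big (h.compl iF) (h.compl iH) bFc (hHc ▸ bH'))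
  refine ⟨π, iπ, H, iH, fun Z iZ bZ => ?_⟩
  rw [← hπ, π.injective.mem_set_image]
  constructor
  · rintro ⟨Z', iZ', e, bZ', hn⟩ hZ
    rw [hπ] at hZ
    exact hn (embeds_inter_of_eq h hd hM hX₀ hB₀ hbad iZ iZ' bZ bZ' e.symm hZ)
  · intro hn
    rw [hπ] at hn
    exact ⟨Z, iZ, rfl, bZ, hn⟩

/-- A paradoxical family `Z_a`, `a ∈ A`, for finite `X₀`. With three objects `c₀, c₁, c₂` permuted
cyclically by `σ`, the set `A` is `{c₀, c₁, c₂} × X₀`, and `Z_(c, x)` arises from the row of `σ c`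
by replacing `(σ c, x)` by `(c, x)`. -/
theorem exists_paradox_of_finite (hf : ¬ 𝓜.Infin X₀) (hH : 𝓜.Big H) (hHc : 𝓜.Big Hᶜ) :
    ∃ (A : Set M) (R : M → M → Prop), 𝓜.ISet A ∧ 𝓜.IRel R ∧ A ⊆ H ∧
      (∀ a y, R a y → y ∈ A) ∧ (∀ a ∈ A, 𝓜.Bic X₀ {y | R a y}) ∧
      (∀ a ∈ A, ∀ b ∈ A, d {y | R a y} = d {y | R b y} → a = b) ∧
      ∀ S, 𝓜.ISet S → ¬ ∀ a ∈ A, (a ∈ S ↔ ¬ 𝓜.Embeds {y | R a y} ({y | R a y} ∩ S)) := by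
  classical
  obtain ⟨p, ip, -, hp⟩ := h.exists_pairing h.univ hM
  obtain ⟨e, ie, heH, he⟩ := hH
  have hp' : ∀ {x y x' y'}, p x y = p x' y' → x = x' ∧ y = y' := fun q =>
    hp _ trivial _ trivial _ trivial _ trivial q
  have he' : ∀ {x y}, e x = e y → x = y := fun q => he trivial trivial q
  obtain ⟨u, -, v, -, huv⟩ := h.exists_ne_of_infin hM
  obtain ⟨c₀, c₁, c₂, h₀₁, h₀₂, h₁₂⟩ : ∃ c₀ c₁ c₂ : M, c₀ ≠ c₁ ∧ c₀ ≠ c₂ ∧ c₁ ≠ c₂ :=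
    ⟨p u u, p u v, p v u, fun q => huv (hp' q).2, fun q => huv (hp' q).1, fun q => huv (hp' q).1⟩
  set σ : M → M := fun c => if c = c₀ then c₁ else if c = c₁ then c₂ else c₀ with hσ
  have iσ : 𝓜.IFun σ := h.ifun (h.ite (h.eq (h.proj 0) (h.const _)) (h.const _)
    (h.ite (h.eq (h.proj 0) (h.const _)) (h.const _) (h.const _)))
  set C : Set M := {c₀, c₁, c₂} with hC
  have iC : 𝓜.ISet C := h.insert _ (h.insert _ (h.singleton _))
  have hσC : ∀ c ∈ C, σ c ∈ C ∧ σ c ≠ c ∧ σ (σ c) ≠ c := by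
    rintro c (rfl | rfl | rfl)
    · simp [hσ, hC, h₀₁.symm, h₀₂.symm]
    · simp [hσ, hC, h₀₁.symm, h₀₂.symm, h₁₂.symm, h₀₁]
    · simp [hσ, hC, h₀₁, h₀₂.symm, h₁₂.symm, h₀₂, h₁₂]
  set A := {a | ∃ c, c ∈ C ∧ ∃ x, x ∈ X₀ ∧ a = e (p c x)} with hA
  have iA : 𝓜.ISet A := h.ex (h.and (h.mem iC (h.proj 0)) (h.ex (h.and (h.mem hX₀ (h.proj 0))
    (h.eq (h.proj 2) (h.app ie (h.app₂ ip (h.proj 1) (h.proj 0)))))))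
  let R : M → M → Prop := fun a y => ∃ c, c ∈ C ∧ ∃ x, x ∈ X₀ ∧ a = e (p c x) ∧
    (y = a ∨ ∃ x', x' ∈ X₀ ∧ x' ≠ x ∧ y = e (p (σ c) x'))
  have iR : 𝓜.IRel R := h.ex (h.and (h.mem iC (h.proj 0)) (h.ex (h.and (h.mem hX₀ (h.proj 0))
    (h.and (h.eq (h.proj 2) (h.app ie (h.app₂ ip (h.proj 1) (h.proj 0))))
      (h.or (h.eq (h.proj 3) (h.proj 2)) (h.ex (h.and (h.mem hX₀ (h.proj 0))
        (h.and (h.not (h.eq (h.proj 0) (h.proj 1)))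
          (h.eq (h.proj 4) (h.app ie (h.app₂ ip (h.app iσ (h.proj 2)) (h.proj 0))))))))))))
  have hAH : A ⊆ H := by
    rintro _ ⟨c, -, x, -, rfl⟩
    exact heH trivial
  have hRA : ∀ a y, R a y → y ∈ A := by
    rintro _ y ⟨c, hc, x, hx, rfl, rfl | ⟨x', hx', -, rfl⟩⟩
    · exact ⟨c, hc, x, hx, rfl⟩
    · exact ⟨_, (hσC c hc).1, x', hx', rfl⟩
  have hRiff : ∀ c ∈ C, ∀ x ∈ X₀, ∀ y, R (e (p c x)) y ↔
      (y = e (p c x) ∨ ∃ x', x' ∈ X₀ ∧ x' ≠ x ∧ y = e (p (σ c) x')) := by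
    refine fun c hc x hx y => ⟨?_, fun q => ⟨c, hc, x, hx, rfl, q⟩⟩
    rintro ⟨c', hc', x', hx', q, q'⟩
    obtain ⟨rfl, rfl⟩ := hp' (he' q)
    exact q'
  have hRbic : ∀ a ∈ A, 𝓜.Bic X₀ {y | R a y} := by
    rintro _ ⟨c, hc, x, hx, rfl⟩
    refine bic_of_equi_of_big h hX₀ hB₀ (iR.iSet h _) ?_ (Background.Big.mono h hHc
      fun y hy hy' => hy (hAH (hRA _ y hy')))
    refine ⟨fun x' => if x' = x then e (p c x) else e (p (σ c) x'), h.ifun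
      (h.ite (h.eq (h.proj 0) (h.const _)) (h.const _)
        (h.app ie (h.app₂ ip (h.const _) (h.proj 0)))), fun x' hx' => ?_, fun y _ y' _ q => ?_, ?_⟩
    · rw [Set.mem_ofPred_eq, hRiff c hc x hx]
      dsimp only
      split_ifs with hxx
      · exact Or.inl rfl
      · exact Or.inr ⟨x', hx', hxx, rfl⟩
    · dsimp only at q
      split_ifs at q with h1 h2 h2
      · rw [h1, h2]
      · exact absurd (hp' (he' q)).1.symm (hσC c hc).2.1
      · exact absurd (hp' (he' q)).1 (hσC c hc).2.1
      · exact (hp' (he' q)).2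
    · intro y hy
      rcases (hRiff c hc x hx y).1 hy with rfl | ⟨x', hx', hne, rfl⟩
      · exact ⟨x, hx, by simp⟩
      · exact ⟨x', hx', by simp [hne]⟩
  have hself : ∀ a ∈ A, R a a := by
    rintro _ ⟨c, hc, x, hx, rfl⟩
    exact (hRiff c hc x hx _).2 (Or.inl rfl)
  refine ⟨A, R, iA, iR, hAH, hRA, hRbic, fun a ha b hb q => ?_, fun S iS hS => ?_⟩
  · have q' := eq_of_finite h hd hM hX₀ hB₀ hbad hf (iR.iSet h a) (iR.iSet h b) (hRbic a ha)
      (hRbic b hb) q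
    have hab : R b a := (Set.ext_iff.1 q' a).1 (hself a ha)
    have hba : R a b := (Set.ext_iff.1 q' b).2 (hself b hb)
    obtain ⟨c, hc, x, hx, rfl⟩ := ha
    obtain ⟨c', hc', x', hx', rfl⟩ := hb
    rcases (hRiff c' hc' x' hx' _).1 hab with e1 | ⟨y, -, -, e1⟩
    · exact e1
    rcases (hRiff c hc x hx _).1 hba with e2 | ⟨y', -, -, e2⟩
    · exact e2.symm
    have e1' := (hp' (he' e1)).1
    have e2' := (hp' (he' e2)).1
    exact absurd (e1'.trans (congrArg σ e2')).symm (hσC c hc).2.2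
  · have hAS : A ⊆ S := by
      intro a ha
      by_contra haS
      have := not_not.1 fun q => haS ((hS a ha).2 q)
      have hfin : ¬ 𝓜.Infin {y | R a y} := fun q => hf (h.infin_of_embeds (iR.iSet h a) hX₀ q
        (h.equi_symm hX₀ (iR.iSet h a) (hRbic a ha).1).embeds)
      have := h.eq_of_subset_of_embeds hfin Set.inter_subset_left this
      exact haS ((Set.inter_eq_left.1 this) (hself a ha))
    obtain ⟨x, hx⟩ := hbad.nonempty
    have ha : e (p c₀ x) ∈ A := ⟨c₀, Or.inl rfl, x, hx, rfl⟩
    exact (hS _ ha).1 (hAS ha) (h.embeds_of_subset fun y hy => ⟨hy, hAS (hRA _ y hy)⟩)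

/-- A paradoxical family `Z_a`, `a ∈ A`, for infinite `X₀`: a set `A` of the size of `X₀` is
partitioned into sets `B_a`, `a ∈ A`, of the same size, and `Z_a` is the complement of `B_a`
in `A`. -/
theorem exists_paradox_of_infinite (hi : 𝓜.Infin X₀) (hH : 𝓜.Big H) (hHc : 𝓜.Big Hᶜ) :
    ∃ (A : Set M) (R : M → M → Prop), 𝓜.ISet A ∧ 𝓜.IRel R ∧ A ⊆ H ∧
      (∀ a y, R a y → y ∈ A) ∧ (∀ a ∈ A, 𝓜.Bic X₀ {y | R a y}) ∧
      (∀ a ∈ A, ∀ b ∈ A, d {y | R a y} = d {y | R b y} → a = b) ∧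
      ∀ S, 𝓜.ISet S → ¬ ∀ a ∈ A, (a ∈ S ↔ ¬ 𝓜.Embeds {y | R a y} ({y | R a y} ∩ S)) := by
  obtain ⟨p, ip, -, hp⟩ := h.exists_pairing h.univ hM
  obtain ⟨r, ir, hrX, hr⟩ := h.exists_pairing hX₀ hi
  obtain ⟨e, ie, heH, he⟩ := hH
  have hp' : ∀ {x y x' y'}, p x y = p x' y' → x = x' ∧ y = y' := fun q =>
    hp _ trivial _ trivial _ trivial _ trivial q
  have he' : ∀ {x y}, e x = e y → x = y := fun q => he trivial trivial q
  set A := {a | ∃ x, x ∈ X₀ ∧ ∃ y, y ∈ X₀ ∧ a = e (p x y)} with hA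
  have iA : 𝓜.ISet A := h.ex (h.and (h.mem hX₀ (h.proj 0)) (h.ex (h.and (h.mem hX₀ (h.proj 0))
    (h.eq (h.proj 2) (h.app ie (h.app₂ ip (h.proj 1) (h.proj 0)))))))
  have hAH : A ⊆ H := by
    rintro _ ⟨c, -, x, -, rfl⟩
    exact heH trivial
  have eA : 𝓜.Equi X₀ A := by
    refine h.equi_of_embeds hX₀ iA ⟨fun x => e (p x x), h.ifun
      (h.app ie (h.app₂ ip (h.proj 0) (h.proj 0))), fun x hx => ⟨x, hx, x, hx, rfl⟩,
      fun x _ x' _ q => (hp' (he' q)).1⟩ ?_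
    obtain ⟨f, hf, hf'⟩ := h.exists_ifun iA
      (R := fun a z => ∃ x, x ∈ X₀ ∧ ∃ y, y ∈ X₀ ∧ a = e (p x y) ∧ z = r x y)
      (h.ex (h.and (h.mem hX₀ (h.proj 0)) (h.ex (h.and (h.mem hX₀ (h.proj 0))
        (h.and (h.eq (h.proj 2) (h.app ie (h.app₂ ip (h.proj 1) (h.proj 0))))
          (h.eq (h.proj 3) (h.app₂ ir (h.proj 1) (h.proj 0)))))))) (by
      rintro _ ⟨x, hx, y, hy, rfl⟩
      refine ⟨r x y, ⟨x, hx, y, hy, rfl, rfl⟩, ?_⟩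
      rintro z ⟨x', hx', y', hy', q, rfl⟩
      obtain ⟨rfl, rfl⟩ := hp' (he' q)
      rfl)
    have hf'' : ∀ x ∈ X₀, ∀ y ∈ X₀, f (e (p x y)) = r x y := fun x hx y hy =>
      (hf' _ ⟨x, hx, y, hy, rfl⟩ _).2 ⟨x, hx, y, hy, rfl, rfl⟩
    refine ⟨f, hf, ?_, ?_⟩
    · rintro _ ⟨x, hx, y, hy, rfl⟩
      rw [hf'' x hx y hy]
      exact hrX x hx y hy
    · rintro _ ⟨x, hx, y, hy, rfl⟩ _ ⟨x', hx', y', hy', rfl⟩ q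
      rw [hf'' x hx y hy, hf'' x' hx' y' hy'] at q
      obtain ⟨rfl, rfl⟩ := hr x hx y hy x' hx' y' hy' q
      rfl
  obtain ⟨b, ib, hb⟩ := h.equi_symm hX₀ iA eA
  let B : M → M → Prop := fun a y => ∃ x, x ∈ X₀ ∧ y = e (p (b a) x)
  have iB : 𝓜.IRel B := h.ex (h.and (h.mem hX₀ (h.proj 0))
    (h.eq (h.proj 2) (h.app ie (h.app₂ ip (h.app ib (h.proj 1)) (h.proj 0)))))
  have hBA : ∀ a ∈ A, ∀ y, B a y → y ∈ A := by
    rintro a ha y ⟨x, hx, rfl⟩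
    exact ⟨_, hb.mapsTo ha, x, hx, rfl⟩
  have hBd : ∀ a ∈ A, ∀ a' ∈ A, ∀ y, B a y → B a' y → a = a' := by
    rintro a ha a' ha' y ⟨x, hx, rfl⟩ ⟨x', hx', q⟩
    exact hb.injOn ha ha' (hp' (he' q)).1
  have hBe : ∀ a, 𝓜.Embeds X₀ {y | B a y} := fun a => ⟨fun x => e (p (b a) x),
    h.ifun (h.app ie (h.app₂ ip (h.const _) (h.proj 0))), fun x hx => ⟨x, hx, rfl⟩,
    fun x _ x' _ q => (hp' (he' q)).2⟩
  let R : M → M → Prop := fun a y => y ∈ A ∧ ¬ B a y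
  have iR : 𝓜.IRel R := h.and (h.mem iA (h.proj 1)) (h.not (h.rel iB (h.proj 0) (h.proj 1)))
  have iA' : 𝓜.Infin A := h.infin_of_embeds hX₀ iA hi eA.embeds
  have hother : ∀ a ∈ A, ∃ a' ∈ A, a' ≠ a := by
    intro a ha
    obtain ⟨u, hu, v, hv, huv⟩ := h.exists_ne_of_infin iA'
    by_cases hua : u = a
    · exact ⟨v, hv, fun q => huv (hua.trans q.symm)⟩
    · exact ⟨u, hu, hua⟩
  have hRe : ∀ a ∈ A, 𝓜.Equi X₀ {y | R a y} := by
    intro a ha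
    obtain ⟨a', ha', hne⟩ := hother a ha
    refine h.equi_of_embeds hX₀ (iR.iSet h a) (h.embeds_mono (hBe a') fun y hy =>
      ⟨hBA a' ha' y hy, fun q => hne (hBd a' ha' a ha y hy q)⟩) ?_
    exact h.embeds_trans (h.embeds_of_subset fun y hy => hy.1) (h.equi_symm hX₀ iA eA).embeds
  have hRb : ∀ a ∈ A, 𝓜.Bic X₀ {y | R a y} := fun a ha =>
    bic_of_equi_of_big h hX₀ hB₀ (iR.iSet h a) (hRe a ha)
      (Background.Big.mono h hHc fun y hy hy' => hy (hAH hy'.1))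
  refine ⟨A, R, iA, iR, hAH, fun a y q => q.1, hRb, fun a ha a' ha' q => ?_, fun S iS hS => ?_⟩
  · by_contra hne
    refine not_embeds_diff h hd hM hX₀ hB₀ hbad (iR.iSet h a) (iR.iSet h a') (hRb a ha) (hRb a' ha')
      q (h.embeds_trans (h.equi_symm hX₀ (iR.iSet h a) (hRe a ha)).embeds
        (h.embeds_mono (hBe a') fun y hy => ?_))
    exact ⟨⟨hBA a' ha' y hy, fun q => hne (hBd a ha a' ha' y q hy)⟩, fun q => q.2 hy⟩
  · have hS' : ∀ a ∈ A, (a ∈ S ↔ ¬ 𝓜.Embeds X₀ ({y | R a y} ∩ S)) := fun a ha =>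
      (hS a ha).trans (not_congr ⟨fun q => h.embeds_trans (hRe a ha).embeds q,
        fun q => h.embeds_trans (h.equi_symm hX₀ (iR.iSet h a) (hRe a ha)).embeds q⟩)
    -- Two members of `A ∩ S` make `A ∩ S` small, since it is covered by `Z_a ∩ S` and `Z_b ∩ S`.
    have hsmall : ¬ 𝓜.Embeds X₀ (A ∩ S) := by
      intro hem
      obtain ⟨u, hu, v, hv, huv⟩ := h.exists_ne_of_infin
        (h.infin_of_embeds hX₀ (h.inter iA iS) hi hem)
      have hcov : A ∩ S ⊆ ({y | R u y} ∩ S) ∪ ({y | R v y} ∩ S) := fun y hy => by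
        by_cases hy' : B u y
        · exact Or.inr ⟨⟨hy.1, fun q => huv (hBd u hu.1 v hv.1 y hy' q)⟩, hy.2⟩
        · exact Or.inl ⟨⟨hy.1, hy'⟩, hy.2⟩
      rcases h.embeds_or_of_union hX₀ (h.inter (iR.iSet h u) iS) hi
        (h.embeds_mono hem hcov) with q | q
      · exact (hS' u hu.1).1 hu.2 q
      · exact (hS' v hv.1).1 hv.2 q
    have hAS : A ⊆ S := fun a ha => (hS' a ha).2 fun q =>
      hsmall (h.embeds_mono q fun y hy => ⟨hy.1.1, hy.2⟩)
    exact hsmall (h.embeds_mono eA.embeds fun y hy => ⟨hy, hAS hy⟩)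

/-- The abstracts can also be permuted so that there is no such concept `S`: the abstract of each
member `Z_a` of a paradoxical family is moved to `a`. -/
theorem exists_iPerm_no_liar : ∃ π : Equiv.Perm M, 𝓜.IPerm π ∧ ¬ ∃ S, 𝓜.ISet S ∧
    ∀ Z, 𝓜.ISet Z → 𝓜.Bic X₀ Z → (π (d Z) ∈ S ↔ ¬ 𝓜.Embeds Z (Z ∩ S)) := by
  obtain ⟨H, H', iH, iH', eH, dH, bH, bH'⟩ := h.exists_big_halves hM h.univ
    (h.equi_refl Set.univ).embeds
  have hH'H : H' ⊆ Hᶜ := fun x hx hx' => Set.disjoint_left.1 dH hx' hx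
  have bHc : 𝓜.Big Hᶜ := Background.Big.mono h bH' hH'H
  obtain ⟨A, R, iA, iR, hAH, hRA, hRb, hinj, hpar⟩ : ∃ (A : Set M) (R : M → M → Prop), 𝓜.ISet A ∧
      𝓜.IRel R ∧ A ⊆ H ∧ (∀ a y, R a y → y ∈ A) ∧ (∀ a ∈ A, 𝓜.Bic X₀ {y | R a y}) ∧
      (∀ a ∈ A, ∀ b ∈ A, d {y | R a y} = d {y | R b y} → a = b) ∧
      ∀ S, 𝓜.ISet S → ¬ ∀ a ∈ A, (a ∈ S ↔ ¬ 𝓜.Embeds {y | R a y} ({y | R a y} ∩ S)) := by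
    by_cases hi : 𝓜.Infin X₀
    · exact exists_paradox_of_infinite h hd hM hX₀ hB₀ hbad hi bH bHc
    · exact exists_paradox_of_finite h hd hM hX₀ hB₀ hbad hi bH bHc
  set f : M → M := fun a => d {y | R a y} with hf
  have jf : 𝓜.IFun f := hd.family iR
  have hfb : Set.BijOn f A (f '' A) := Set.InjOn.bijOn_image fun a ha b hb q => hinj a ha b hb q
  -- The abstracts of disjoint copies of `X₀` outside `H` are not among the values of `f`.
  obtain ⟨R', iR', hRH', hRd', hRe'⟩ := exists_lines h hM hX₀ bH'
  have bR' : ∀ m, 𝓜.Bic X₀ {y | R' m y} := fun m => bic_of_equi_of_big h hX₀ hB₀ (iR'.iSet h m)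
    (hRe' m) (Background.Big.mono h bH fun x hx hx' => hH'H (hRH' m x hx') hx)
  have bfc : 𝓜.Big (f '' A)ᶜ := by
    refine big_of_lines h hd hM hX₀ hB₀ hbad iR' hRd' bR' fun m => ?_
    rintro ⟨a, ha, q⟩
    exact ne_of_disjoint h hd hM hX₀ hB₀ hbad (iR.iSet h a) (iR'.iSet h m) (hRb a ha) (bR' m)
      (Set.disjoint_left.2 fun y hy hy' => hH'H (hRH' m y hy') (hAH (hRA a y hy))) q
  obtain ⟨π, iπ, hπ⟩ := h.exists_iPerm_extending iA jf hfb
    (h.equi_of_big (h.compl iA) (h.compl (h.image jf iA))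
      (Background.Big.mono h bHc (Set.compl_subset_compl.2 hAH)) bfc)
  refine ⟨π.symm, h.iPerm_symm iπ, ?_⟩
  rintro ⟨S, iS, hS⟩
  refine hpar S iS fun a ha => ?_
  rw [← hS _ (iR.iSet h a) (hRb a ha)]
  have : π.symm (d {y | R a y}) = a := by
    rw [Equiv.symm_apply_eq]
    exact (hπ ha).symm
  rw [this]

end

end SOStructure

/-! ### Finite domains -/

namespace SOStructure

variable {M : Type u} {𝓜 : SOStructure M} {d : Set M → M} {X X₀ Y : Set M}

theorem image_swap_eq [DecidableEq M] {x z : M} (hx : x ∈ X) (hz : z ∉ X) :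
    Equiv.swap x z '' X = insert z (X \ {x}) := by
  ext y
  constructor
  · rintro ⟨w, hw, rfl⟩
    by_cases hwx : w = x
    · subst hwx; left; exact Equiv.swap_apply_left _ _
    · have hwz : w ≠ z := fun e => hz (e ▸ hw)
      right
      rw [Equiv.swap_apply_of_ne_of_ne hwx hwz]
      exact ⟨hw, hwx⟩
  · rintro (rfl | ⟨hy, hyx⟩)
    · exact ⟨x, hx, Equiv.swap_apply_left _ _⟩
    · exact ⟨y, hy, Equiv.swap_apply_of_ne_of_ne hyx fun e => hz (e ▸ hy)⟩

theorem bic_exchange (h : 𝓜.Background) {x z : M} (hx : x ∈ X) (hz : z ∉ X) :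
    𝓜.Bic X (insert z (X \ {x})) := by
  classical
  rw [← image_swap_eq hx hz]
  exact h.bic_image (h.iPerm_swap x z) X

/-- In a finite domain injective internal functions are surjective. -/
theorem surjective_of_injective (hf : ¬ 𝓜.Infin (Set.univ : Set M)) {f : M → M} (jf : 𝓜.IFun f)
    (hi : Function.Injective f) : Function.Surjective f := by
  intro y
  by_contra hy
  exact hf ⟨f, jf, fun _ _ => trivial, hi.injOn, y, trivial, fun ⟨x, _, e⟩ => hy ⟨x, e⟩⟩

theorem Background.exists_iPerm_pair (h : 𝓜.Background) {p q a b : M} (hpq : p ≠ q) (hab : a ≠ b) :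
    ∃ π : Equiv.Perm M, 𝓜.IPerm π ∧ π p = a ∧ π q = b := by
  classical
  refine ⟨_, h.iPerm_trans (h.iPerm_swap p a) (h.iPerm_swap (Equiv.swap p a q) b), ?_, ?_⟩
  · rw [Equiv.trans_apply, Equiv.swap_apply_left]
    refine Equiv.swap_apply_of_ne_of_ne (fun e => hpq ?_) hab
    exact (Equiv.swap p a).injective ((Equiv.swap_apply_left p a).trans e)
  · rw [Equiv.trans_apply, Equiv.swap_apply_left]

section

variable (h : 𝓜.Background) (hd : 𝓜.Naming d) (hf : ¬ 𝓜.Infin (Set.univ : Set M))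
  (hX₀ : 𝓜.ISet X₀) (he : 𝓜.Embeds X₀ X₀ᶜ) (hbad : 𝓜.Bad d X₀)
include h hd hX₀ hbad

omit hX₀ in
theorem ne_empty_of_bic (hX : 𝓜.ISet X) (bX : 𝓜.Bic X X₀) : d X ≠ d ∅ := by
  intro e
  obtain ⟨Y, iY, bY, hne⟩ := hbad
  have key : ∀ {Z : Set M}, 𝓜.Bic X Z → d Z = d ∅ := by
    intro Z bZ
    obtain ⟨π, hπ, rfl⟩ := (h.bic_iff_exists_iPerm hX).1 bZ
    exact hd.transport hπ hX h.empty e rfl (Set.image_empty _)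
  exact hne ((key bX).trans (key (h.bic_trans bX bY)).symm)

include hf he

/-- In a finite domain equivalence among the concepts bicardinally equivalent to `X₀` is equality,
possibly up to complement. -/
theorem eq_or_eq_compl (hX : 𝓜.ISet X) (hY : 𝓜.ISet Y) (bX : 𝓜.Bic X₀ X) (bY : 𝓜.Bic X₀ Y)
    (e : d X = d Y) : Y = X ∨ Y = Xᶜ := by
  classical
  have fin : ∀ {A : Set M}, 𝓜.ISet A → ¬ 𝓜.Infin A := fun hA hi =>
    hf (h.infin_of_embeds hA h.univ hi (h.embeds_of_subset (Set.subset_univ _)))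
  by_cases h1 : X ⊆ Y
  · exact Or.inl (h.eq_of_subset_of_embeds (fin hY) h1
      (h.equi_trans (h.equi_symm hX₀ hY bY.1) bX.1).embeds).symm
  by_cases h2 : Xᶜ ⊆ Y
  · exact Or.inr (h.eq_of_subset_of_embeds (fin hY) h2 (h.embeds_trans
      (h.equi_symm hX₀ hY bY.1).embeds (h.embeds_trans he bX.2.embeds))).symm
  obtain ⟨x, hx, hxY⟩ := Set.not_subset.1 h1
  obtain ⟨z, hz, hzY⟩ := Set.not_subset.1 h2
  -- The transposition of `x` and `z` moves `X` and fixes `Y`.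
  have e' : d (insert z (X \ {x})) = d Y := by
    refine hd.transport (h.iPerm_swap x z) hX hY e (image_swap_eq hx hz) ?_
    have : Set.EqOn (Equiv.swap x z) (fun y => y) Y := fun y hy =>
      Equiv.swap_apply_of_ne_of_ne (fun q => hxY (q ▸ hy)) fun q => hzY (q ▸ hy)
    rw [this.image_eq, Set.image_id']
  have key : ∀ {Z : Set M}, 𝓜.ISet Z → 𝓜.Bic X₀ Z → d X = d Z := fun iZ bZ =>
    hd.swap hX iZ (h.bic_trans (h.bic_symm hX₀ hX bX) bZ) (fin hX)
      ⟨x, hx, z, hz, e.trans e'.symm⟩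
  obtain ⟨W, iW, bW, hne⟩ := hbad
  exact absurd ((key hX₀ (h.bic_refl _)).symm.trans (key iW bW)) hne

/-- `X₀` is not a singleton: otherwise distinct objects `m` would have different `d {m}`, and one
of these would have to be `d ∅`. -/
theorem exists_ne_mem : ∃ x ∈ X₀, ∃ x' ∈ X₀, x ≠ x' := by
  by_contra hs
  push Not at hs
  obtain ⟨x, hx⟩ := hbad.nonempty
  have hX : X₀ = {x} := Set.eq_singleton_iff_unique_mem.2 ⟨hx, fun y hy => hs y hy x hx⟩
  have bic : ∀ m, 𝓜.Bic X₀ {m} := by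
    intro m
    by_cases hm : m = x
    · rw [hm, hX]; exact h.bic_refl _
    · have := bic_exchange h (X := X₀) (z := m) hx (by rw [hX]; exact hm)
      simpa [hX] using this
  have inj : Function.Injective fun m => d {m} := by
    intro m n e
    rcases eq_or_eq_compl h hd hf hX₀ he hbad (h.singleton m) (h.singleton n) (bic m) (bic n) e
      with q | q
    · exact (Set.singleton_injective q).symm
    · exfalso
      have all : ∀ y, d {y} = d {m} := by
        intro y
        by_cases hy : y = m
        · rw [hy]
        · have : y ∈ ({n} : Set M) := q ▸ hy
          rw [Set.mem_singleton_iff.1 this]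
          exact e.symm
      obtain ⟨Y, iY, bY, hne⟩ := hbad
      obtain ⟨π, hπ, rfl⟩ := (h.bic_iff_exists_iPerm hX₀).1 bY
      rw [hX, Set.image_singleton, all, all (π x)] at hne
      exact hne rfl
  have ifd : 𝓜.IFun fun m => d {m} := hd.family (R := fun m y => y = m)
    (h.eq (h.proj 1) (h.proj 0))
  obtain ⟨m, hm⟩ := surjective_of_injective hf ifd inj (d ∅)
  exact ne_empty_of_bic h hd hbad (h.singleton m) (h.bic_symm hX₀ (h.singleton m) (bic m)) hm

/-- The complement of `X₀` has at most two elements: otherwise there would be as many pairwise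
inequivalent concepts bicardinally equivalent to `X₀` as there are objects, and one of these would
have the abstract of `∅`. -/
theorem eq_or_eq_of_notMem {x₀ x₁ y₀ y₁ : M} (hx₀ : x₀ ∈ X₀) (hx₁ : x₁ ∈ X₀) (hx : x₀ ≠ x₁)
    (hy₀ : y₀ ∉ X₀) (hy₁ : y₁ ∉ X₀) (hy : y₀ ≠ y₁) {y : M} (hyX : y ∉ X₀) : y = y₀ ∨ y = y₁ := by
  classical
  by_contra hne
  push Not at hne
  -- The set `W m` is obtained from `X₀` by exchanging the element `a m` for the object `r m`.
  let a : M → M := fun m => if m ∈ X₀ then m else if m = y₀ then x₁ else x₀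
  let r : M → M := fun m => if m ∈ X₀ then y₀ else if m = y₀ then y₁ else m
  have ha : ∀ m, a m ∈ X₀ := by intro m; simp only [a]; split_ifs <;> assumption
  have hr : ∀ m, r m ∉ X₀ := by intro m; simp only [r]; split_ifs <;> assumption
  have hinj : ∀ m n, a m = a n → r m = r n → m = n := by
    intro m n; simp only [a, r]; split_ifs <;> grind
  have ja : 𝓜.ITerm fun v : Fin 2 → M => a (v 0) := h.ite (h.mem hX₀ (h.proj 0)) (h.proj 0)
    (h.ite (h.eq (h.proj 0) (h.const y₀)) (h.const x₁) (h.const x₀))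
  have jr : 𝓜.ITerm fun v : Fin 2 → M => r (v 0) := h.ite (h.mem hX₀ (h.proj 0)) (h.const y₀)
    (h.ite (h.eq (h.proj 0) (h.const y₀)) (h.const y₁) (h.proj 0))
  let W : M → Set M := fun m => insert (r m) (X₀ \ {a m})
  have bW : ∀ m, 𝓜.Bic X₀ (W m) := fun m => bic_exchange h (ha m) (hr m)
  have iW : ∀ m, 𝓜.ISet (W m) := fun m => h.insert _ (h.diff hX₀ (h.singleton _))
  have Wr : ∀ m z, z ∉ X₀ → (z ∈ W m ↔ z = r m) := fun m z hz =>
    ⟨fun q => q.resolve_right fun q => hz q.1, Or.inl⟩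
  have Wa : ∀ m z, z ∈ X₀ → (z ∈ W m ↔ z ≠ a m) := fun m z hz =>
    ⟨fun q => q.elim (fun q => absurd (q ▸ hz) (hr m)) fun q => q.2, fun q => Or.inr ⟨hz, q⟩⟩
  have inj : Function.Injective fun m => d (W m) := by
    intro m n e
    rcases eq_or_eq_compl h hd hf hX₀ he hbad (iW m) (iW n) (bW m) (bW n) e with q | q
    · refine hinj m n ?_ ?_
      · by_contra hne
        exact ((Wa m _ (ha m)).1 (q ▸ (Wa n _ (ha m)).2 hne)) rfl
      · exact (Wr n _ (hr m)).1 (q ▸ (Wr m _ (hr m)).2 rfl)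
    · exfalso
      have cover : ∀ z, z ∉ X₀ → z = r m ∨ z = r n := by
        intro z hz
        by_cases hzm : z ∈ W m
        · exact Or.inl ((Wr m z hz).1 hzm)
        · exact Or.inr ((Wr n z hz).1 (q ▸ hzm))
      have c0 := cover _ hy₀
      have c1 := cover _ hy₁
      have c2 := cover _ hyX
      grind
  have ifd : 𝓜.IFun fun m => d (W m) := hd.family (R := fun m y => y = r m ∨ (y ∈ X₀ ∧ ¬ y = a m))
    (h.or (h.eq (h.proj 1) jr) (h.and (h.mem hX₀ (h.proj 1)) (h.not (h.eq (h.proj 1) ja))))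
  obtain ⟨m, hm⟩ := surjective_of_injective hf ifd inj (d ∅)
  exact ne_empty_of_bic h hd hbad (iW m) (h.bic_symm hX₀ (iW m) (bW m)) hm

/-- In a finite domain (which can only have four elements) the abstracts can be permuted so that
the abstract of each pair of the form `{d ∅, t}` is `t`, and also so that this fails. -/
theorem exists_iPerm_pairs : ∃ π₁ π₂ : Equiv.Perm M, 𝓜.IPerm π₁ ∧ 𝓜.IPerm π₂ ∧
    (∀ t, t ≠ π₁ (d ∅) → π₁ (d {π₁ (d ∅), t}) = t) ∧
    ¬ ∀ t, t ≠ π₂ (d ∅) → π₂ (d {π₂ (d ∅), t}) = t := by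
  classical
  obtain ⟨x₀, hx₀, x₁, hx₁, hx⟩ := exists_ne_mem h hd hf hX₀ he hbad
  obtain ⟨f, jf, fm, fi⟩ := id he
  have hy : f x₀ ≠ f x₁ := fun e => hx (fi hx₀ hx₁ e)
  have hX : X₀ = {x₀, x₁} := by
    ext x
    refine ⟨fun hxX => ?_, ?_⟩
    · exact (eq_or_eq_of_notMem h hd hf hX₀ he hbad hx₀ hx₁ hx (fm hx₀) (fm hx₁) hy (fm hxX)).imp
        (fi hxX hx₀) (fi hxX hx₁)
    · rintro (rfl | rfl) <;> assumption
  set c := d ∅ with hc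
  have iP : ∀ t, 𝓜.ISet ({c, t} : Set M) := fun t => h.insert c (h.singleton t)
  have bP : ∀ t, t ≠ c → 𝓜.Bic X₀ {c, t} := by
    intro t ht
    obtain ⟨π, hπ, e0, e1⟩ := h.exists_iPerm_pair hx ht.symm
    have := h.bic_image hπ X₀
    rwa [hX, Set.image_pair, e0, e1, ← hX] at this
  let g : M → M := fun t => if t = c then c else d {c, t}
  have gne : ∀ t, t ≠ c → d {c, t} ≠ c := fun t ht =>
    ne_empty_of_bic h hd hbad (iP t) (h.bic_symm hX₀ (iP t) (bP t ht))
  have jg : 𝓜.IFun g := h.ifun (h.ite (h.eq (h.proj 0) (h.const c)) (h.const c)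
    (h.app (hd.family (R := fun m y => y = c ∨ y = m) (h.or (h.eq (h.proj 1) (h.const c))
      (h.eq (h.proj 1) (h.proj 0)))) (h.proj 0)))
  have gi : Function.Injective g := by
    intro s t e
    simp only [g] at e
    split_ifs at e with hs ht ht
    · rw [hs, ht]
    · exact absurd e.symm (gne t ht)
    · exact absurd e (gne s hs)
    · rcases eq_or_eq_compl h hd hf hX₀ he hbad (iP s) (iP t) (bP s hs) (bP t ht) e with q | q
      · have : s ∈ ({c, t} : Set M) := q ▸ Or.inr rfl
        exact this.resolve_left hs
      · have : c ∈ ({c, s} : Set M)ᶜ := q ▸ Or.inl rfl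
        exact absurd (Or.inl rfl) this
  let π : Equiv.Perm M := Equiv.ofBijective g ⟨gi, surjective_of_injective hf jg gi⟩
  have hπ : 𝓜.IPerm π := jg
  have πc : π.symm c = c := by
    rw [Equiv.symm_apply_eq]
    exact (if_pos rfl).symm
  have πt : ∀ t, t ≠ c → π.symm (d {c, t}) = t := by
    intro t ht
    rw [Equiv.symm_apply_eq]
    exact (if_neg ht).symm
  obtain ⟨p, q, hp, hq, hpq⟩ : ∃ p q, p ≠ c ∧ q ≠ c ∧ p ≠ q := by
    have := fm hx₀
    have h0 : f x₀ ≠ x₀ := fun e => by rw [e] at this; exact this hx₀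
    have h1 : f x₀ ≠ x₁ := fun e => by rw [e] at this; exact this hx₁
    by_cases q0 : x₀ = c
    · exact ⟨f x₀, x₁, fun e => h0 (e.trans q0.symm), fun e => hx (q0.trans e.symm), h1⟩
    · by_cases q1 : x₁ = c
      · exact ⟨f x₀, x₀, fun e => h1 (e.trans q1.symm), q0, h0⟩
      · exact ⟨x₀, x₁, q0, q1, hx⟩
  refine ⟨π.symm, π.symm.trans (Equiv.swap p q), h.iPerm_symm hπ,
    h.iPerm_trans (h.iPerm_symm hπ) (h.iPerm_swap p q), ?_, ?_⟩
  · rw [πc]; exact πt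
  · rw [Equiv.trans_apply, πc, Equiv.swap_apply_of_ne_of_ne hp.symm hq.symm]
    intro H
    have := H p hp
    rw [Equiv.trans_apply, πt p hp, Equiv.swap_apply_left] at this
    exact hpq this.symm

end

end SOStructure

namespace SOStructure

variable {M : Type u} {ι κ : Type} {𝓜 : SOStructure M}

/-! ### Internal permutations are automorphisms -/

/-- The relations of the structure are closed under inverse images by internal functions. -/
theorem Background.internal_comp (h : 𝓜.Background) {n : ℕ} {P : (Fin n → M) → Prop}
    (hP : 𝓜.Internal P) {f : M → M} (hf : 𝓜.IFun f) : 𝓜.Internal fun a => P (f ∘ a) := by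
  have key : ∀ k : ℕ, k ≤ n → 𝓜.Internal fun a : Fin n → M =>
      P fun i => if i.val < k then f (a i) else a i := by
    intro k
    induction k with
    | zero => intro _; simpa using hP
    | succ k ih =>
      intro hk
      have := h.ex (n := n) (P := fun a y => f (a ⟨k, hk⟩) = y ∧
        P fun i => if i.val < k then f (a i) else if i.val = k then y else a i) (h.and
          (h.eq (h.app hf (h.proj _)) (h.proj 0)) (by
            have := h.subst (n := n + 1) (ih (by omega))
              fun i => if i.val = k then 0 else i.succ
            convert this using 4 with w i
            by_cases hi : i.val = k
            · simp [hi]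
            · simp [hi]))
      simp only [exists_eq_left'] at this
      convert this using 4 with a i
      rcases lt_trichotomy i.val k with hi | hi | hi
      · rw [if_pos (by omega), if_pos hi]
      · have hi' : i = ⟨k, hk⟩ := Fin.ext hi
        rw [if_pos (by omega), if_neg (by omega), if_pos hi, hi']
      · rw [if_neg (by omega), if_neg (by omega), if_neg (by omega)]
  simpa [Function.comp_def] using key n le_rfl

theorem Background.isAut (h : 𝓜.Background) {π : Equiv.Perm M} (hπ : 𝓜.IPerm π) : 𝓜.IsAut π := by
  have key : ∀ {σ : Equiv.Perm M}, 𝓜.IPerm σ → ∀ (n : ℕ) (R : Set (Fin n → M)), R ∈ 𝓜.rel n →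
      relImage σ R ∈ 𝓜.rel n := by
    intro σ hσ n R hR
    have : 𝓜.Internal fun a : Fin n → M => σ.symm ∘ a ∈ R :=
      h.internal_comp (P := fun a => a ∈ R) hR (h.iPerm_symm hσ)
    have e : relImage σ R = {a | σ.symm ∘ a ∈ R} := Set.ext (mem_relImage σ R)
    rw [e]
    exact this
  intro n R
  refine ⟨key hπ n R, fun hR => ?_⟩
  have := key (h.iPerm_symm hπ) n _ hR
  rwa [relImage_symm_relImage] at this

theorem IsAut.ext_map {f : M ≃ M} (hf : 𝓜.IsAut f) (X : 𝓜.Concept) :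
    ext (hf.map X) = f '' ext X := by
  ext x
  change ![x] ∈ relImage f X.1 ↔ _
  rw [mem_relImage, mem_iff_mem_ext]
  simp

/-! ### The formula `E` -/

section

variable {E : L0Formula} (hobj : E.freeObj = ∅) (hrel : E.freeRel ⊆ {(1, 0), (1, 1)})
include hobj hrel

/-- Under an assignment `E` says that it holds of the values of the first two concept variables. -/
theorem sat0_iff (v : ℕ → M) (V : 𝓜.RelAssign) :
    𝓜.Sat0 E v V ↔ 𝓜.Holds2 E (V 1 0) (V 1 1) := by
  have key : ∀ v' (V' : 𝓜.RelAssign),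
      𝓜.Sat0 E v V ↔ 𝓜.Sat0 E v' ((V'.set 1 0 (V 1 0)).set 1 1 (V 1 1)) := by
    intro v' V'
    refine sat_congr _ E (fun i hi => ?_) fun p hp => ?_
    · rw [hobj] at hi; exact hi.elim
    · rcases hrel hp with rfl | rfl <;> simp
  exact ⟨fun q v' V' => (key v' V').1 q, fun q => (key v V).2 (q v V)⟩

theorem holds2_map (h : 𝓜.Background) {f : M ≃ M} (hf : 𝓜.IsAut f) (X Y : 𝓜.Concept) :
    𝓜.Holds2 E (hf.map X) (hf.map Y) ↔ 𝓜.Holds2 E X Y := by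
  have h1 := sat0_iff hobj hrel (fun _ => h.someObj) ((h.someRel.set 1 0 X).set 1 1 Y)
  rw [Sat0, hf.sat_iff (D' := fun d : Empty => d.elim) (fun d => d.elim), ← Sat0,
    sat0_iff hobj hrel] at h1
  simpa using h1

end

/-! ### Operators definable from others -/

end SOStructure

namespace SOFormula

variable {ι κ : Type}

/-- Existential quantification over the first `n` object variables of odd index. -/
def exOdd : ℕ → SOFormula ι → SOFormula ι
  | 0, φ => φ
  | n + 1, φ => exOdd n (.exObj (2 * n + 1) φ)

/-- The conjunction of the first `n` formulas of a sequence. -/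
def conj (f : ℕ → SOFormula ι) : ℕ → SOFormula ι
  | 0 => .eqv 0 0
  | n + 1 => .and (conj f n) (f n)

/-- Says that `x_z` is the value of a term in the signature `κ`, where `γ k j z` says that `x_z` is
the value of the operator `k` at `X_j`. -/
def valueIs (γ : κ → ℕ → ℕ → SOFormula ι) (z : ℕ) : SOTerm κ → SOFormula ι
  | .var i => .eqv z (2 * i)
  | .abs k j => γ k j z

/-- Translation of formulas in the signature `κ` along definitions `γ` of its operators in the
signature `ι`. Variables keep their names up to doubling of the index, so that those of odd index
are free for parameters and auxiliary quantifiers. -/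
def translate (γ : κ → ℕ → ℕ → SOFormula ι) : SOFormula κ → SOFormula ι
  | .eq s t => .exObj 1 (.and (valueIs γ 1 s) (valueIs γ 1 t))
  | .rel n j t => exOdd n (.and
      (conj (fun i => if hi : i < n then valueIs γ (2 * i + 1) (t ⟨i, hi⟩) else .eqv 0 0) n)
      (.rel n (2 * j) fun i => .var (2 * i + 1)))
  | .neg φ => .neg (translate γ φ)
  | .and φ ψ => .and (translate γ φ) (translate γ ψ)
  | .allObj i φ => .allObj (2 * i) (translate γ φ)
  | .allRel n j φ => .allRel n (2 * j) (translate γ φ)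

end SOFormula

namespace SOStructure

variable {M : Type u} {ι κ : Type} {𝓜 : SOStructure M}

theorem termVal_var (D : ι → 𝓜.Concept → M) (v : ℕ → M) (V : 𝓜.RelAssign) (i : ℕ) :
    𝓜.termVal D v V (.var i) = v i := rfl

/-- The assignment with values from `V` at even and from `V₀` at odd indices. -/
def interleave (V V₀ : 𝓜.RelAssign) : 𝓜.RelAssign :=
  fun n j => if j % 2 = 0 then V n (j / 2) else V₀ n (j / 2)

@[simp] theorem interleave_even (V V₀ : 𝓜.RelAssign) (n j : ℕ) :
    interleave V V₀ n (2 * j) = V n j := by simp [interleave]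

@[simp] theorem interleave_odd (V V₀ : 𝓜.RelAssign) (n j : ℕ) :
    interleave V V₀ n (2 * j + 1) = V₀ n j := by
  simp only [interleave]
  rw [if_neg (by omega)]
  congr 1
  omega

theorem interleave_set (V V₀ : 𝓜.RelAssign) (n j : ℕ) (R : 𝓜.Rel n) :
    interleave (V.set n j R) V₀ = (interleave V V₀).set n (2 * j) R := by
  funext m k
  by_cases hm : m = n
  · subst hm
    by_cases hk : k = 2 * j
    · subst hk; simp
    · rw [RelAssign.set_index_ne _ _ hk]
      simp only [interleave]
      split_ifs with hk'
      · rw [RelAssign.set_index_ne _ _ (by omega)]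
      · rfl
  · simp only [interleave, RelAssign.set_arity_ne _ _ _ hm]

theorem sat_exOdd (D : ι → 𝓜.Concept → M) (V : 𝓜.RelAssign) (n : ℕ) (φ : SOFormula ι) :
    ∀ v : ℕ → M, 𝓜.Sat D (.exOdd n φ) v V ↔
      ∃ a : ℕ → M, 𝓜.Sat D φ (fun i => if i % 2 = 1 ∧ i < 2 * n then a (i / 2) else v i) V := by
  induction n generalizing φ with
  | zero => intro v; simp [SOFormula.exOdd, show Nonempty M from ⟨v 0⟩]
  | succ n ih =>
    intro v
    rw [SOFormula.exOdd, ih]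
    simp only [sat_exObj]
    constructor
    · rintro ⟨a, b, q⟩
      refine ⟨Function.update a n b, ?_⟩
      convert q using 1
      funext i
      by_cases hi : i = 2 * n + 1
      · subst hi
        rw [if_pos (by omega), show (2 * n + 1) / 2 = n by omega]; simp
      · rw [Function.update_of_ne hi]
        by_cases hi' : i % 2 = 1 ∧ i < 2 * n
        · rw [if_pos hi', if_pos (by omega), Function.update_of_ne (by omega)]
        · rw [if_neg hi', if_neg (by omega)]
    · rintro ⟨a, q⟩
      refine ⟨a, a n, ?_⟩
      convert q using 1
      funext i
      by_cases hi : i = 2 * n + 1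
      · subst hi
        rw [if_pos (by omega), show (2 * n + 1) / 2 = n by omega]; simp
      · rw [Function.update_of_ne hi]
        by_cases hi' : i % 2 = 1 ∧ i < 2 * n
        · rw [if_pos hi', if_pos (by omega)]
        · rw [if_neg hi', if_neg (by omega)]

theorem sat_conj (D : ι → 𝓜.Concept → M) (v : ℕ → M) (V : 𝓜.RelAssign) (f : ℕ → SOFormula ι)
    (n : ℕ) : 𝓜.Sat D (.conj f n) v V ↔ ∀ i < n, 𝓜.Sat D (f i) v V := by
  induction n with
  | zero => simp [SOFormula.conj]
  | succ n ih =>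
    simp only [SOFormula.conj, sat_and, ih, Nat.lt_succ_iff_lt_or_eq]
    constructor
    · rintro ⟨h1, h2⟩ i (hi | rfl)
      · exact h1 i hi
      · exact h2
    · exact fun q => ⟨fun i hi => q i (Or.inl hi), q n (Or.inr rfl)⟩

section

variable {D : ι → 𝓜.Concept → M} {D' : κ → 𝓜.Concept → M} {γ : κ → ℕ → ℕ → SOFormula ι}
  {V₀ : 𝓜.RelAssign} (hγ : ∀ k j z (v : ℕ → M) (V : 𝓜.RelAssign),
    𝓜.Sat D (γ k j z) v (interleave V V₀) ↔ v z = D' k (V 1 j))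
include hγ

theorem sat_valueIs (v v' : ℕ → M) (V : 𝓜.RelAssign) (z : ℕ) (s : SOTerm κ)
    (hv : ∀ i, v' (2 * i) = v (2 * i)) :
    𝓜.Sat D (.valueIs γ z s) v' (interleave V V₀) ↔
      v' z = 𝓜.termVal D' (fun i => v (2 * i)) V s := by
  cases s with
  | var i => simp [SOFormula.valueIs, termVal, hv]
  | abs k j => exact hγ k j z v' V

theorem sat_translate (φ : SOFormula κ) : ∀ (v : ℕ → M) (V : 𝓜.RelAssign),
    𝓜.Sat D (φ.translate γ) v (interleave V V₀) ↔ 𝓜.Sat D' φ (fun i => v (2 * i)) V := by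
  induction φ with
  | eq s t =>
    intro v V
    simp only [SOFormula.translate, sat_exObj, sat_and]
    have hv : ∀ a i, Function.update v 1 a (2 * i) = v (2 * i) := fun a i =>
      Function.update_of_ne (by omega) _ _
    simp only [sat_valueIs hγ v _ V 1 _ (hv _), Function.update_self, exists_eq_left, Sat]
  | rel n j t =>
    intro v V
    simp only [SOFormula.translate, sat_exOdd, sat_and, sat_conj]
    have hv : ∀ (a : ℕ → M) i, (if 2 * i % 2 = 1 ∧ 2 * i < 2 * n then a (2 * i / 2)
        else v (2 * i)) = v (2 * i) := fun a i => if_neg (by omega)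
    have hodd : ∀ (a : ℕ → M) (i : ℕ), i < n → (if (2 * i + 1) % 2 = 1 ∧ 2 * i + 1 < 2 * n
        then a ((2 * i + 1) / 2) else v (2 * i + 1)) = a i := fun a i hi => by
      rw [if_pos (by omega)]
      congr 1
      omega
    have h1 : ∀ (a : ℕ → M), (∀ i < n, 𝓜.Sat D (if hi : i < n then
          SOFormula.valueIs γ (2 * i + 1) (t ⟨i, hi⟩) else SOFormula.eqv 0 0)
        (fun i => if i % 2 = 1 ∧ i < 2 * n then a (i / 2) else v i) (interleave V V₀)) ↔
        ∀ i : Fin n, a i = 𝓜.termVal D' (fun i => v (2 * i)) V (t i) := by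
      intro a
      constructor
      · intro q i
        have := q i i.2
        rw [dif_pos i.2, sat_valueIs hγ v _ V _ _ (hv a), hodd a i i.2] at this
        exact this
      · intro q i hi
        rw [dif_pos hi, sat_valueIs hγ v _ V _ _ (hv a), hodd a i hi]
        exact q ⟨i, hi⟩
    simp only [h1, Sat, interleave_even, termVal_var]
    have h2 : ∀ a : ℕ → M, (fun k : Fin n => if (2 * k.val + 1) % 2 = 1 ∧ 2 * k.val + 1 < 2 * n
        then a ((2 * k.val + 1) / 2) else v (2 * k.val + 1)) = fun k : Fin n => a k :=
      fun a => funext fun k => hodd a k k.2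
    simp only [h2]
    constructor
    · rintro ⟨a, q, q'⟩
      rwa [funext q] at q'
    · intro q
      refine ⟨fun i => if hi : i < n then 𝓜.termVal D' (fun i => v (2 * i)) V (t ⟨i, hi⟩)
        else v 0, fun i => by simp, ?_⟩
      simpa using q
  | neg φ ih => intro v V; exact not_congr (ih v V)
  | and φ ψ ih1 ih2 => intro v V; exact and_congr (ih1 v V) (ih2 v V)
  | allObj i φ ih =>
    intro v V
    refine forall_congr' fun a => (ih _ _).trans ?_
    have : (fun k => Function.update v (2 * i) a (2 * k)) =
        Function.update (fun k => v (2 * k)) i a := by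
      funext k
      by_cases hk : k = i
      · subst hk; simp
      · rw [Function.update_of_ne hk, Function.update_of_ne (by omega)]
    rw [this]
  | allRel n j φ ih =>
    intro v V
    refine forall_congr' fun R => ?_
    rw [← interleave_set]
    exact ih _ _

/-- Comprehension, and with it the background logic, extends to operators that are definable from the given ones. -/
theorem IsModel.of_definable (h : 𝓜.IsModel D) : 𝓜.IsModel D' := by
  refine ⟨h.1, h.2, fun n φ v V => ?_, h.4, h.5, h.6, h.7⟩
  have h1 : 𝓜.Internal fun w : Fin (2 * n) → M => 𝓜.Sat D (φ.translate γ)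
      (fun i => if hi : i < 2 * n then w ⟨i, hi⟩ else v (i / 2)) (interleave V V₀) :=
    Background.internal_of_sat h (φ.translate γ) (fun i => v (i / 2)) (interleave V V₀)
      fun _ => Iff.rfl
  have h2 := h.background.subst (n := n) h1 fun i => ⟨i / 2, by omega⟩
  simp only [sat_translate hγ] at h2
  have e : ∀ a : Fin n → M, (fun i => if hi : i < n then a ⟨i, hi⟩ else v i) = fun i =>
      if hi : 2 * i < 2 * n then a ⟨2 * i / 2, by omega⟩ else v (2 * i / 2) := fun a => by
    funext i
    have hi' : 2 * i / 2 = i := by omega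
    simp only [hi']
    by_cases hi : i < n
    · rw [dif_pos hi, dif_pos (by omega)]
    · rw [dif_neg hi, dif_neg (by omega)]
  simp only [e]
  exact h2

end

/-! ### Cardinal comparisons as formulas -/

end SOStructure

namespace SOFormula

variable {ι : Type}

/-- Says that the relation `R` of index `0` is an injection of the class of the `x_i` with `a i`
into that of the `x_i` with `b i`. -/
def isInj (a b : ℕ → SOFormula ι) : SOFormula ι :=
  .and (.allObj 10 (.imp (a 10) (.and (.exObj 11 (.and (b 11) (.app 10 11 0)))
      (.allObj 11 (.allObj 12 (.imp (.and (b 11) (.app 10 11 0))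
        (.imp (.and (b 12) (.app 10 12 0)) (.eqv 11 12))))))))
    (.allObj 10 (.imp (a 10) (.allObj 11 (.imp (a 11) (.allObj 12 (.imp (b 12)
      (.imp (.app 10 12 0) (.imp (.app 11 12 0) (.eqv 10 11)))))))))

/-- Says that there is an injection of the class of the `x_i` with `a i` into that of the `x_i`
with `b i`. -/
def cardLE (a b : ℕ → SOFormula ι) : SOFormula ι := .exRel 2 0 (isInj a b)

/-- Says that the classes given by `a` and `b` are equinumerous. -/
def cardEq (a b : ℕ → SOFormula ι) : SOFormula ι := .exRel 2 0 (.and (isInj a b)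
  (.allObj 10 (.imp (b 10) (.exObj 11 (.and (a 11) (.app 11 10 0))))))

/-- Says that the concepts `X_j` and `X_k` are bicardinally equivalent. -/
def bic (j k : ℕ) : SOFormula ι :=
  .and (cardEq (fun i => .mem i j) fun i => .mem i k)
    (cardEq (fun i => .neg (.mem i j)) fun i => .neg (.mem i k))

end SOFormula

namespace SOStructure

variable {M : Type u} {ι κ : Type} {𝓜 : SOStructure M}

section

variable {D : ι → 𝓜.Concept → M} {V : 𝓜.RelAssign} {a b : ℕ → SOFormula ι} {A B : Set M}
  (ha : ∀ i v F, 𝓜.Sat D (a i) v (V.set 2 0 F) ↔ v i ∈ A)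
  (hb : ∀ i v F, 𝓜.Sat D (b i) v (V.set 2 0 F) ↔ v i ∈ B)
include ha hb

theorem sat_isInj (v : ℕ → M) (F : 𝓜.Rel 2) :
    𝓜.Sat D (.isInj a b) v (V.set 2 0 F) ↔ 𝓜.IsInj F A B := by
  simp only [SOFormula.isInj, sat_and, sat_allObj, sat_imp, sat_exObj, sat_app, sat_eqv, ha, hb,
    RelAssign.set_same, Function.update_self, ne_eq, Nat.reduceEqDiff,
    not_false_eq_true, Function.update_of_ne]
  refine and_congr (forall₂_congr fun x hx => ?_) Iff.rfl
  constructor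
  · rintro ⟨⟨y, q⟩, q'⟩
    exact ⟨y, q, fun z r => q' z y r q⟩
  · rintro ⟨y, q, q'⟩
    exact ⟨⟨y, q⟩, fun z z' r r' => (q' z r).trans (q' z' r').symm⟩

theorem sat_cardLE (v : ℕ → M) : 𝓜.Sat D (.cardLE a b) v V ↔ 𝓜.CardLE A B := by
  simp only [SOFormula.cardLE, sat_exRel, sat_isInj ha hb, CardLE]

theorem sat_cardEq (v : ℕ → M) : 𝓜.Sat D (.cardEq a b) v V ↔ 𝓜.CardEq A B := by
  simp only [SOFormula.cardEq, sat_exRel, sat_and, sat_isInj ha hb, CardEq, sat_allObj, sat_imp,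
    sat_exObj, sat_app, ha, hb, RelAssign.set_same, Function.update_self, ne_eq,
    Nat.reduceEqDiff, not_false_eq_true, Function.update_of_ne]

end

theorem sat_bic (D : ι → 𝓜.Concept → M) (v : ℕ → M) (V : 𝓜.RelAssign) (j k : ℕ) :
    𝓜.Sat D (.bic j k) v V ↔ 𝓜.BicardEquiv (V 1 j) (V 1 k) := by
  rw [SOFormula.bic, sat_and, sat_cardEq (A := ext (V 1 j)) (B := ext (V 1 k)) (by simp) (by simp),
    sat_cardEq (A := (ext (V 1 j))ᶜ) (B := (ext (V 1 k))ᶜ) (by simp) (by simp)]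
  rfl

end SOStructure

/-! ### Free variables and the formulas for the least-cardinality principle -/

namespace SOFormula
variable {ι : Type}

@[simp] theorem freeObj_neg (φ : SOFormula ι) : (neg φ).freeObj = φ.freeObj := rfl
@[simp] theorem freeObj_and (φ ψ : SOFormula ι) : (and φ ψ).freeObj = φ.freeObj ∪ ψ.freeObj := rfl
@[simp] theorem freeObj_or (φ ψ : SOFormula ι) : (or φ ψ).freeObj = φ.freeObj ∪ ψ.freeObj := rfl
@[simp] theorem freeObj_imp (φ ψ : SOFormula ι) : (imp φ ψ).freeObj = φ.freeObj ∪ ψ.freeObj := rfl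
@[simp] theorem freeObj_iff (φ ψ : SOFormula ι) : (iff φ ψ).freeObj = φ.freeObj ∪ ψ.freeObj := by
  rw [iff, freeObj_and, freeObj_imp, freeObj_imp, Set.union_comm ψ.freeObj, Set.union_self]
@[simp] theorem freeObj_allObj (i : ℕ) (φ : SOFormula ι) :
    (allObj i φ).freeObj = φ.freeObj \ {i} := rfl
@[simp] theorem freeObj_exObj (i : ℕ) (φ : SOFormula ι) :
    (exObj i φ).freeObj = φ.freeObj \ {i} := rfl
@[simp] theorem freeObj_exRel (n j : ℕ) (φ : SOFormula ι) :
    (exRel n j φ).freeObj = φ.freeObj := rfl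
@[simp] theorem freeObj_mem (i j : ℕ) : (mem i j : SOFormula ι).freeObj = {i} := by
  simp [mem, freeObj, SOTerm.freeObj]
@[simp] theorem freeObj_app (i k j : ℕ) : (app i k j : SOFormula ι).freeObj = {i, k} := by
  ext x; simp [app, freeObj, SOTerm.freeObj]
@[simp] theorem freeObj_eqv (i k : ℕ) : (eqv i k : SOFormula ι).freeObj = {i, k} := rfl

@[simp] theorem freeRel_neg (φ : SOFormula ι) : (neg φ).freeRel = φ.freeRel := rfl
@[simp] theorem freeRel_and (φ ψ : SOFormula ι) : (and φ ψ).freeRel = φ.freeRel ∪ ψ.freeRel := rfl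
@[simp] theorem freeRel_or (φ ψ : SOFormula ι) : (or φ ψ).freeRel = φ.freeRel ∪ ψ.freeRel := rfl
@[simp] theorem freeRel_imp (φ ψ : SOFormula ι) : (imp φ ψ).freeRel = φ.freeRel ∪ ψ.freeRel := rfl
@[simp] theorem freeRel_iff (φ ψ : SOFormula ι) : (iff φ ψ).freeRel = φ.freeRel ∪ ψ.freeRel := by
  rw [iff, freeRel_and, freeRel_imp, freeRel_imp, Set.union_comm ψ.freeRel, Set.union_self]
@[simp] theorem freeRel_allObj (i : ℕ) (φ : SOFormula ι) : (allObj i φ).freeRel = φ.freeRel := rfl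
@[simp] theorem freeRel_exObj (i : ℕ) (φ : SOFormula ι) : (exObj i φ).freeRel = φ.freeRel := rfl
@[simp] theorem freeRel_exRel (n j : ℕ) (φ : SOFormula ι) :
    (exRel n j φ).freeRel = φ.freeRel \ {(n, j)} := rfl
@[simp] theorem freeRel_mem (i j : ℕ) : (mem i j : SOFormula ι).freeRel = {(1, j)} := by
  ext x; simp [mem, freeRel, SOTerm.freeRel]
@[simp] theorem freeRel_app (i k j : ℕ) : (app i k j : SOFormula ι).freeRel = {(2, j)} := by
  ext x; simp [app, freeRel, SOTerm.freeRel]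
@[simp] theorem freeRel_eqv (i k : ℕ) : (eqv i k : SOFormula ι).freeRel = ∅ := by
  simp [eqv, freeRel, SOTerm.freeRel]

variable {a b : ℕ → SOFormula ι}

theorem freeObj_cardLE (ha : ∀ i, (a i).freeObj = {i}) (hb : ∀ i, (b i).freeObj = {i}) :
    (cardLE a b).freeObj = ∅ := by
  ext x; simp [cardLE, isInj, ha, hb]; try grind

theorem freeObj_cardEq (ha : ∀ i, (a i).freeObj = {i}) (hb : ∀ i, (b i).freeObj = {i}) :
    (cardEq a b).freeObj = ∅ := by
  ext x; simp [cardEq, isInj, ha, hb]; try grind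

theorem freeRel_cardLE {S T : Set (ℕ × ℕ)} (ha : ∀ i, (a i).freeRel = S)
    (hb : ∀ i, (b i).freeRel = T) : (cardLE a b).freeRel ⊆ S ∪ T := by
  intro x; simp [cardLE, isInj, ha, hb]; try grind

theorem freeRel_cardEq {S T : Set (ℕ × ℕ)} (ha : ∀ i, (a i).freeRel = S)
    (hb : ∀ i, (b i).freeRel = T) : (cardEq a b).freeRel ⊆ S ∪ T := by
  intro x; simp [cardEq, isInj, ha, hb]; try grind

@[simp] theorem freeObj_bic (j k : ℕ) : (bic j k : SOFormula ι).freeObj = ∅ := by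
  simp [bic, freeObj_cardEq]

theorem freeRel_bic (j k : ℕ) : (bic j k : SOFormula ι).freeRel ⊆ {(1, j), (1, k)} := by
  have h1 := freeRel_cardEq (a := fun i => (mem i j : SOFormula ι)) (b := fun i => mem i k)
    (S := {(1, j)}) (T := {(1, k)}) (by simp) (by simp)
  have h2 := freeRel_cardEq (a := fun i => (neg (mem i j) : SOFormula ι))
    (b := fun i => neg (mem i k)) (S := {(1, j)}) (T := {(1, k)}) (by simp) (by simp)
  rw [Set.singleton_union] at h1 h2
  exact Set.union_subset h1 h2

/-- Says that `X_j` is Dedekind infinite. -/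
def infin (j : ℕ) : SOFormula ι := .exRel 1 (j + 1) (.and
  (.and (.allObj 0 (.imp (.mem 0 (j + 1)) (.mem 0 j)))
    (.exObj 0 (.and (.mem 0 j) (.neg (.mem 0 (j + 1))))))
  (.cardLE (fun i => .mem i j) fun i => .mem i (j + 1)))

@[simp] theorem freeObj_infin (j : ℕ) : (infin j : SOFormula ι).freeObj = ∅ := by
  simp [infin, freeObj_cardLE]

theorem freeRel_infin (j : ℕ) : (infin j : SOFormula ι).freeRel ⊆ {(1, j)} := by
  have h1 := freeRel_cardLE (a := fun i => (mem i j : SOFormula ι)) (b := fun i => mem i (j + 1))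
    (S := {(1, j)}) (T := {(1, j + 1)}) (by simp) (by simp)
  intro x
  simp only [infin, freeRel_exRel, freeRel_and, freeRel_allObj, freeRel_imp, freeRel_mem,
    freeRel_exObj, freeRel_neg]
  have := @h1 x
  grind

/-- Says that some concept bicardinally equivalent to `X₀` is not `E`-equivalent to it, and that
`X₀` is no larger than its complement. -/
def smallBad (E : SOFormula ι) : SOFormula ι :=
  .and (.exRel 1 1 (.and (.bic 0 1) (.neg E)))
    (.cardLE (fun i => .mem i 0) fun i => .neg (.mem i 0))

/-- Says that `X₀` is the difference of two bicardinally equivalent, `E`-inequivalent concepts the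
first of which is finite and `E`-equivalent to the result of exchanging one of its elements. -/
def diffBad (E : SOFormula ι) : SOFormula ι :=
  .exRel 1 2 (.and (.allObj 0 (.iff (.mem 0 2) (.mem 0 0))) (.exRel 1 0 (.exRel 1 1 (.and
    (.and (.allObj 0 (.iff (.mem 0 2) (.and (.mem 0 0) (.neg (.mem 0 1)))))
      (.and (.bic 0 1) (.and (.neg E) (.neg (.infin 0)))))
    (.exObj 0 (.exObj 1 (.and (.and (.mem 0 0) (.neg (.mem 1 0))) (.exRel 1 1 (.and
      (.allObj 2 (.iff (.mem 2 1) (.or (.eqv 2 1) (.and (.mem 2 0) (.neg (.eqv 2 0))))))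
      E)))))))))

variable {E : SOFormula ι} (hobj : E.freeObj = ∅) (hrel : E.freeRel ⊆ {(1, 0), (1, 1)})

include hobj in
theorem freeObj_smallBad : (smallBad E).freeObj = ∅ := by
  simp [smallBad, freeObj_cardLE, hobj]

include hrel in
theorem freeRel_smallBad : (smallBad E).freeRel ⊆ {(1, 0)} := by
  have h1 := freeRel_cardLE (a := fun i => (mem i 0 : SOFormula ι)) (b := fun i => neg (mem i 0))
    (S := {(1, 0)}) (T := {(1, 0)}) (by simp) (by simp)
  have h2 := freeRel_bic (ι := ι) 0 1
  intro x
  simp only [smallBad, freeRel_exRel, freeRel_and, freeRel_neg]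
  have := @h1 x
  have := @h2 x
  have := @hrel x
  grind

include hobj in
theorem freeObj_diffBad : (diffBad E).freeObj = ∅ := by
  ext x
  simp [diffBad, hobj]
  try grind

include hrel in
theorem freeRel_diffBad : (diffBad E).freeRel ⊆ {(1, 0)} := by
  have h1 := freeRel_infin (ι := ι) 0
  have h2 := freeRel_bic (ι := ι) 0 1
  intro x
  simp only [diffBad, freeRel_exRel, freeRel_and, freeRel_neg, freeRel_allObj, freeRel_iff,
    freeRel_mem, freeRel_exObj, freeRel_or, freeRel_eqv]
  have := @h1 x
  have := @h2 x
  have := @hrel x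
  simp only [Set.mem_sdiff, Set.mem_union, Set.mem_insert_iff, Set.mem_singleton_iff,
    Set.mem_empty_iff_false] at *
  tauto

end SOFormula

namespace SOStructure

variable {M : Type u} {ι : Type} {𝓜 : SOStructure M}

theorem sat_infin (D : ι → 𝓜.Concept → M) (v : ℕ → M) (V : 𝓜.RelAssign) (j : ℕ) :
    𝓜.Sat D (.infin j) v V ↔ 𝓜.DedekindInfinite (V 1 j) := by
  rw [SOFormula.infin, sat_exRel, DedekindInfinite]
  refine exists_congr fun Z => ?_
  rw [sat_and, sat_cardLE (A := ext (V 1 j)) (B := ext Z) (by simp) (by simp),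
    Set.ssubset_iff_exists]
  simp [Set.subset_def]

variable {E : L0Formula} (hobj : E.freeObj = ∅) (hrel : E.freeRel ⊆ {(1, 0), (1, 1)})
include hobj hrel

theorem holds1_smallBad (h : 𝓜.Background) (X : 𝓜.Concept) : 𝓜.Holds1 (.smallBad E) X ↔
    (∃ Y, 𝓜.BicardEquiv X Y ∧ ¬ 𝓜.Holds2 E X Y) ∧ 𝓜.CardLE (ext X) (ext X)ᶜ := by
  have hs : ∀ v (V : 𝓜.RelAssign), 𝓜.Sat0 (.smallBad E) v (V.set 1 0 X) ↔
      (∃ Y, 𝓜.BicardEquiv X Y ∧ ¬ 𝓜.Holds2 E X Y) ∧ 𝓜.CardLE (ext X) (ext X)ᶜ := by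
    intro v V
    have hE : ∀ v V, 𝓜.Sat (fun d : Empty => d.elim) E v V ↔ 𝓜.Holds2 E (V 1 0) (V 1 1) :=
      sat0_iff hobj hrel
    rw [Sat0, SOFormula.smallBad, sat_and, sat_cardLE (A := ext X) (B := (ext X)ᶜ) (by simp)
      (by simp), sat_exRel]
    simp [sat_bic, hE, -Subtype.exists]
  exact ⟨fun q => (hs (fun _ => h.someObj) h.someRel).1 (q _ _), fun q v V => (hs v V).2 q⟩

theorem holds1_diffBad (h : 𝓜.Background) (D : 𝓜.Concept) : 𝓜.Holds1 (.diffBad E) D ↔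
    ∃ X Y : 𝓜.Concept, ext D = ext X \ ext Y ∧ 𝓜.BicardEquiv X Y ∧ ¬ 𝓜.Holds2 E X Y ∧
      ¬ 𝓜.DedekindInfinite X ∧ ∃ x ∈ ext X, ∃ z ∉ ext X, ∃ W : 𝓜.Concept,
        ext W = insert z (ext X \ {x}) ∧ 𝓜.Holds2 E X W := by
  have hs : ∀ v (V : 𝓜.RelAssign), 𝓜.Sat0 (.diffBad E) v (V.set 1 0 D) ↔
    ∃ X Y : 𝓜.Concept, ext D = ext X \ ext Y ∧ 𝓜.BicardEquiv X Y ∧ ¬ 𝓜.Holds2 E X Y ∧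
      ¬ 𝓜.DedekindInfinite X ∧ ∃ x ∈ ext X, ∃ z ∉ ext X, ∃ W : 𝓜.Concept,
        ext W = insert z (ext X \ {x}) ∧ 𝓜.Holds2 E X W := by
    intro v V
    have hE : ∀ v V, 𝓜.Sat (fun d : Empty => d.elim) E v V ↔ 𝓜.Holds2 E (V 1 0) (V 1 1) :=
      sat0_iff hobj hrel
    have hD : ∀ D' : 𝓜.Concept, (∀ x, x ∈ ext D' ↔ x ∈ ext D) ↔ D' = D := fun D' =>
      ⟨fun q => ext_injective (Set.ext q), fun q => by simp [q]⟩
    simp [Sat0, SOFormula.diffBad, sat_bic, sat_infin, hE, hD, -Subtype.exists, Set.ext_iff, and_assoc]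
  exact ⟨fun q => (hs (fun _ => h.someObj) h.someRel).1 (q _ _), fun q v V => (hs v V).2 q⟩

end SOStructure

/-! ### The operator of a model as a function on sets -/

namespace SOStructure

variable {M : Type u} {𝓜 : SOStructure M} {A B X Y : Set M}

open Classical in
/-- An operator on concepts as a function on sets of objects, with an arbitrary value at the sets
which are not extensions of concepts. -/
noncomputable def setOp [Nonempty M] (δ : 𝓜.Concept → M) (A : Set M) : M :=
  if hA : 𝓜.ISet A then δ hA.concept else Classical.arbitrary M

theorem setOp_eq [Nonempty M] (δ : 𝓜.Concept → M) (hA : 𝓜.ISet A) :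
    setOp δ A = δ hA.concept := dif_pos hA

@[simp] theorem setOp_ext [Nonempty M] (δ : 𝓜.Concept → M) (X : 𝓜.Concept) :
    setOp δ (ext X) = δ X := by
  rw [setOp_eq δ (iSet_ext X), concept_iSet_ext]

theorem exists_iSet_iff {P : Set M → Prop} :
    (∃ Z, 𝓜.ISet Z ∧ P Z) ↔ ∃ Z : 𝓜.Concept, P (ext Z) :=
  ⟨fun ⟨_, hZ, q⟩ => ⟨hZ.concept, by rwa [ISet.ext_concept]⟩, fun ⟨Z, q⟩ => ⟨_, iSet_ext Z, q⟩⟩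

theorem Background.bicardEquiv_iff_bic (h : 𝓜.Background) (X Y : 𝓜.Concept) :
    𝓜.BicardEquiv X Y ↔ 𝓜.Bic (ext X) (ext Y) := h.bicardEquiv_iff X Y

theorem IsAut.map_concept {f : M ≃ M} (hf : 𝓜.IsAut f) (hA : 𝓜.ISet A) (hB : 𝓜.ISet (f '' A)) :
    hf.map hA.concept = hB.concept :=
  ext_injective (by rw [hf.ext_map, ISet.ext_concept, ISet.ext_concept])

section

variable [Nonempty M] {E : L0Formula} {δ : 𝓜.Concept → M}
  (hobj : E.freeObj = ∅) (hrel : E.freeRel ⊆ {(1, 0), (1, 1)})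
  (h : 𝓜.IsModel fun _ : Unit => δ) (hE : 𝓜.AbstractionPrinciple E δ)

include h in
theorem setOp_family {R : M → M → Prop} (hR : 𝓜.IRel R) :
    𝓜.IFun fun m => setOp δ {y | R m y} := by
  have hi : ∀ m, 𝓜.ISet {y | R m y} := fun m => hR.iSet h.background m
  refine Background.internal_of_sat h (.exRel 1 0 (.and
    (.allObj 2 (.iff (.mem 2 0) (.app 0 2 0))) (.isAbs 1 () 0)))
    (fun _ => h.someObj) (h.someRel.set 2 0 hR.toRel) fun a => ?_
  simp [-Subtype.exists]
  constructor
  · intro q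
    exact ⟨(hi (a 0)).concept, fun y => by rw [ISet.ext_concept]; rfl, by rw [← setOp_eq δ (hi (a 0)), q]⟩
  · rintro ⟨Z, hZ, q⟩
    have : {y | R (a 0) y} = ext Z := by ext y; exact (hZ y).symm
    rw [this, setOp_ext, q]

include h in
theorem setOp_few (hX : 𝓜.ISet X) (hY : 𝓜.ISet Y) :
    𝓜.ISet {x | ∃ Z, 𝓜.ISet Z ∧ setOp δ Z = x ∧ 𝓜.Bic X Z ∧ ¬ 𝓜.Embeds Z (Z ∩ Y)} := by
  have hb := h.background
  refine Background.internal_of_sat h (.exRel 1 0 (.and (.isAbs 0 () 0) (.and (.bic 1 0)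
    (.neg (.cardLE (fun i => .mem i 0) fun i => .and (.mem i 0) (.mem i 2))))))
    (fun _ => h.someObj) ((h.someRel.set 1 1 hX.concept).set 1 2 hY.concept) fun a => ?_
  rw [Set.mem_ofPred_eq, exists_iSet_iff, sat_exRel]
  refine exists_congr fun Z => ?_
  rw [sat_and, sat_and, sat_bic, sat_neg, sat_cardLE (A := ext Z) (B := ext Z ∩ Y) (by simp)
    (by simp), hb.cardLE_iff (iSet_ext Z) (hb.inter (iSet_ext Z) hY), hb.bicardEquiv_iff_bic]
  simp [eq_comm]

include h in
theorem setOp_diagonal {L₀ L₁ : M → M → Prop} (h₀ : 𝓜.IRel L₀) (h₁ : 𝓜.IRel L₁) :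
    𝓜.ISet {x | ∃ Z, 𝓜.ISet Z ∧ setOp δ Z = x ∧
      (∀ y, y ∈ Z ↔ ∃ c, ((∀ z, L₀ c z → z ∈ Z) ∧ L₀ c y) ∨ (¬ (∀ z, L₀ c z → z ∈ Z) ∧ L₁ c y)) ∧
      ¬ ∀ z, L₀ x z → z ∈ Z} := by
  refine Background.internal_of_sat h (.exRel 1 0 (.and (.isAbs 0 () 0) (.and
    (.allObj 1 (.iff (.mem 1 0) (.exObj 2 (.or
      (.and (.allObj 3 (.imp (.app 2 3 0) (.mem 3 0))) (.app 2 1 0))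
      (.and (.neg (.allObj 3 (.imp (.app 2 3 0) (.mem 3 0)))) (.app 2 1 1))))))
    (.neg (.allObj 3 (.imp (.app 0 3 0) (.mem 3 0)))))))
    (fun _ => h.someObj) ((h.someRel.set 2 0 h₀.toRel).set 2 1 h₁.toRel) fun a => ?_
  rw [Set.mem_ofPred_eq, exists_iSet_iff, sat_exRel]
  refine exists_congr fun Z => ?_
  simp [eq_comm]

include hE in
theorem setOp_eq_iff (hA : 𝓜.ISet A) (hB : 𝓜.ISet B) :
    setOp δ A = setOp δ B ↔ 𝓜.Holds2 E hA.concept hB.concept := by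
  rw [setOp_eq δ hA, setOp_eq δ hB, hE]

include hobj hrel h hE

theorem setOp_image_eq {π : Equiv.Perm M} (hπ : 𝓜.IPerm π) (hA : 𝓜.ISet A) (hB : 𝓜.ISet B)
    (e : setOp δ A = setOp δ B) : setOp δ (π '' A) = setOp δ (π '' B) := by
  have hb := h.background
  have hf := hb.isAut hπ
  have iA := hb.image hπ hA
  have iB := hb.image hπ hB
  rw [setOp_eq_iff hE iA iB, ← hf.map_concept hA iA, ← hf.map_concept hB iB,
    holds2_map hobj hrel hb, ← setOp_eq_iff hE hA hB]
  exact e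

/-- Suppose that `E` holds between a finite concept `X` and the result of exchanging one of its
elements, but not between all bicardinally equivalent ones. Among the differences of pairs of
the latter some `X' \ Y'` is of least cardinality. Exchanging an element of `X' \ Y'` for one of
`Y' \ X'` makes it smaller, and so shows it to be infinite. -/
theorem setOp_swap (hX : 𝓜.ISet X) (hY : 𝓜.ISet Y) (bXY : 𝓜.Bic X Y) (hf : ¬ 𝓜.Infin X)
    (hs : ∃ x ∈ X, ∃ z ∉ X, setOp δ X = setOp δ (insert z (X \ {x}))) :
    setOp δ X = setOp δ Y := by
  classical
  have hb := h.background
  by_contra hne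
  -- The formula `diffBad`, in terms of sets.
  have hΦ : ∀ D : 𝓜.Concept, 𝓜.Holds1 (.diffBad E) D ↔ ∃ X Y, 𝓜.ISet X ∧ 𝓜.ISet Y ∧
      ext D = X \ Y ∧ 𝓜.Bic X Y ∧ setOp δ X ≠ setOp δ Y ∧ ¬ 𝓜.Infin X ∧
      ∃ x ∈ X, ∃ z ∉ X, setOp δ X = setOp δ (insert z (X \ {x})) := by
    intro D
    rw [holds1_diffBad hobj hrel hb]
    constructor
    · rintro ⟨X, Y, e, b, n, i, x, hx, z, hz, W, hW, q⟩
      refine ⟨ext X, ext Y, iSet_ext X, iSet_ext Y, e, (hb.bicardEquiv_iff_bic X Y).1 b, ?_, ?_,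
        x, hx, z, hz, ?_⟩
      · rw [setOp_ext, setOp_ext, Ne, hE]; exact n
      · rw [← hb.dedekindInfinite_iff (iSet_ext X), concept_iSet_ext]; exact i
      · rw [← hW, setOp_ext, setOp_ext, hE]; exact q
    · rintro ⟨X, Y, iX, iY, e, b, n, i, x, hx, z, hz, q⟩
      have iW := hb.insert z (hb.diff iX (hb.singleton x))
      refine ⟨iX.concept, iY.concept, by simpa using e, ?_, ?_, ?_, x, by simpa using hx, z,
        by simpa using hz, iW.concept, by simp, ?_⟩
      · rw [hb.bicardEquiv_iff_bic]; simpa using b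
      · rw [← setOp_eq_iff hE iX iY]; exact n
      · rwa [hb.dedekindInfinite_iff]
      · rwa [← setOp_eq_iff hE iX iW]
  obtain ⟨D, hD, hmin⟩ := hb.wellFounded (.diffBad E) (SOFormula.freeObj_diffBad hobj)
    (SOFormula.freeRel_diffBad hrel) ⟨(hb.diff hX hY).concept, (hΦ _).2
      ⟨X, Y, hX, hY, by simp, bXY, hne, hf, hs⟩⟩
  obtain ⟨X', Y', iX, iY, e, b, n, i, x, hx, z, hz, q⟩ := (hΦ D).1 hD
  have hn : ¬ X' ⊆ Y' := fun hs => by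
    have iY' : ¬ 𝓜.Infin Y' := fun q => i
      (hb.infin_of_embeds iY iX q (hb.equi_symm iX iY b.1).embeds)
    rw [hb.eq_of_subset_of_embeds iY' hs (hb.equi_symm iX iY b.1).embeds] at n
    exact n rfl
  have hn' : ¬ Y' ⊆ X' := fun hs => by
    rw [hb.eq_of_subset_of_embeds i hs b.1.embeds] at n
    exact n rfl
  obtain ⟨p, hpX, hpY⟩ := Set.not_subset.1 hn
  obtain ⟨r, hrY, hrX⟩ := Set.not_subset.1 hn'
  have hpr : p ≠ r := fun e => hrX (e ▸ hpX)
  have iW := hb.insert r (hb.diff iX (hb.singleton p))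
  set W := insert r (X' \ {p}) with hW
  have hd : ∀ {π : Equiv.Perm M}, setOp δ X' = setOp δ (insert z (X' \ {x})) → 𝓜.IPerm π →
      π '' X' = X' → π '' insert z (X' \ {x}) = W → setOp δ X' = setOp δ W := by
    intro π q hπ e1 e2
    have := setOp_image_eq hobj hrel h hE hπ iX (hb.insert z (hb.diff iX (hb.singleton x))) q
    rwa [e1, e2] at this
  have eW : setOp δ X' = setOp δ W := by
    have hσ := hb.iPerm_trans (hb.iPerm_swap x p) (hb.iPerm_swap z r)
    refine hd q hσ ?_ ?_
    · ext y
      rw [Set.mem_image_equiv, Equiv.symm_trans_apply, Equiv.symm_swap, Equiv.symm_swap]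
      simp only [Equiv.swap_apply_def]
      grind
    · ext y
      rw [Set.mem_image_equiv, Equiv.symm_trans_apply, Equiv.symm_swap, Equiv.symm_swap]
      simp only [Equiv.swap_apply_def, hW, Set.mem_sdiff, Set.mem_insert_iff,
        Set.mem_singleton_iff]
      grind
  have bW : 𝓜.Bic W Y' := hb.bic_trans (hb.bic_symm iX iW (bic_exchange hb hpX hrX)) b
  have iD : 𝓜.ISet (ext D \ {p}) := hb.diff (iSet_ext D) (hb.singleton p)
  have hD' : 𝓜.Holds1 (.diffBad E) iD.concept := by
    refine (hΦ _).2 ⟨W, Y', iW, iY, ?_, bW, eW ▸ n, fun q => i (hb.infin_of_embeds iW iX q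
      (hb.equi_symm iX iW (bic_exchange hb hpX hrX).1).embeds), r, Or.inl rfl, p, ?_, ?_⟩
    · rw [ISet.ext_concept, e]
      ext y
      simp only [hW, Set.mem_sdiff, Set.mem_insert_iff, Set.mem_singleton_iff]
      grind
    · simp only [hW, Set.mem_sdiff, Set.mem_insert_iff, Set.mem_singleton_iff]
      tauto
    · have : insert p (W \ {r}) = X' := by
        ext y
        simp only [hW, Set.mem_sdiff, Set.mem_insert_iff, Set.mem_singleton_iff]
        grind
      rw [this, eW]
  have hle := hmin _ hD'
  rw [ISet.ext_concept, hb.cardLE_iff (iSet_ext D) iD] at hle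
  have hDf : ¬ 𝓜.Infin (ext D) := fun q => i (hb.infin_of_embeds (iSet_ext D) iX q
    (hb.embeds_of_subset (by rw [e]; exact Set.sdiff_subset)))
  have := hb.eq_of_subset_of_embeds hDf Set.sdiff_subset hle
  have hpD : p ∈ ext D := e ▸ ⟨hpX, hpY⟩
  rw [← this] at hpD
  exact hpD.2 rfl

theorem naming_setOp : 𝓜.Naming (setOp δ) where
  image_eq := setOp_image_eq hobj hrel h hE
  family := setOp_family h
  few := setOp_few h
  diagonal := setOp_diagonal h
  swap := setOp_swap hobj hrel h hE

end

end SOStructure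

namespace SOStructure

variable {M : Type u} {𝓜 : SOStructure M} {A B X Y Z : Set M} {d : Set M → M}

/-! ### Isomorphisms of induced models -/

theorem relImage_relImage {N K : Type u} {n : ℕ} (f : M → N) (g : N → K) (R : Set (Fin n → M)) :
    relImage g (relImage f R) = relImage (g ∘ f) R := by
  simp only [relImage, Set.image_image]
  rfl

theorem relImage_eq_self {n : ℕ} {f : M → M} (hf : ∀ x, f x = x) (R : Set (Fin n → M)) :
    relImage f R = R := by
  have : f = fun x => x := funext hf
  subst this
  exact Set.image_id R

/-- The models induced by surjective operators are isomorphic exactly if an automorphism of the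
structure carries one operator to the other. -/
theorem inducedIsomorphic_iff {δ₁ δ₂ : 𝓜.Concept → M} (h₁ : Function.Surjective δ₁)
    (h₂ : Function.Surjective δ₂) : 𝓜.InducedIsomorphic δ₁ δ₂ ↔
      ∃ (f : M ≃ M) (hf : 𝓜.IsAut f), ∀ X, f (δ₁ X) = δ₂ (hf.map X) := by
  let e₁ : Set.range δ₁ ≃ M := Equiv.subtypeUnivEquiv h₁
  let e₂ : Set.range δ₂ ≃ M := Equiv.subtypeUnivEquiv h₂
  constructor
  · rintro ⟨g, hg, hg'⟩
    let f : M ≃ M := e₁.symm.trans (g.trans e₂)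
    have k₁ : ∀ {n} (R : Set (Fin n → M)), relImage Subtype.val (relImage e₁.symm R) = R :=
      fun R => (relImage_relImage _ _ R).trans (relImage_eq_self (fun _ => rfl) R)
    have k₂ : ∀ {n} (R : Set (Fin n → M)),
        relImage Subtype.val (relImage g (relImage e₁.symm R)) = relImage f R := fun R => by
      rw [relImage_relImage, relImage_relImage]; rfl
    have hf : 𝓜.IsAut f := fun n R => by
      have := hg n (relImage e₁.symm R)
      simp only [induced, Set.mem_ofPred_eq, k₁, k₂] at this
      exact this
    refine ⟨f, hf, fun X => ?_⟩
    have q := hg' ⟨relImage e₁.symm X.1, by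
        simp only [induced, Set.mem_ofPred_eq, k₁]; exact X.2⟩
      ⟨relImage g (relImage e₁.symm X.1), by
        simp only [induced, Set.mem_ofPred_eq, k₂]; exact (hf.map X).2⟩ rfl
    have q' := congrArg Subtype.val q
    simp only [inducedOp, k₁, k₂] at q'
    exact q'
  · rintro ⟨f, hf, hf'⟩
    let g : Set.range δ₁ ≃ Set.range δ₂ := e₁.trans (f.trans e₂.symm)
    have k : ∀ {n} (R : Set (Fin n → Set.range δ₁)),
        relImage Subtype.val (relImage g R) = relImage f (relImage Subtype.val R) := fun R => by
      rw [relImage_relImage, relImage_relImage]; rfl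
    refine ⟨g, fun n R => ?_, fun X Y hY => ?_⟩
    · simp only [induced, Set.mem_ofPred_eq, k]
      exact hf n _
    · apply Subtype.ext
      change f (δ₁ _) = δ₂ _
      rw [hf']
      congr 1
      apply Subtype.ext
      change relImage f (relImage Subtype.val X.1) = relImage Subtype.val Y.1
      rw [hY, k]

/-! ### Automorphisms preserve cardinal notions -/

namespace IsAut

variable {f : M ≃ M} (hf : 𝓜.IsAut f)
include hf

theorem internal {n : ℕ} {P : (Fin n → M) → Prop} (hP : 𝓜.Internal P) :
    𝓜.Internal fun a => P (f.symm ∘ a) := by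
  have e : {a : Fin n → M | P (f.symm ∘ a)} = relImage f {a | P a} :=
    Set.ext fun a => (mem_relImage f {a | P a} a).symm
  unfold Internal
  rw [e]
  exact (hf n _).1 hP

theorem iSet_image (hA : 𝓜.ISet A) : 𝓜.ISet (f '' A) := by
  have : 𝓜.ISet {x | f.symm x ∈ A} := hf.internal hA
  rwa [Equiv.image_eq_preimage_symm]

theorem ifun {g : M → M} (hg : 𝓜.IFun g) : 𝓜.IFun (f ∘ g ∘ f.symm) := by
  have : 𝓜.IRel fun x y => g (f.symm x) = f.symm y := hf.internal hg
  simpa only [IFun, Function.comp_apply, ← Equiv.eq_symm_apply] using this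

theorem embeds_image (hAB : 𝓜.Embeds A B) : 𝓜.Embeds (f '' A) (f '' B) := by
  obtain ⟨g, hg, hm, hi⟩ := hAB
  refine ⟨_, hf.ifun hg, ?_, ?_⟩
  · rintro _ ⟨x, hx, rfl⟩
    simpa using hm hx
  · rintro _ ⟨x, hx, rfl⟩ _ ⟨y, hy, rfl⟩ q
    simp only [Function.comp_apply, Equiv.symm_apply_apply, EmbeddingLike.apply_eq_iff_eq] at q ⊢
    exact hi hx hy q

theorem embeds_image_iff : 𝓜.Embeds (f '' A) (f '' B) ↔ 𝓜.Embeds A B := by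
  refine ⟨fun q => ?_, hf.embeds_image⟩
  have := hf.symm.embeds_image q
  rwa [Equiv.symm_image_image, Equiv.symm_image_image] at this

theorem equi_image (hAB : 𝓜.Equi A B) : 𝓜.Equi (f '' A) (f '' B) := by
  obtain ⟨g, hg, hb⟩ := hAB
  refine ⟨_, hf.ifun hg, ?_, ?_, ?_⟩
  · rintro _ ⟨x, hx, rfl⟩
    simpa using hb.mapsTo hx
  · rintro _ ⟨x, hx, rfl⟩ _ ⟨y, hy, rfl⟩ q
    simp only [Function.comp_apply, Equiv.symm_apply_apply, EmbeddingLike.apply_eq_iff_eq] at q ⊢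
    exact hb.injOn hx hy q
  · rintro _ ⟨y, hy, rfl⟩
    obtain ⟨x, hx, rfl⟩ := hb.surjOn hy
    exact ⟨f x, ⟨x, hx, rfl⟩, by simp⟩

theorem bic_image (hAB : 𝓜.Bic A B) : 𝓜.Bic (f '' A) (f '' B) := by
  refine ⟨hf.equi_image hAB.1, ?_⟩
  rw [← Set.image_compl_eq f.bijective, ← Set.image_compl_eq f.bijective]
  exact hf.equi_image hAB.2

end IsAut

/-! ### Permuting the abstracts -/

section

variable {E : L0Formula} {δ : 𝓜.Concept → M}
  (hobj : E.freeObj = ∅) (hrel : E.freeRel ⊆ {(1, 0), (1, 1)})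
  (h : 𝓜.IsModel fun _ : Unit => δ) (hE : 𝓜.AbstractionPrinciple E δ)
include hobj hrel h hE

/-- If some concept no larger than its complement is bicardinally equivalent to an inequivalent one,
the abstracts can be permuted in two ways that are not isomorphic. -/
theorem exists_iPerm_of_smallBad (hbad : ∃ X, 𝓜.Holds1 (.smallBad E) X) :
    ∃ π₁ π₂ : Equiv.Perm M, 𝓜.IPerm π₁ ∧ 𝓜.IPerm π₂ ∧
      ¬ ∃ (f : M ≃ M) (hf : 𝓜.IsAut f), ∀ X, f (π₁ (δ X)) = π₂ (δ (hf.map X)) := by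
  have hne := h.nonempty_obj
  have hb := h.background
  set d : Set M → M := setOp δ with hd
  have nd : 𝓜.Naming d := naming_setOp hobj hrel h hE
  have hΦ : ∀ X : 𝓜.Concept, 𝓜.Holds1 (.smallBad E) X ↔
      𝓜.Bad d (ext X) ∧ 𝓜.Embeds (ext X) (ext X)ᶜ := by
    intro X
    rw [holds1_smallBad hobj hrel hb, hb.cardLE_iff (iSet_ext X) (hb.compl (iSet_ext X)), Bad,
      exists_iSet_iff]
    simp only [hb.bicardEquiv_iff_bic, hd, setOp_ext, Ne, hE X _]
  have op : ∀ {π₁ π₂ : Equiv.Perm M} {f : M ≃ M} (hf : 𝓜.IsAut f),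
      (∀ X, f (π₁ (δ X)) = π₂ (δ (hf.map X))) →
      ∀ {A : Set M}, 𝓜.ISet A → f (π₁ (d A)) = π₂ (d (f '' A)) := by
    intro π₁ π₂ f hf hX A hA
    rw [hd, setOp_eq δ hA, setOp_eq δ (hf.iSet_image hA), hX, hf.map_concept hA]
  by_cases hM : 𝓜.Infin (Set.univ : Set M)
  · obtain ⟨X₀, hX₀, hmin⟩ := hb.wellFounded (.smallBad E) (SOFormula.freeObj_smallBad hobj)
      (SOFormula.freeRel_smallBad hrel) hbad
    -- The concepts bicardinally equivalent to the least such `X₀` are permuted by automorphisms.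
    have bigc : ∀ {X : Set M}, 𝓜.ISet X → 𝓜.Embeds X Xᶜ → 𝓜.Big Xᶜ := fun iX eX =>
      (hb.big_compl_or hM iX).elim (fun q => hb.big_of_embeds q eX) id
    have iX₀ := iSet_ext X₀
    obtain ⟨bX₀, eX₀⟩ := (hΦ X₀).1 hX₀
    set C := ext X₀ with hC
    have badim : ∀ {f : M ≃ M}, 𝓜.IsAut f → ∀ {X : Set M}, 𝓜.ISet X →
        𝓜.Bad d X ∧ 𝓜.Embeds X Xᶜ → 𝓜.Bad d (f '' X) ∧ 𝓜.Embeds (f '' X) (f '' X)ᶜ := by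
      rintro f hf X iX ⟨⟨Y, iY, bY, hne⟩, eX⟩
      refine ⟨⟨f '' Y, hf.iSet_image iY, hf.bic_image bY, fun q => hne ?_⟩, ?_⟩
      · rw [hd, setOp_eq_iff hE (hf.iSet_image iX) (hf.iSet_image iY), ← hf.map_concept iX,
          ← hf.map_concept iY, holds2_map hobj hrel hb, ← setOp_eq_iff hE iX iY] at q
        exact q
      · rw [← Set.image_compl_eq f.bijective]
        exact hf.embeds_image eX
    have hmin' : ∀ {X : Set M}, 𝓜.ISet X → 𝓜.Bad d X ∧ 𝓜.Embeds X Xᶜ → 𝓜.Embeds C X := by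
      intro X iX hX
      have := hmin iX.concept ((hΦ _).2 (by rwa [ISet.ext_concept]))
      rwa [ISet.ext_concept, hb.cardLE_iff iX₀ iX] at this
    have orbit : ∀ {f : M ≃ M}, 𝓜.IsAut f → 𝓜.Bic C (f '' C) := by
      intro f hf
      have iC := hf.iSet_image iX₀
      have bC := badim hf iX₀ ⟨bX₀, eX₀⟩
      refine bic_of_equi_of_big hb iX₀ (bigc iX₀ eX₀) iC (hb.equi_of_embeds iX₀ iC
        (hmin' iC bC) ?_) (bigc iC bC.2)
      have := hf.embeds_image (hmin' (hf.symm.iSet_image iX₀) (badim hf.symm iX₀ ⟨bX₀, eX₀⟩))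
      rwa [Equiv.image_symm_image] at this
    obtain ⟨π₁, iπ₁, S, iS, hS⟩ := exists_iPerm_liar hb nd hM iX₀ (bigc iX₀ eX₀) bX₀
    obtain ⟨π₂, iπ₂, hπ₂⟩ := exists_iPerm_no_liar hb nd hM iX₀ (bigc iX₀ eX₀) bX₀
    refine ⟨π₁, π₂, iπ₁, iπ₂, ?_⟩
    rintro ⟨f, hf, hX⟩
    refine hπ₂ ⟨f '' S, hf.iSet_image iS, fun Z iZ bZ => ?_⟩
    have iZ' := hf.symm.iSet_image iZ
    have hZ : f '' (f.symm '' Z) = Z := Equiv.image_symm_image _ _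
    have := hS _ iZ' (hb.bic_trans (orbit hf.symm) (hf.symm.bic_image bZ))
    rw [← hf.embeds_image_iff, Set.image_inter f.injective, hZ] at this
    rw [← this]
    conv_lhs => rw [← hZ]
    rw [← op hf hX iZ', f.injective.mem_set_image]
  · obtain ⟨X₀, hX₀⟩ := hbad
    obtain ⟨bX₀, eX₀⟩ := (hΦ X₀).1 hX₀
    obtain ⟨π₁, π₂, iπ₁, iπ₂, h₁, h₂⟩ := exists_iPerm_pairs hb nd hM (iSet_ext X₀) eX₀ bX₀
    refine ⟨π₁, π₂, iπ₁, iπ₂, ?_⟩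
    rintro ⟨f, hf, hX⟩
    refine h₂ fun t ht => ?_
    have e0 : f (π₁ (d ∅)) = π₂ (d ∅) := by rw [op hf hX hb.empty, Set.image_empty]
    have e1 := h₁ (f.symm t) fun q => ht (by rw [← e0, ← q, Equiv.apply_symm_apply])
    have e2 := op hf hX (hb.insert (π₁ (d ∅)) (hb.singleton (f.symm t)))
    rw [Set.image_pair, e0, Equiv.apply_symm_apply] at e2
    rw [← e2]
    exact (congrArg f e1).trans (Equiv.apply_symm_apply f t)

end

end SOStructure

namespace SOStructure

variable {M : Type u} {𝓜 : SOStructure M}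

/-! ### Passing to complements -/

/-- The complement of a concept. -/
def Background.complConcept (h : 𝓜.Background) (X : 𝓜.Concept) : 𝓜.Concept :=
  ISet.concept (h.compl (iSet_ext X))

@[simp] theorem Background.ext_complConcept (h : 𝓜.Background) (X : 𝓜.Concept) :
    ext (h.complConcept X) = (ext X)ᶜ := ISet.ext_concept _

/-- The formula `E (Xᶜ, Yᶜ)`. -/
def complFormula (E : L0Formula) : L0Formula :=
  .exRel 1 2 (.and (.allObj 0 (.iff (.mem 0 2) (.neg (.mem 0 0))))
    (.exRel 1 3 (.and (.allObj 0 (.iff (.mem 0 3) (.neg (.mem 0 1))))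
      (.exRel 1 0 (.and (.allObj 0 (.iff (.mem 0 0) (.mem 0 2)))
        (.exRel 1 1 (.and (.allObj 0 (.iff (.mem 0 1) (.mem 0 3))) E)))))))

theorem freeObj_complFormula {E : L0Formula} (hobj : E.freeObj = ∅) :
    (complFormula E).freeObj = ∅ := by
  simp [complFormula, hobj]

theorem freeRel_complFormula {E : L0Formula} (hrel : E.freeRel ⊆ {(1, 0), (1, 1)}) :
    (complFormula E).freeRel ⊆ {(1, 0), (1, 1)} := by
  intro x
  have := @hrel x
  simp only [complFormula, SOFormula.freeRel_exRel, SOFormula.freeRel_and, SOFormula.freeRel_neg,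
    SOFormula.freeRel_allObj, SOFormula.freeRel_iff, SOFormula.freeRel_mem, Set.mem_sdiff,
    Set.mem_union, Set.mem_insert_iff, Set.mem_singleton_iff] at *
  tauto

section

variable {E : L0Formula} {δ : 𝓜.Concept → M}
  (hobj : E.freeObj = ∅) (hrel : E.freeRel ⊆ {(1, 0), (1, 1)})

include hobj hrel in
theorem holds2_complFormula (h : 𝓜.Background) (X Y : 𝓜.Concept) :
    𝓜.Holds2 (complFormula E) X Y ↔ 𝓜.Holds2 E (h.complConcept X) (h.complConcept Y) := by
  have hE : ∀ v V, 𝓜.Sat (fun d : Empty => d.elim) E v V ↔ 𝓜.Holds2 E (V 1 0) (V 1 1) :=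
    sat0_iff hobj hrel
  have h1 := sat0_iff (freeObj_complFormula hobj) (freeRel_complFormula hrel)
    (fun _ => h.someObj) ((h.someRel.set 1 0 X).set 1 1 Y)
  have hc : ∀ Z Z' : 𝓜.Concept, (∀ x, x ∈ ext Z ↔ x ∉ ext Z') ↔ Z = h.complConcept Z' := by
    refine fun Z Z' => ⟨fun q => ext_injective (Set.ext fun x => ?_), ?_⟩
    · rw [Background.ext_complConcept]; exact q x
    · rintro rfl x
      rw [Background.ext_complConcept]; rfl
  have he : ∀ Z Z' : 𝓜.Concept, (∀ x, x ∈ ext Z ↔ x ∈ ext Z') ↔ Z = Z' := fun Z Z' =>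
    ⟨fun q => ext_injective (Set.ext q), fun q => by simp [q]⟩
  simp [Sat0, complFormula, hE, hc, he, -Subtype.exists] at h1
  exact h1.symm

/-- The operator `∂ (Xᶜ)` belongs to a model of the background logic, too. -/
theorem IsModel.complement (h : 𝓜.IsModel fun _ : Unit => δ) :
    𝓜.IsModel fun _ : Unit => fun X => δ (h.background.complConcept X) := by
  refine h.of_definable (V₀ := h.someRel) (γ := fun _ j z => .exRel 1 (2 * j + 1) (.and
    (.allObj (z + 1) (.iff (.mem (z + 1) (2 * j + 1)) (.neg (.mem (z + 1) (2 * j)))))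
    (.isAbs z () (2 * j + 1)))) fun _ j z v V => ?_
  have hc : ∀ Z Z' : 𝓜.Concept, (∀ x, x ∈ ext Z ↔ x ∉ ext Z') ↔
      Z = h.background.complConcept Z' := by
    refine fun Z Z' => ⟨fun q => ext_injective (Set.ext fun x => ?_), ?_⟩
    · rw [Background.ext_complConcept]; exact q x
    · rintro rfl x
      rw [Background.ext_complConcept]; rfl
  simp [hc, -Subtype.exists]

/-! ### Models with two operators -/

/-- Internal permutations of the abstracts give a model with two operators. -/
theorem IsModel.permute (h : 𝓜.IsModel fun _ : Unit => δ) {π₁ π₂ : Equiv.Perm M}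
    (h₁ : 𝓜.IPerm π₁) (h₂ : 𝓜.IPerm π₂) : 𝓜.IsModel ![π₁ ∘ δ, π₂ ∘ δ] := by
  refine h.of_definable (V₀ := (h.someRel.set 2 0 (IFun.toRel h₁)).set 2 1 (IFun.toRel h₂))
    (γ := fun k j z => .exObj (z + 1) (.and (.isAbs (z + 1) () (2 * j))
      (.app (z + 1) z (2 * k.val + 1)))) fun k j z v V => ?_
  simp only [sat_exObj, sat_and, sat_isAbs, sat_app, interleave_odd, interleave_even,
    Function.update_self, exists_eq_left, Function.update_of_ne (Nat.succ_ne_self z).symm]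
  fin_cases k
  · simpa using (IFun.mem_toRel (f := π₁) h₁ (δ (V 1 j)) (v z)).trans eq_comm
  · simpa using (IFun.mem_toRel (f := π₂) h₂ (δ (V 1 j)) (v z)).trans eq_comm

include hobj hrel

/-- If `E` is not implied by bicardinal equivalence, the abstracts can be permuted in two ways that
are not isomorphic. -/
theorem exists_iPerm_of_not_bicardCoarse (h : 𝓜.IsModel fun _ : Unit => δ)
    (hE : 𝓜.AbstractionPrinciple E δ) (hc : ¬ 𝓜.BicardCoarse E) :
    ∃ π₁ π₂ : Equiv.Perm M, 𝓜.IPerm π₁ ∧ 𝓜.IPerm π₂ ∧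
      ¬ ∃ (f : M ≃ M) (hf : 𝓜.IsAut f), ∀ X, f (π₁ (δ X)) = π₂ (δ (hf.map X)) := by
  have hb := h.background
  simp only [BicardCoarse, not_forall] at hc
  obtain ⟨X, Y, bXY, hne⟩ := hc
  rcases hb.embeds_total (iSet_ext X) (hb.compl (iSet_ext X)) with e | e
  · refine exists_iPerm_of_smallBad hobj hrel h hE ⟨X, (holds1_smallBad hobj hrel hb X).2
      ⟨⟨Y, bXY, hne⟩, ?_⟩⟩
    exact (hb.cardLE_iff (iSet_ext X) (hb.compl (iSet_ext X))).2 e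
  · have hobj' := freeObj_complFormula hobj
    have hrel' := freeRel_complFormula hrel
    have cc : ∀ Z, hb.complConcept (hb.complConcept Z) = Z := fun Z => ext_injective (by simp)
    have hE' : 𝓜.AbstractionPrinciple (complFormula E) fun X => δ (hb.complConcept X) :=
      fun X Y => (hE _ _).trans (holds2_complFormula hobj hrel hb X Y).symm
    have hbad : ∃ Z, 𝓜.Holds1 (.smallBad (complFormula E)) Z := by
      refine ⟨hb.complConcept X, (holds1_smallBad hobj' hrel' hb _).2
        ⟨⟨hb.complConcept Y, ?_, ?_⟩, ?_⟩⟩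
      · rw [BicardEquiv] at bXY ⊢
        simpa using bXY.symm
      · rwa [holds2_complFormula hobj hrel hb, cc, cc]
      · rw [Background.ext_complConcept, compl_compl]
        exact (hb.cardLE_iff (hb.compl (iSet_ext X)) (iSet_ext X)).2 e
    obtain ⟨π₁, π₂, i₁, i₂, hn⟩ := exists_iPerm_of_smallBad hobj' hrel' h.complement hE' hbad
    refine ⟨π₁, π₂, i₁, i₂, ?_⟩
    rintro ⟨f, hf, hX⟩
    refine hn ⟨f, hf, fun Z => ?_⟩
    rw [hX]
    congr 2
    refine ext_injective ?_
    rw [hf.ext_map, Background.ext_complConcept, Background.ext_complConcept, hf.ext_map,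
      Set.image_compl_eq f.bijective]

omit hobj hrel in
/-- If `E` is implied by bicardinal equivalence, the correspondence `∂₁ X ↦ ∂₂ X` is a permutation in
the structure, and hence an isomorphism. -/
theorem inducedIsomorphic_of_bicardCoarse {δ₁ δ₂ : 𝓜.Concept → M} (h : 𝓜.ModelsA2 E δ₁ δ₂)
    (h₁ : Function.Surjective δ₁) (h₂ : Function.Surjective δ₂) (hc : 𝓜.BicardCoarse E) :
    𝓜.InducedIsomorphic δ₁ δ₂ := by
  obtain ⟨hm, hE₁, hE₂⟩ := h
  have hb := hm.background
  rw [inducedIsomorphic_iff h₁ h₂]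
  have heq : ∀ X Y, δ₁ X = δ₁ Y ↔ δ₂ X = δ₂ Y := fun X Y => (hE₁ X Y).trans (hE₂ X Y).symm
  let g : M → M := fun x => δ₂ (Function.surjInv h₁ x)
  have hg : ∀ X, g (δ₁ X) = δ₂ X := fun X => (heq _ _).1 (Function.surjInv_eq h₁ _)
  have bij : Function.Bijective g := by
    constructor
    · intro x y q
      obtain ⟨X, rfl⟩ := h₁ x
      obtain ⟨Y, rfl⟩ := h₁ y
      rw [hg, hg] at q
      exact (heq X Y).2 q
    · intro y
      obtain ⟨X, rfl⟩ := h₂ y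
      exact ⟨δ₁ X, hg X⟩
  have ig : 𝓜.IFun g := by
    refine Background.internal_of_sat hm (.exRel 1 0 (.and (.isAbs 0 0 0) (.isAbs 1 1 0)))
      (fun _ => hm.someObj) hm.someRel fun a => ?_
    simp [-Subtype.exists]
    constructor
    · intro q
      obtain ⟨X, hX⟩ := h₁ (a 0)
      exact ⟨X, hX.symm, by rw [← hg, hX, q]⟩
    · rintro ⟨X, q, q'⟩
      rw [q, q', hg]
  let f : Equiv.Perm M := Equiv.ofBijective g bij
  have hf : 𝓜.IPerm f := ig
  refine ⟨f, hb.isAut hf, fun X => (hg X).trans ((hE₂ _ _).2 (hc _ _ ?_))⟩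
  rw [hb.bicardEquiv_iff_bic, IsAut.ext_map]
  exact hb.bic_image hf _

end

end SOStructure

/-! ### The theorem -/

/-- `E(X₀, X₁)` is any `L₀`-formula without further free variables. The first part is the
equivalence inside one structure carrying surjective operators for `A_E`, the second part the
equivalence for the theory `A_E`. -/
theorem mainTheorem7 (E : L0Formula) (hobj : E.freeObj = ∅)
    (hrel : E.freeRel ⊆ {(1, 0), (1, 1)}) :
    (∀ (M : Type u) (𝓜 : SOStructure M) (δ₁ δ₂ : 𝓜.Concept → M),
      𝓜.ModelsA2 E δ₁ δ₂ → Function.Surjective δ₁ → Function.Surjective δ₂ →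
      ((∀ ε₁ ε₂ : 𝓜.Concept → M, 𝓜.ModelsA2 E ε₁ ε₂ →
          Function.Surjective ε₁ → Function.Surjective ε₂ → 𝓜.InducedIsomorphic ε₁ ε₂) ↔
        𝓜.BicardCoarse E)) ∧
    ((∀ (M : Type u) (𝓜 : SOStructure M) (δ₁ δ₂ : 𝓜.Concept → M),
        𝓜.ModelsA2 E δ₁ δ₂ → Function.Surjective δ₁ → Function.Surjective δ₂ →
        𝓜.InducedIsomorphic δ₁ δ₂) ↔
      BicardCoarseningOnAbstracts.{u} E) := by
  have part₁ : ∀ (M : Type u) (𝓜 : SOStructure M) (δ : 𝓜.Concept → M),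
      𝓜.ModelsA E δ → Function.Surjective δ →
      ((∀ ε₁ ε₂ : 𝓜.Concept → M, 𝓜.ModelsA2 E ε₁ ε₂ →
          Function.Surjective ε₁ → Function.Surjective ε₂ → 𝓜.InducedIsomorphic ε₁ ε₂) ↔
        𝓜.BicardCoarse E) := by
    intro M 𝓜 δ ⟨h, hE⟩ hs
    refine ⟨fun H => ?_, fun hc ε₁ ε₂ h₁₂ h₁ h₂ =>
      SOStructure.inducedIsomorphic_of_bicardCoarse h₁₂ h₁ h₂ hc⟩
    by_contra hc
    obtain ⟨π₁, π₂, i₁, i₂, hn⟩ := SOStructure.exists_iPerm_of_not_bicardCoarse hobj hrel h hE hc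
    have s₁ : Function.Surjective (π₁ ∘ δ) := π₁.surjective.comp hs
    have s₂ : Function.Surjective (π₂ ∘ δ) := π₂.surjective.comp hs
    exact hn ((SOStructure.inducedIsomorphic_iff s₁ s₂).1 (H _ _ ⟨h.permute i₁ i₂,
      fun X Y => π₁.apply_eq_iff_eq.trans (hE X Y),
      fun X Y => π₂.apply_eq_iff_eq.trans (hE X Y)⟩ s₁ s₂))
  have first : ∀ (M : Type u) (𝓜 : SOStructure M) (δ₁ δ₂ : 𝓜.Concept → M),
      𝓜.ModelsA2 E δ₁ δ₂ → 𝓜.ModelsA E δ₁ := fun M 𝓜 δ₁ δ₂ h =>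
    ⟨h.1.reduct (fun _ => 0) rfl, h.2.1⟩
  refine ⟨fun M 𝓜 δ₁ δ₂ h h₁ _ => part₁ M 𝓜 δ₁ (first M 𝓜 δ₁ δ₂ h) h₁, ?_, ?_⟩
  · exact fun H M 𝓜 δ h hs => (part₁ M 𝓜 δ h hs).1 (H M 𝓜)
  · exact fun H M 𝓜 δ₁ δ₂ h h₁ h₂ => (part₁ M 𝓜 δ₁ (first M 𝓜 δ₁ δ₂ h) h₁).2
      (H M 𝓜 δ₁ (first M 𝓜 δ₁ δ₂ h) h₁) δ₁ δ₂ h h₁ h₂
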